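/- Let $M$ be a smooth compact connected manifold (Hausdorff, without boundary) of dimension $m$, let $E\to M$ be a smooth real vector bundle of finite rank, and let $|\Lambda_M|$ be the line bundle of $1$-densities on $M$. Let $C^{-\infty}(E)$ be the space of generalized sections of $E$, i.e. of continuous linear functionals on $C^\infty(E^*\otimes|\Lambda_M|)$ (with its natural $C^\infty$ topology), equipped with its Borel $\sigma$-algebra. Regard $C^\infty(E)$ as a subspace of $C^{-\infty}(E)$ through the injection $s\mapsto\bigl(\varphi\mapsto\int_M\langle\varphi,s\rangle\bigr)$. For $\varphi\in C^\infty(E^*\otimes|\Lambda_M|)$ put $L_\varphi(T)=T(\varphi)$, $T\in C^{-\infty}(E)$. Let $\boldsymbol\Gamma$ be a smooth Gaussian measure on $C^{-\infty}(E)$ with covariance density $C\in C^\infty(E\boxtimes E)$. This means that $\boldsymbol\Gamma$ is a Borel probability measure on $C^{-\infty}(E)$, that for every $\varphi\in C^\infty(E^*\otimes|\Lambda_M|)$ the pushforward of $\boldsymbol\Gamma$ by $L_\varphi$ is a centered Gaussian measure on $\mathbb R$ (possibly the Dirac measure at $0$), and that $$\boldsymbol E_{\boldsymbol\Gamma}(L_\varphi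 L_\psi)=\int_{M\times M}C_{x,y}\bigl(\varphi(x),\psi(y)\bigr)\qquad\text{for all }\varphi,\psi\in C^\infty(E^*\otimes|\Lambda_M|),$$ where $C_{x,y}:E_x^*\times E_y^*\to\mathbb R$, $C_{x,y}(u^*,v^*)=\langle u^*\otimes v^*,C(x,y)\rangle$, is extended to densities with values in $E_x^*$ and $E_y^*$, so that the integrand is a density on $M\times M$. Then, for the probability measure that $\boldsymbol\Gamma$ induces on $C^\infty(E)$, for every positive integer $n$, all points $x_1,\dots,x_n\in M$ and all $u_i^*\in E_{x_i}^*$, $i=1,\dots,n$, the map $$C^\infty(E)\ni\varphi\mapsto\bigl(X_1(\varphi),\dots,X_n(\varphi)\bigr)\in\mathbb R^n,\qquad X_i(\varphi)=\langle u_i^*,\varphi(x_i)\rangle,$$ is a (measurable) centered Gaussian random vector, and $$\boldsymbol E(X_iX_j)=C_{x_i,x_j}(u_i^*,u_j^*)\qquad\text{for all }i,j.$$ -/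

import Mathlib

open Bundle MeasureTheory ProbabilityTheory
open scoped Manifold ContDiff Bundle Topology NNReal

noncomputable section

namespace GaussianSections

/-! ### The density line bundle of a manifold -/

section Density

variable (m : ℕ) (M : Type*) [TopologicalSpace M] [ChartedSpace (EuclideanSpace ℝ (Fin m)) M]
  [IsManifold (𝓡 m) ∞ M]

/-- The cocycle of the line bundle `|Λ_M|` of `1`-densities. In the chart `i` a density is
`g_i |dy_i|` with a real coefficient `g_i`, and the coefficients in two charts are related by
`g_j = |det (∂ y_i / ∂ y_j)| g_i`; the Jacobian matrix `∂ y_i / ∂ y_j` is the coordinate change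
from `j` to `i` of the tangent bundle. -/
def densityCore : VectorBundleCore ℝ M ℝ (atlas (EuclideanSpace ℝ (Fin m)) M) where
  baseSet i := i.1.source
  isOpen_baseSet i := i.1.open_source
  indexAt := achart (EuclideanSpace ℝ (Fin m))
  mem_baseSet_at := mem_chart_source _
  coordChange i j x :=
    |((tangentBundleCore (𝓡 m) M).coordChange j i x).det| • ContinuousLinearMap.id ℝ ℝ
  coordChange_self i x hx v := by
    have : (tangentBundleCore (𝓡 m) M).coordChange i i x = ContinuousLinearMap.id ℝ _ := by
      ext1 v
      exact (tangentBundleCore (𝓡 m) M).coordChange_self i x hx v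
    rw [this]
    simp [ContinuousLinearMap.det]
  continuousOn_coordChange i j := by
    have h := (tangentBundleCore (𝓡 m) M).continuousOn_coordChange j i
    rw [Set.inter_comm]
    exact ((ContinuousLinearMap.continuous_det.comp_continuousOn h).abs).smul continuousOn_const
  coordChange_comp i j k x hx v := by
    have : (tangentBundleCore (𝓡 m) M).coordChange k i x =
        ((tangentBundleCore (𝓡 m) M).coordChange j i x).comp
          ((tangentBundleCore (𝓡 m) M).coordChange k j x) := by
      ext1 w
      exact ((tangentBundleCore (𝓡 m) M).coordChange_comp k j i x
        ⟨⟨hx.2, hx.1.2⟩, hx.1.1⟩ w).symm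
    rw [this]
    have hd : ∀ A B : EuclideanSpace ℝ (Fin m) →L[ℝ] EuclideanSpace ℝ (Fin m),
        (A.comp B).det = A.det * B.det := fun A B => LinearMap.det_comp _ _
    rw [hd, abs_mul]
    simp only [smul_apply, ContinuousLinearMap.id_apply, smul_eq_mul]
    ring

theorem contDiff_clm_det :
    ContDiff ℝ ∞ (fun A : EuclideanSpace ℝ (Fin m) →L[ℝ] EuclideanSpace ℝ (Fin m) => A.det) := by
  let b := (EuclideanSpace.basisFun (Fin m) ℝ).toBasis
  have h : (fun A : EuclideanSpace ℝ (Fin m) →L[ℝ] EuclideanSpace ℝ (Fin m) => A.det) =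
      fun A => ∑ σ : Equiv.Perm (Fin m), ((Equiv.Perm.sign σ : ℤ) : ℝ) *
        ∏ i, (A (b i)) (σ i) := by
    funext A
    rw [ContinuousLinearMap.det, ← LinearMap.det_toMatrix b, Matrix.det_apply']
    refine Finset.sum_congr rfl fun σ _ => ?_
    congr 1
    refine Finset.prod_congr rfl fun i _ => ?_
    simp [LinearMap.toMatrix_apply, b]
  rw [h]
  refine ContDiff.sum fun σ _ => contDiff_const.mul (contDiff_prod fun i _ => ?_)
  exact ((EuclideanSpace.proj (𝕜 := ℝ) (σ i)).comp
    (ContinuousLinearMap.apply ℝ (EuclideanSpace ℝ (Fin m)) (b i))).contDiff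

instance : (densityCore m M).IsContMDiff (𝓡 m) ∞ where
  contMDiffOn_coordChange i j := by
    have : IsManifold (𝓡 m) (∞ + 1) M := ‹IsManifold (𝓡 m) ∞ M›
    have hT : (tangentBundleCore (𝓡 m) M).IsContMDiff (𝓡 m) ∞ :=
      tangentBundleCore.isContMDiff (n := ∞)
    have h := VectorBundleCore.contMDiffOn_coordChange (tangentBundleCore (𝓡 m) M) (n := ∞)
      (𝓡 m) j i
    intro x hx
    have hx' : x ∈ j.1.source ∩ i.1.source := ⟨hx.2, hx.1⟩
    have hdet : ((tangentBundleCore (𝓡 m) M).coordChange j i x).det ≠ 0 := by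
      have hc : ((tangentBundleCore (𝓡 m) M).coordChange i j x).comp
          ((tangentBundleCore (𝓡 m) M).coordChange j i x) = ContinuousLinearMap.id ℝ _ := by
        ext1 w
        refine ((tangentBundleCore (𝓡 m) M).coordChange_comp j i j x
          ⟨hx', hx.2⟩ w).trans ?_
        exact (tangentBundleCore (𝓡 m) M).coordChange_self j x hx.2 w
      have hd : ((tangentBundleCore (𝓡 m) M).coordChange i j x).det *
          ((tangentBundleCore (𝓡 m) M).coordChange j i x).det = 1 := by
        have := congrArg ContinuousLinearMap.det hc
        refine Eq.trans (LinearMap.det_comp _ _).symm (this.trans ?_)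
        simp [ContinuousLinearMap.det]
      exact right_ne_zero_of_mul_eq_one hd
    have h1 : ContMDiffWithinAt (𝓡 m) 𝓘(ℝ, ℝ) ∞
        (fun x => |((tangentBundleCore (𝓡 m) M).coordChange j i x).det|)
        (j.1.source ∩ i.1.source) x := by
      have hA := ContDiffAt.abs ((contDiff_clm_det m).contDiffAt (x :=
        (tangentBundleCore (𝓡 m) M).coordChange j i x)) hdet
      exact hA.contMDiffAt.comp_contMDiffWithinAt x (h x hx')
    have h2 := h1.smul (contMDiffWithinAt_const (I' := 𝓘(ℝ, ℝ →L[ℝ] ℝ))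
      (c := ContinuousLinearMap.id ℝ ℝ))
    exact h2.mono fun y hy => ⟨hy.2, hy.1⟩

/-- The line bundle `|Λ_M|` of `1`-densities on `M`. -/
def Density : M → Type := (densityCore m M).Fiber

variable {M}

instance (x : M) : NormedAddCommGroup (Density m M x) := inferInstanceAs (NormedAddCommGroup ℝ)

instance (x : M) : NormedSpace ℝ (Density m M x) := inferInstanceAs (NormedSpace ℝ ℝ)

instance : TopologicalSpace (TotalSpace ℝ (Density m M)) :=
  inferInstanceAs (TopologicalSpace (densityCore m M).TotalSpace)

instance : FiberBundle ℝ (Density m M) := inferInstanceAs (FiberBundle ℝ (densityCore m M).Fiber)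

instance : VectorBundle ℝ ℝ (Density m M) :=
  inferInstanceAs (VectorBundle ℝ ℝ (densityCore m M).Fiber)

instance : ContMDiffVectorBundle ∞ ℝ (Density m M) (𝓡 m) :=
  inferInstanceAs (ContMDiffVectorBundle ∞ ℝ (densityCore m M).Fiber (𝓡 m))

/-- The coefficient of a density `d` at `p` in the preferred chart at `a`: there `d` is
`densityCoord m a p d • |dy|`. It is zero if `p` is outside the domain of that chart. -/
def densityCoord (a p : M) : Density m M p →L[ℝ] ℝ :=
  (trivializationAt ℝ (Density m M) a).continuousLinearMapAt ℝ p

variable (M)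

/-- A smooth partition of unity on `M` subordinate to the cover by the domains of the preferred
charts. -/
def chartPartition [T2Space M] [CompactSpace M] : SmoothPartitionOfUnity M (𝓡 m) M Set.univ :=
  (SmoothPartitionOfUnity.exists_isSubordinate_chartAt_source (𝓡 m) M).choose

theorem chartPartition_isSubordinate [T2Space M] [CompactSpace M] :
    (chartPartition m M).IsSubordinate
      fun a => (chartAt (EuclideanSpace ℝ (Fin m)) a).source :=
  (SmoothPartitionOfUnity.exists_isSubordinate_chartAt_source (𝓡 m) M).choose_spec

variable {M}

/-- The integral `∫_M ρ` of a (continuous) density `ρ` over the compact manifold `M`: the sum over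
a partition of unity subordinate to charts of the Lebesgue integrals in these charts. -/
def densityIntegral [T2Space M] [CompactSpace M] (ρ : ∀ x : M, Density m M x) : ℝ :=
  ∑ᶠ a : M, ∫ y in (extChartAt (𝓡 m) a).target,
    chartPartition m M a ((extChartAt (𝓡 m) a).symm y) *
      densityCoord m a ((extChartAt (𝓡 m) a).symm y) (ρ ((extChartAt (𝓡 m) a).symm y))

end Density

/-! ### The topology of the space of smooth sections -/

section SectionTopology

variable {m : ℕ} {M : Type*} [TopologicalSpace M] [ChartedSpace (EuclideanSpace ℝ (Fin m)) M]
  (G : Type*) [NormedAddCommGroup G] [NormedSpace ℝ G]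
  (V : M → Type*) [TopologicalSpace (TotalSpace G V)] [∀ x, TopologicalSpace (V x)]
  [FiberBundle G V]

/-- The expression of a section in the preferred chart and the preferred trivialization at `a`. -/
def localRep (m : ℕ) {M : Type*} [TopologicalSpace M]
    [ChartedSpace (EuclideanSpace ℝ (Fin m)) M]
    (G : Type*) [NormedAddCommGroup G] (V : M → Type*) [TopologicalSpace (TotalSpace G V)]
    [∀ x, TopologicalSpace (V x)] [FiberBundle G V]
    (a : M) (s : ∀ x, V x) (y : EuclideanSpace ℝ (Fin m)) : G :=
  (trivializationAt G V a ⟨(extChartAt (𝓡 m) a).symm y, s ((extChartAt (𝓡 m) a).symm y)⟩).2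

/-- The open subset of `ℝ^m` on which `localRep m G V a s` expresses the section `s`. -/
def localDomain (m : ℕ) {M : Type*} [TopologicalSpace M]
    [ChartedSpace (EuclideanSpace ℝ (Fin m)) M]
    (G : Type*) [NormedAddCommGroup G] (V : M → Type*) [TopologicalSpace (TotalSpace G V)]
    [∀ x, TopologicalSpace (V x)] [FiberBundle G V] (a : M) : Set (EuclideanSpace ℝ (Fin m)) :=
  (extChartAt (𝓡 m) a).target ∩
    (extChartAt (𝓡 m) a).symm ⁻¹' (trivializationAt G V a).baseSet

/-- The natural (`C^∞`) topology on the space of smooth sections: in the local expressions of the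
sections, uniform convergence of all derivatives on compact sets. -/
instance sectionTopology [∀ x, AddCommGroup (V x)] [∀ x, Module ℝ (V x)] [VectorBundle ℝ G V] :
    TopologicalSpace Cₛ^∞⟮𝓡 m; G, V⟯ :=
  ⨅ (a : M) (k : ℕ), TopologicalSpace.induced
    (fun s : Cₛ^∞⟮𝓡 m; G, V⟯ =>
      UniformOnFun.ofFun {K | IsCompact K ∧ K ⊆ localDomain m G V a}
        (iteratedFDeriv ℝ k (localRep m G V a s)))
    inferInstance

end SectionTopology

/-! ### Generalized sections and Gaussian measures -/

section Generalized

variable (m : ℕ) {M : Type*} [TopologicalSpace M] [ChartedSpace (EuclideanSpace ℝ (Fin m)) M]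
  [IsManifold (𝓡 m) ∞ M]
  (F : Type*) [NormedAddCommGroup F] [NormedSpace ℝ F]
  (E : M → Type*) [TopologicalSpace (TotalSpace F E)] [∀ x, TopologicalSpace (E x)]
  [∀ x, AddCommGroup (E x)] [∀ x, Module ℝ (E x)] [FiberBundle F E] [VectorBundle ℝ F E]
  [∀ x, IsTopologicalAddGroup (E x)] [∀ x, ContinuousSMul ℝ (E x)]

/-- The space `C^∞(E)` of smooth sections of `E`. -/
abbrev SmoothSection : Type _ := Cₛ^∞⟮𝓡 m; F, E⟯

/-- The space `C^∞(E^* ⊗ |Λ_M|)`; the bundle `E^* ⊗ |Λ_M|` is the bundle of linear maps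
`E → |Λ_M|`. -/
abbrev TestSection : Type _ := Cₛ^∞⟮𝓡 m; F →L[ℝ] ℝ, fun x : M => E x →L[ℝ] Density m M x⟯

/-- The space `C^{-∞}(E)` of generalized sections of `E`: the continuous linear functionals on
`C^∞(E^* ⊗ |Λ_M|)`, with the weak topology. -/
abbrev GeneralizedSection : Type _ := WeakDual ℝ (TestSection m F E)

instance : MeasurableSpace (GeneralizedSection m F E) := borel _

instance : BorelSpace (GeneralizedSection m F E) := ⟨rfl⟩

variable {m F E}

theorem densityCoord_pairing (φ : TestSection m F E) (s : SmoothSection m F E) (a b p : M)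
    (hb : p ∈ (chartAt (EuclideanSpace ℝ (Fin m)) b).source)
    (hE : p ∈ (trivializationAt F E b).baseSet) :
    densityCoord m a p (φ p (s p)) =
      (trivializationAt (F →L[ℝ] ℝ) (fun x : M => E x →L[ℝ] Density m M x) b ⟨p, φ p⟩).2
          (trivializationAt F E b ⟨p, s p⟩).2 *
        densityCoord m a p ((trivializationAt ℝ (Density m M) b).symmL ℝ p 1) := by
  have hb' : p ∈ (trivializationAt ℝ (Density m M) b).baseSet := hb
  have h1 : (trivializationAt (F →L[ℝ] ℝ) (fun x : M => E x →L[ℝ] Density m M x) b ⟨p, φ p⟩).2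
      (trivializationAt F E b ⟨p, s p⟩).2 =
      (trivializationAt ℝ (Density m M) b).continuousLinearMapAt ℝ p (φ p (s p)) := by
    have h2 : (trivializationAt F E b).symmL ℝ p (trivializationAt F E b ⟨p, s p⟩).2 = s p := by
      rw [← (trivializationAt F E b).continuousLinearMapAt_apply_of_mem (R := ℝ) hE]
      exact Trivialization.symmL_continuousLinearMapAt _ hE _
    rw [hom_trivializationAt_apply]
    change (trivializationAt ℝ (Density m M) b).continuousLinearMapAt ℝ p
      (φ p ((trivializationAt F E b).symmL ℝ p _)) = _
    rw [h2]
  rw [h1, ← smul_eq_mul, ← map_smul, ← map_smul, smul_eq_mul, mul_one,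
    Trivialization.symmL_continuousLinearMapAt _ hb']

theorem continuousAt_trivialization_section {G : Type*} [NormedAddCommGroup G]
    {V : M → Type*} [TopologicalSpace (TotalSpace G V)] [∀ x, TopologicalSpace (V x)]
    [FiberBundle G V] (s : ∀ x, V x) (hs : Continuous fun x => TotalSpace.mk' G x (s x)) (b : M) :
    ContinuousAt (fun p => (trivializationAt G V b ⟨p, s p⟩).2) b := by
  have hb : TotalSpace.mk' G b (s b) ∈ (trivializationAt G V b).source :=
    (trivializationAt G V b).mem_source.2 (FiberBundle.mem_baseSet_trivializationAt' b)
  exact ((((trivializationAt G V b).continuousOn).continuousAt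
    ((trivializationAt G V b).open_source.mem_nhds hb)).snd).comp
    (f := fun x => TotalSpace.mk' G x (s x)) hs.continuousAt

variable (m) in
theorem continuousAt_densityCoord_symmL (a b : M)
    (hb : b ∈ (chartAt (EuclideanSpace ℝ (Fin m)) a).source) :
    ContinuousAt (fun p => densityCoord m a p
      ((trivializationAt ℝ (Density m M) b).symmL ℝ p 1)) b := by
  have h := continuousOn_coordChange ℝ (trivializationAt ℝ (Density m M) b)
    (trivializationAt ℝ (Density m M) a)
  have hmem : (trivializationAt ℝ (Density m M) b).baseSet ∩
      (trivializationAt ℝ (Density m M) a).baseSet ∈ 𝓝 b :=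
    ((trivializationAt ℝ (Density m M) b).open_baseSet.inter
      (trivializationAt ℝ (Density m M) a).open_baseSet).mem_nhds
      ⟨FiberBundle.mem_baseSet_trivializationAt' b, hb⟩
  refine ((h.continuousAt hmem).clm_apply (continuousAt_const (y := (1 : ℝ)))).congr ?_
  filter_upwards [hmem] with p hp
  rw [densityCoord, (trivializationAt ℝ (Density m M) a).continuousLinearMapAt_apply_of_mem
      (R := ℝ) hp.2,
    (trivializationAt ℝ (Density m M) b).symmL_apply hp.1]
  exact Trivialization.coordChangeL_apply _ _ hp 1

theorem eventually_densityCoord_pairing (s : SmoothSection m F E) (a b : M) :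
    ∀ᶠ p in 𝓝 b, ∀ φ : TestSection m F E, densityCoord m a p (φ p (s p)) =
      (trivializationAt (F →L[ℝ] ℝ) (fun x : M => E x →L[ℝ] Density m M x) b ⟨p, φ p⟩).2
          (trivializationAt F E b ⟨p, s p⟩).2 *
        densityCoord m a p ((trivializationAt ℝ (Density m M) b).symmL ℝ p 1) := by
  filter_upwards [(chartAt (EuclideanSpace ℝ (Fin m)) b).open_source.mem_nhds
    (mem_chart_source _ b), (trivializationAt F E b).open_baseSet.mem_nhds
    (FiberBundle.mem_baseSet_trivializationAt' b)] with p h1 h2 φ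
  exact densityCoord_pairing φ s a b p h1 h2

theorem continuousOn_pairing (φ : TestSection m F E) (s : SmoothSection m F E) (a : M) :
    ContinuousOn (fun p => densityCoord m a p (φ p (s p)))
      (chartAt (EuclideanSpace ℝ (Fin m)) a).source := by
  intro b hb
  refine ContinuousAt.continuousWithinAt ?_
  refine ContinuousAt.congr ?_ ((eventually_densityCoord_pairing s a b).mono fun p hp =>
    (hp φ).symm)
  exact ((continuousAt_trivialization_section _ φ.contMDiff.continuous b).clm_apply
    (continuousAt_trivialization_section _ s.contMDiff.continuous b)).mul
    (continuousAt_densityCoord_symmL m a b hb)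

theorem tendstoLocallyUniformlyOn_pairing (φ₀ : TestSection m F E) (s : SmoothSection m F E)
    (a : M) :
    TendstoLocallyUniformlyOn
      (fun (φ : TestSection m F E) p => densityCoord m a p (φ p (s p)))
      (fun p => densityCoord m a p (φ₀ p (s p))) (𝓝 φ₀)
      (chartAt (EuclideanSpace ℝ (Fin m)) a).source := by
  rw [Metric.tendstoLocallyUniformlyOn_iff]
  intro ε hε b hb
  -- a bound for the factors that do not depend on the test section
  obtain ⟨c, hc0, hc⟩ : ∃ c > 0, ∀ᶠ p in 𝓝 b, ‖(trivializationAt F E b ⟨p, s p⟩).2‖ *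
      ‖densityCoord m a p ((trivializationAt ℝ (Density m M) b).symmL ℝ p 1)‖ < c := by
    have h := ((continuousAt_trivialization_section _ s.contMDiff.continuous b).norm).mul
      (continuousAt_densityCoord_symmL m a b hb).norm
    exact ⟨_, add_pos_of_nonneg_of_pos (mul_nonneg (norm_nonneg _) (norm_nonneg _)) one_pos,
      h.eventually (gt_mem_nhds (lt_add_one _))⟩
  -- a compact neighbourhood in the local domain
  set D := localDomain m (F →L[ℝ] ℝ) (fun x : M => E x →L[ℝ] Density m M x) b with hD
  have hDopen : IsOpen D :=
    (continuousOn_extChartAt_symm (I := 𝓡 m) b).isOpen_inter_preimage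
      (isOpen_extChartAt_target b) (Trivialization.open_baseSet _)
  have hbD : extChartAt (𝓡 m) b b ∈ D := by
    refine ⟨mem_extChartAt_target b, ?_⟩
    rw [Set.mem_preimage, extChartAt_to_inv]
    exact FiberBundle.mem_baseSet_trivializationAt' b
  obtain ⟨K, hK, hbK, hKD⟩ := exists_compact_subset hDopen hbD
  -- uniform convergence of the local expressions on it
  have hunif : ∀ᶠ φ : TestSection m F E in 𝓝 φ₀, ∀ y ∈ K,
      ‖localRep m (F →L[ℝ] ℝ) (fun x : M => E x →L[ℝ] Density m M x) b φ₀ y -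
        localRep m (F →L[ℝ] ℝ) (fun x : M => E x →L[ℝ] Density m M x) b φ y‖ < ε / c := by
    have hcont : Continuous (fun φ : TestSection m F E =>
        UniformOnFun.ofFun {K | IsCompact K ∧ K ⊆ D}
        (iteratedFDeriv ℝ 0
          (localRep m (F →L[ℝ] ℝ) (fun x : M => E x →L[ℝ] Density m M x) b φ))) := by
      rw [continuous_iff_le_induced]
      exact iInf₂_le_of_le b 0 le_rfl
    have h1 := (UniformOnFun.tendsto_iff_tendstoUniformlyOn.1 (hcont.tendsto φ₀)) K ⟨hK, hKD⟩
    rw [Metric.tendstoUniformlyOn_iff] at h1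
    filter_upwards [h1 (ε / c) (div_pos hε hc0)] with φ hφ y hy
    have h2 := hφ y hy
    simp only [Function.comp_apply, UniformOnFun.toFun_ofFun, iteratedFDeriv_zero_eq_comp] at h2
    rw [LinearIsometryEquiv.dist_map, dist_eq_norm] at h2
    exact h2
  refine ⟨{p | p ∈ (extChartAt (𝓡 m) b).source ∧ extChartAt (𝓡 m) b p ∈ K ∧
    (‖(trivializationAt F E b ⟨p, s p⟩).2‖ *
      ‖densityCoord m a p ((trivializationAt ℝ (Density m M) b).symmL ℝ p 1)‖ < c) ∧
    ∀ φ : TestSection m F E, densityCoord m a p (φ p (s p)) =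
      (trivializationAt (F →L[ℝ] ℝ) (fun x : M => E x →L[ℝ] Density m M x) b ⟨p, φ p⟩).2
          (trivializationAt F E b ⟨p, s p⟩).2 *
        densityCoord m a p ((trivializationAt ℝ (Density m M) b).symmL ℝ p 1)}, ?_, ?_⟩
  · refine mem_nhdsWithin_of_mem_nhds ?_
    filter_upwards [extChartAt_source_mem_nhds (I := 𝓡 m) b,
      (continuousAt_extChartAt (I := 𝓡 m) b).preimage_mem_nhds (mem_interior_iff_mem_nhds.1 hbK),
      hc, eventually_densityCoord_pairing s a b] with p h1 h2 h3 h4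
    exact ⟨h1, h2, h3, h4⟩
  · filter_upwards [hunif] with φ hφ p hp
    obtain ⟨hp1, hp2, hp3, hp4⟩ := hp
    have h5 := hφ _ hp2
    unfold localRep at h5
    rw [(extChartAt (𝓡 m) b).left_inv hp1] at h5
    rw [dist_eq_norm, hp4 φ₀, hp4 φ, ← sub_mul, ← sub_apply, norm_mul]
    calc _ ≤ (ε / c) * (‖(trivializationAt F E b ⟨p, s p⟩).2‖ *
          ‖densityCoord m a p ((trivializationAt ℝ (Density m M) b).symmL ℝ p 1)‖) := by
            rw [← mul_assoc]
            refine mul_le_mul_of_nonneg_right ?_ (norm_nonneg _)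
            exact (ContinuousLinearMap.le_opNorm _ _).trans
              (mul_le_mul_of_nonneg_right h5.le (norm_nonneg _))
      _ < (ε / c) * c := mul_lt_mul_of_pos_left hp3 (div_pos hε hc0)
      _ = ε := div_mul_cancel₀ _ hc0.ne'

section Compact

variable [T2Space M] [CompactSpace M]

variable (m M) in
theorem finite_support_chartPartition :
    {a : M | ∃ x, chartPartition m M a x ≠ 0}.Finite := by
  have h := (chartPartition m M).locallyFinite.finite_nonempty_of_compact
  exact h

variable (m) in
/-- The image in the chart at `a` of the support of the partition function at `a`. -/
def partitionSupport (a : M) : Set (EuclideanSpace ℝ (Fin m)) :=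
  extChartAt (𝓡 m) a '' tsupport (chartPartition m M a)

theorem tsupport_chartPartition_subset (a : M) :
    tsupport (chartPartition m M a) ⊆ (chartAt (EuclideanSpace ℝ (Fin m)) a).source :=
  chartPartition_isSubordinate m M a

theorem isCompact_partitionSupport (a : M) : IsCompact (partitionSupport m a) := by
  refine (isClosed_tsupport _).isCompact.image_of_continuousOn
    ((continuousOn_extChartAt (I := 𝓡 m) a).mono ?_)
  rw [extChartAt_source]
  exact tsupport_chartPartition_subset a

theorem partitionSupport_subset (a : M) :
    partitionSupport m a ⊆ (extChartAt (𝓡 m) a).target := by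
  rintro _ ⟨p, hp, rfl⟩
  refine (extChartAt (𝓡 m) a).map_source ?_
  rw [extChartAt_source]
  exact tsupport_chartPartition_subset a hp

theorem symm_mem_of_mem_partitionSupport {a : M} {y : EuclideanSpace ℝ (Fin m)}
    (hy : y ∈ partitionSupport m a) :
    (extChartAt (𝓡 m) a).symm y ∈ tsupport (chartPartition m M a) := by
  obtain ⟨p, hp, rfl⟩ := hy
  rw [(extChartAt (𝓡 m) a).left_inv]
  · exact hp
  · rw [extChartAt_source]
    exact tsupport_chartPartition_subset a hp

theorem chartPartition_eq_zero {a : M} {y : EuclideanSpace ℝ (Fin m)}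
    (hy : y ∈ (extChartAt (𝓡 m) a).target \ partitionSupport m a) :
    chartPartition m M a ((extChartAt (𝓡 m) a).symm y) = 0 := by
  by_contra h
  exact hy.2 ⟨_, subset_tsupport _ h, (extChartAt (𝓡 m) a).right_inv hy.1⟩

/-- The contribution of the chart at `a` to the integral of the density `⟨φ, s⟩`. -/
def chartPairing (s : SmoothSection m F E) (a : M) (φ : TestSection m F E) : ℝ :=
  ∫ y in (extChartAt (𝓡 m) a).target,
    chartPartition m M a ((extChartAt (𝓡 m) a).symm y) *
      densityCoord m a ((extChartAt (𝓡 m) a).symm y)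
        (φ ((extChartAt (𝓡 m) a).symm y) (s ((extChartAt (𝓡 m) a).symm y)))

theorem chartPairing_eq (s : SmoothSection m F E) (a : M) (φ : TestSection m F E) :
    chartPairing s a φ = ∫ y in partitionSupport m a,
      chartPartition m M a ((extChartAt (𝓡 m) a).symm y) *
        densityCoord m a ((extChartAt (𝓡 m) a).symm y)
          (φ ((extChartAt (𝓡 m) a).symm y) (s ((extChartAt (𝓡 m) a).symm y))) := by
  refine setIntegral_eq_of_subset_of_forall_sdiff_eq_zero
    (isOpen_extChartAt_target a).measurableSet (partitionSupport_subset a) fun y hy => ?_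
  rw [chartPartition_eq_zero hy, zero_mul]

theorem integrableOn_chartPairing (s : SmoothSection m F E) (a : M) (φ : TestSection m F E) :
    IntegrableOn (fun y => chartPartition m M a ((extChartAt (𝓡 m) a).symm y) *
        densityCoord m a ((extChartAt (𝓡 m) a).symm y)
          (φ ((extChartAt (𝓡 m) a).symm y) (s ((extChartAt (𝓡 m) a).symm y))))
      (partitionSupport m a) := by
  refine ContinuousOn.integrableOn_compact (isCompact_partitionSupport a) ?_
  have h1 : ContinuousOn (extChartAt (𝓡 m) a).symm (partitionSupport m a) :=
    (continuousOn_extChartAt_symm (I := 𝓡 m) a).mono (partitionSupport_subset a)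
  refine ((chartPartition m M a).contMDiff.continuous.comp_continuousOn h1).mul ?_
  exact (continuousOn_pairing φ s a).comp h1 fun y hy =>
    tsupport_chartPartition_subset a (symm_mem_of_mem_partitionSupport hy)

theorem continuous_chartPairing (s : SmoothSection m F E) (a : M) :
    Continuous (chartPairing s a) := by
  refine continuous_iff_continuousAt.2 fun φ₀ => ?_
  rw [ContinuousAt, Metric.tendsto_nhds]
  intro ε hε
  have hfin : volume (partitionSupport m a) < ⊤ := (isCompact_partitionSupport a).measure_lt_top
  set v := volume.real (partitionSupport m a) with hv
  have hv0 : 0 ≤ v := measureReal_nonneg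
  have hpos : 0 < ε / (v + 1) := by positivity
  have h1 := (tendstoLocallyUniformlyOn_iff_tendstoUniformlyOn_of_compact
    (isClosed_tsupport (chartPartition m M a)).isCompact).1
    ((tendstoLocallyUniformlyOn_pairing φ₀ s a).mono (tsupport_chartPartition_subset a))
  rw [Metric.tendstoUniformlyOn_iff] at h1
  filter_upwards [h1 _ hpos] with φ hφ
  rw [chartPairing_eq, chartPairing_eq, dist_eq_norm, ← integral_sub
    (integrableOn_chartPairing s a φ) (integrableOn_chartPairing s a φ₀)]
  refine (norm_setIntegral_le_of_norm_le_const hfin (C := ε / (v + 1)) fun y hy => ?_).trans_lt ?_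
  · rw [← mul_sub, norm_mul]
    have h2 := hφ _ (symm_mem_of_mem_partitionSupport hy)
    rw [dist_comm, dist_eq_norm] at h2
    have h3 : ‖chartPartition m M a ((extChartAt (𝓡 m) a).symm y)‖ ≤ 1 := by
      rw [Real.norm_of_nonneg ((chartPartition m M).nonneg _ _)]
      exact (chartPartition m M).le_one _ _
    calc _ ≤ 1 * (ε / (v + 1)) := mul_le_mul h3 h2.le (norm_nonneg _) zero_le_one
      _ = _ := one_mul _
  · rw [← hv, div_mul_eq_mul_div, div_lt_iff₀ (by positivity)]
    nlinarith

theorem densityIntegral_pairing (s : SmoothSection m F E) (φ : TestSection m F E) :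
    densityIntegral m (fun x => φ x (s x)) =
      ∑ a ∈ (finite_support_chartPartition m M).toFinset, chartPairing s a φ := by
  refine finsum_eq_sum_of_support_subset _ fun a ha => ?_
  rw [Set.Finite.coe_toFinset]
  by_contra h
  refine ha ?_
  simp only [Set.mem_ofPred_eq, not_exists, not_not] at h
  simp [h]

/-- The natural injection `C^∞(E) → C^{-∞}(E)`, which sends a smooth section `s` to the generalized
section `φ ↦ ∫_M ⟨φ, s⟩`. -/
def toGeneralized (s : SmoothSection m F E) : GeneralizedSection m F E :=
  StrongDual.toWeakDual
  { toFun := fun φ => densityIntegral m fun x => φ x (s x)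
    map_add' := fun φ ψ => by
      simp only [densityIntegral_pairing, ← Finset.sum_add_distrib]
      refine Finset.sum_congr rfl fun a _ => ?_
      rw [chartPairing_eq, chartPairing_eq, chartPairing_eq, ← integral_add
        (integrableOn_chartPairing s a φ) (integrableOn_chartPairing s a ψ)]
      refine integral_congr_ae (Filter.Eventually.of_forall fun y => ?_)
      have h : (φ + ψ) ((extChartAt (𝓡 m) a).symm y) (s ((extChartAt (𝓡 m) a).symm y)) =
          φ ((extChartAt (𝓡 m) a).symm y) (s ((extChartAt (𝓡 m) a).symm y)) +
            ψ ((extChartAt (𝓡 m) a).symm y) (s ((extChartAt (𝓡 m) a).symm y)) := rfl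
      beta_reduce
      rw [h, map_add, mul_add]
    map_smul' := fun c φ => by
      simp only [densityIntegral_pairing, Finset.mul_sum, smul_eq_mul, RingHom.id_apply]
      refine Finset.sum_congr rfl fun a _ => ?_
      rw [chartPairing_eq, chartPairing_eq, ← integral_const_mul]
      refine integral_congr_ae (Filter.Eventually.of_forall fun y => ?_)
      have h : (c • φ) ((extChartAt (𝓡 m) a).symm y) (s ((extChartAt (𝓡 m) a).symm y)) =
          c • φ ((extChartAt (𝓡 m) a).symm y) (s ((extChartAt (𝓡 m) a).symm y)) := rfl
      beta_reduce
      rw [h, map_smul, smul_eq_mul, mul_left_comm]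
    cont := by
      simp only [densityIntegral_pairing]
      exact continuous_finsetSum _ fun a _ => continuous_chartPairing s a }

theorem toGeneralized_apply (s : SmoothSection m F E) (φ : TestSection m F E) :
    toGeneralized s φ = densityIntegral m fun x => φ x (s x) := rfl

/-- The trace on `C^∞(E)` of the Borel `σ`-algebra of `C^{-∞}(E)`; it coincides with the Borel
`σ`-algebra of the natural topology of `C^∞(E)`. -/
instance : MeasurableSpace (SmoothSection m F E) :=
  MeasurableSpace.comap toGeneralized inferInstance

end Compact

end Generalized

/-! ### The bundle `E ⊠ E` and covariance densities -/

section Pullback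

variable {B B' : Type*} (f : B' → B) (V : B → Type*) [∀ x, AddCommGroup (V x)]

instance (x : B') : AddCommGroup ((f *ᵖ V) x) := inferInstanceAs (AddCommGroup (V (f x)))

variable [∀ x, TopologicalSpace (V x)]

instance [∀ x, IsTopologicalAddGroup (V x)] (x : B') : IsTopologicalAddGroup ((f *ᵖ V) x) :=
  inferInstanceAs (IsTopologicalAddGroup (V (f x)))

instance [∀ x, Module ℝ (V x)] [∀ x, ContinuousSMul ℝ (V x)] (x : B') :
    ContinuousSMul ℝ ((f *ᵖ V) x) :=
  inferInstanceAs (ContinuousSMul ℝ (V (f x)))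

end Pullback

section Kernel

variable (m : ℕ) {M : Type*} [TopologicalSpace M] [ChartedSpace (EuclideanSpace ℝ (Fin m)) M]

/-- The projection `π_x : M × M → M`. -/
abbrev fstMap (M : Type*) [TopologicalSpace M] [ChartedSpace (EuclideanSpace ℝ (Fin m)) M] :
    ContMDiffMap ((𝓡 m).prod (𝓡 m)) (𝓡 m) (M × M) M ∞ :=
  ⟨Prod.fst, contMDiff_fst⟩

/-- The projection `π_y : M × M → M`. -/
abbrev sndMap (M : Type*) [TopologicalSpace M] [ChartedSpace (EuclideanSpace ℝ (Fin m)) M] :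
    ContMDiffMap ((𝓡 m).prod (𝓡 m)) (𝓡 m) (M × M) M ∞ :=
  ⟨Prod.snd, contMDiff_snd⟩

variable (F : Type*) [NormedAddCommGroup F] [NormedSpace ℝ F]
  (E : M → Type*) [TopologicalSpace (TotalSpace F E)] [∀ x, TopologicalSpace (E x)]
  [∀ x, AddCommGroup (E x)] [∀ x, Module ℝ (E x)] [FiberBundle F E] [VectorBundle ℝ F E]
  [∀ x, IsTopologicalAddGroup (E x)] [∀ x, ContinuousSMul ℝ (E x)]

/-- The bundle `E ⊠ E = π_x^* E ⊗ π_y^* E` over `M × M`, realized (the fibres being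
finite-dimensional) as the bundle of linear maps `(π_x^* E)^* → π_y^* E`; the decomposable tensor
`e ⊗ e'` is the map `u ↦ ⟨u, e⟩ e'`. -/
abbrev BoxBundle (p : M × M) : Type _ :=
  ((fstMap m M *ᵖ E) p →L[ℝ] Bundle.Trivial (M × M) ℝ p) →L[ℝ] (sndMap m M *ᵖ E) p

/-- The space `C^∞(E ⊠ E)`. -/
abbrev BoxSection : Type _ :=
  Cₛ^∞⟮(𝓡 m).prod (𝓡 m); (F →L[ℝ] ℝ) →L[ℝ] F, BoxBundle m E⟯

variable {m F E}

/-- The bilinear form `C_{x,y} : E_x^* × E_y^* → ℝ`, `C_{x,y}(u, v) = ⟨u ⊗ v, C_{x,y}⟩`, of a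
section `C` of `E ⊠ E`. -/
def boxForm (C : BoxSection m F E) (x y : M) (u : E x →L[ℝ] ℝ) (v : E y →L[ℝ] ℝ) : ℝ :=
  v (C (x, y) u)

variable [IsManifold (𝓡 m) ∞ M] [T2Space M] [CompactSpace M]

/-- The value on `φ ⊗ ψ` of the generalized section of `E ⊠ E` given by the smooth section `C`:
the integral over `M × M` of the density `C_{x,y}(φ(x), ψ(y))`. In the product of the preferred
charts at `p.1` and `p.2`, `φ = u |dy|` and `ψ = v |dz|` with local sections `u`, `v` of `E^*`, and
the density is `C(u, v) |dy| |dz|`; the products of the functions of a partition of unity on `M`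
are a partition of unity on `M × M`. -/
def kernelPairing (C : BoxSection m F E) (φ ψ : TestSection m F E) : ℝ :=
  ∑ᶠ p : M × M,
    ∫ w in (extChartAt (𝓡 m) p.1).target ×ˢ (extChartAt (𝓡 m) p.2).target,
      chartPartition m M p.1 ((extChartAt (𝓡 m) p.1).symm w.1) *
        chartPartition m M p.2 ((extChartAt (𝓡 m) p.2).symm w.2) *
        boxForm C ((extChartAt (𝓡 m) p.1).symm w.1) ((extChartAt (𝓡 m) p.2).symm w.2)
          ((densityCoord m p.1 ((extChartAt (𝓡 m) p.1).symm w.1)).comp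
            (φ ((extChartAt (𝓡 m) p.1).symm w.1)))
          ((densityCoord m p.2 ((extChartAt (𝓡 m) p.2).symm w.2)).comp
            (ψ ((extChartAt (𝓡 m) p.2).symm w.2)))

end Kernel

section Gaussian

variable {m : ℕ} {M : Type*} [TopologicalSpace M] [ChartedSpace (EuclideanSpace ℝ (Fin m)) M]
  [IsManifold (𝓡 m) ∞ M]
  {F : Type*} [NormedAddCommGroup F] [NormedSpace ℝ F]
  {E : M → Type*} [TopologicalSpace (TotalSpace F E)] [∀ x, TopologicalSpace (E x)]
  [∀ x, AddCommGroup (E x)] [∀ x, Module ℝ (E x)] [FiberBundle F E] [VectorBundle ℝ F E]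
  [∀ x, IsTopologicalAddGroup (E x)] [∀ x, ContinuousSMul ℝ (E x)]

/-- A (centered) Gaussian measure on `C^{-∞}(E)`: a Borel probability measure whose pushforward by
every `L_φ : T ↦ T φ` is a centered Gaussian measure on `ℝ`, possibly the Dirac measure at `0`. -/
structure IsGaussianMeasure (Γ : Measure (GeneralizedSection m F E)) : Prop where
  isProbabilityMeasure : IsProbabilityMeasure Γ
  map_eq : ∀ φ : TestSection m F E, ∃ v : ℝ≥0,
    Γ.map (fun T : GeneralizedSection m F E => T φ) = gaussianReal 0 v

variable [T2Space M] [CompactSpace M]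

/-- `Γ` is a smooth Gaussian measure on `C^{-∞}(E)` with covariance density `C`: it is Gaussian and
its covariance form `(φ, ψ) ↦ E(L_φ L_ψ)` is given by the smooth section `C` of `E ⊠ E`. -/
structure IsSmoothGaussianMeasure (Γ : Measure (GeneralizedSection m F E))
    (C : BoxSection m F E) : Prop extends IsGaussianMeasure Γ where
  covariance_eq : ∀ φ ψ : TestSection m F E,
    ∫ T : GeneralizedSection m F E, T φ * T ψ ∂Γ = kernelPairing C φ ψ

/-- The probability measure on `C^∞(E)` induced by a Gaussian measure `Γ` on `C^{-∞}(E)` with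
`Γ(C^∞(E)) = 1`: the measure of a set is the `Γ`-measure of its image in `C^{-∞}(E)`. -/
def inducedMeasure (Γ : Measure (GeneralizedSection m F E)) : Measure (SmoothSection m F E) :=
  Γ.comap toGeneralized

end Gaussian

end GaussianSections

end

noncomputable section

namespace GaussianSections

set_option linter.unusedSectionVars false

section Trigonometric

open Real FourierTransform

theorem norm_iteratedFDeriv_cos_clm_le {V : Type*} [NormedAddCommGroup V] [NormedSpace ℝ V]
    (L : V →L[ℝ] ℝ) (c : ℝ) (n : ℕ) (v : V) :
    ‖iteratedFDeriv ℝ n (fun v => cos (L v - c)) v‖ ≤ ‖L‖ ^ n := by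
  have h := L.iteratedFDeriv_comp_right (f := fun t => cos (t - c)) (n := ω)
    (contDiff_cos.comp (contDiff_id.sub contDiff_const)) v (i := n) le_top
  have h2 : (fun v => cos (L v - c)) = (fun t => cos (t - c)) ∘ L := rfl
  rw [h2, h]
  refine (ContinuousMultilinearMap.norm_compContinuousLinearMap_le _ _).trans ?_
  rw [norm_iteratedFDeriv_eq_norm_iteratedDeriv, iteratedDeriv_comp_sub_const]
  simp only [Finset.prod_const, Finset.card_univ, Fintype.card_fin]
  exact mul_le_of_le_one_left (by positivity) (abs_iteratedDeriv_cos_le_one n _)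

theorem exists_forall_pow_mul_abs_integral_cos_le {V W : Type*} [NormedAddCommGroup V]
    [NormedSpace ℝ V] [FiniteDimensional ℝ V] [MeasurableSpace V] [BorelSpace V]
    (μ : Measure V) [μ.IsAddHaarMeasure]
    [NormedAddCommGroup W] [NormedSpace ℝ W] {H : V → ℝ} (hH : ContDiff ℝ ∞ H)
    (hc : HasCompactSupport H) (L : V →L[ℝ] W →L[ℝ] ℝ) (l : W →L[ℝ] V)
    (hl : ∀ w, L (l w) w = ‖w‖ ^ 2) (N : ℕ) :
    ∃ K, 0 ≤ K ∧ ∀ w c, (1 + ‖w‖) ^ N * |∫ v, H v * cos (2 * π * L v w - c) ∂μ| ≤ K := by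
  set f : V → ℂ := fun v => (H v : ℂ) with hf
  have hfs : ContDiff ℝ ∞ f := Complex.ofRealCLM.contDiff.comp hH
  have hfc : HasCompactSupport f := hc.comp_left (g := fun x : ℝ => (x : ℂ)) Complex.ofReal_zero
  have hint : ∀ (k n : ℕ), (k : ℕ∞) ≤ ⊤ → (n : ℕ∞) ≤ ⊤ →
      Integrable (fun v => ‖v‖ ^ k * ‖iteratedFDeriv ℝ n f v‖) μ := by
    intro k n _ _
    refine Continuous.integrable_of_hasCompactSupport ?_ ?_
    · exact (continuous_norm.pow k).mul
        (hfs.continuous_iteratedFDeriv (mod_cast le_top)).norm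
    · exact ((hfc.iteratedFDeriv n).norm).mul_left
  have key : ∀ w c, |∫ v, H v * cos (2 * π * L v w - c) ∂μ| ≤
      ‖VectorFourier.fourierIntegral 𝐞 μ L.toLinearMap₁₂ f w‖ := by
    intro w c
    have hi : Integrable (fun v => 𝐞 (-(L v w)) • f v) μ := by
      refine Continuous.integrable_of_hasCompactSupport ?_ ?_
      · have h1 : Continuous fun v => L v w := by fun_prop
        exact (Real.continuous_fourierChar.comp h1.neg).smul hfs.continuous
      · refine hfc.mono fun v hv hv' => hv ?_
        simp only [hv', smul_zero]
    have h2 : ∫ v, H v * cos (2 * π * L v w - c) ∂μ =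
        (Complex.exp (c * Complex.I) * VectorFourier.fourierIntegral 𝐞 μ L.toLinearMap₁₂ f w).re := by
      have h4 : VectorFourier.fourierIntegral 𝐞 μ L.toLinearMap₁₂ f w =
        ∫ v, 𝐞 (-(L v w)) • f v ∂μ := rfl
      rw [h4, ← integral_const_mul]
      rw [← RCLike.re_eq_complex_re, ← integral_re (hi.const_mul _)]
      refine integral_congr_ae (Filter.Eventually.of_forall fun v => ?_)
      simp only [hf, Circle.smul_def, Real.fourierChar_apply, smul_eq_mul,
        RCLike.re_eq_complex_re]
      rw [← mul_assoc, ← Complex.exp_add, Complex.re_mul_ofReal, mul_comm]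
      congr 1
      have h3 : (c : ℂ) * Complex.I + ((2 * π * -(L v w) : ℝ) : ℂ) * Complex.I =
        ((-(2 * π * L v w - c) : ℝ) : ℂ) * Complex.I := by push_cast; ring
      erw [h3, Complex.exp_ofReal_mul_I_re, cos_neg]
    rw [h2]
    refine (Complex.abs_re_le_norm _).trans ?_
    rw [norm_mul, Complex.norm_exp_ofReal_mul_I, one_mul]
  have hdec : ∀ n : ℕ, ∃ K, 0 ≤ K ∧ ∀ w,
      ‖w‖ ^ n * ‖VectorFourier.fourierIntegral 𝐞 μ L.toLinearMap₁₂ f w‖ ≤ K := by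
    intro n
    refine ⟨‖l‖ ^ n * (2 * ((0 : ℕ) : ℝ) + 2) ^ n * ∑ p ∈ Finset.range (0 + 1) ×ˢ Finset.range (n + 1),
      ∫ v, ‖v‖ ^ p.1 * ‖iteratedFDeriv ℝ p.2 f v‖ ∂μ, ?_, fun w => ?_⟩
    · refine mul_nonneg (by positivity) (Finset.sum_nonneg fun p _ => ?_)
      exact integral_nonneg fun v => by positivity
    have h := VectorFourier.pow_mul_norm_iteratedFDeriv_fourierIntegral_le L (K := ⊤) (N := ⊤)
      hfs hint (k := 0) (n := n) le_top le_top (l w) w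
    rw [hl, norm_iteratedFDeriv_zero, pow_zero, mul_one] at h
    set S := ∑ p ∈ Finset.range (0 + 1) ×ˢ Finset.range (n + 1),
      ∫ v, ‖v‖ ^ p.1 * ‖iteratedFDeriv ℝ p.2 f v‖ ∂μ with hS
    have hS0 : 0 ≤ S := Finset.sum_nonneg fun p _ => integral_nonneg fun v => by positivity
    rcases eq_or_ne n 0 with rfl | hn
    · simpa using h
    rcases eq_or_ne w 0 with rfl | hw
    · rw [norm_zero, zero_pow hn, zero_mul]; positivity
    have hw' : 0 < ‖w‖ ^ n := by positivity
    refine le_of_mul_le_mul_left ?_ hw'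
    calc _ = |‖w‖ ^ 2| ^ n * ‖VectorFourier.fourierIntegral 𝐞 μ L.toLinearMap₁₂ f w‖ := by
          rw [abs_of_nonneg (by positivity)]; ring
      _ ≤ _ := h
      _ ≤ (‖l‖ * ‖w‖) ^ n * (2 * ((0 : ℕ) : ℝ) + 2) ^ n * S := by
          gcongr; exact l.le_opNorm w
      _ = _ := by rw [mul_pow]; ring
  obtain ⟨K0, hK0, h0⟩ := hdec 0
  obtain ⟨K1, hK1, h1⟩ := hdec N
  refine ⟨2 ^ N * (K0 + K1), by positivity, fun w c => ?_⟩
  have h3 : (1 + ‖w‖) ^ N ≤ 2 ^ N * (1 + ‖w‖ ^ N) := by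
    rcases le_total ‖w‖ 1 with h | h
    · calc (1 + ‖w‖) ^ N ≤ 2 ^ N := by gcongr; linarith
        _ ≤ _ := le_mul_of_one_le_right (by positivity) (by linarith [pow_nonneg (norm_nonneg w) N])
    · calc (1 + ‖w‖) ^ N ≤ (2 * ‖w‖) ^ N := by gcongr; linarith
        _ = 2 ^ N * ‖w‖ ^ N := mul_pow _ _ _
        _ ≤ _ := by gcongr; linarith
  calc _ ≤ (2 ^ N * (1 + ‖w‖ ^ N)) * ‖VectorFourier.fourierIntegral 𝐞 μ L.toLinearMap₁₂ f w‖ :=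
        mul_le_mul h3 (key w c) (abs_nonneg _) (by positivity)
    _ = 2 ^ N * (‖w‖ ^ 0 * ‖VectorFourier.fourierIntegral 𝐞 μ L.toLinearMap₁₂ f w‖ +
        ‖w‖ ^ N * ‖VectorFourier.fourierIntegral 𝐞 μ L.toLinearMap₁₂ f w‖) := by ring
    _ ≤ _ := by gcongr; exacts [h0 w, h1 w]

end Trigonometric

section FourierSeries

open Real

variable {m : ℕ}

/-- The integer frequency vector `k` as a point of `ℝ^m`. -/
def freq (k : Fin m → ℤ) : EuclideanSpace ℝ (Fin m) := WithLp.toLp 2 fun i => (k i : ℝ)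

/-- The real trigonometric monomials of period `1`: `cos (2π⟨y, k⟩)` and `sin (2π⟨y, k⟩)`. -/
def trig (q : (Fin m → ℤ) × Bool) (y : EuclideanSpace ℝ (Fin m)) : ℝ :=
  cos (2 * π * inner ℝ y (freq q.1) - if q.2 then π / 2 else 0)

/-- The weight `1 + |k|` of a frequency. -/
def weight (q : (Fin m → ℤ) × Bool) : ℝ := 1 + ‖freq q.1‖

theorem one_le_weight (q : (Fin m → ℤ) × Bool) : 1 ≤ weight q := by
  unfold weight; linarith [norm_nonneg (freq q.1)]

theorem weight_pos (q : (Fin m → ℤ) × Bool) : 0 < weight q :=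
  zero_lt_one.trans_le (one_le_weight q)

theorem contDiff_trig (q : (Fin m → ℤ) × Bool) : ContDiff ℝ ∞ (trig q) := by
  unfold trig
  exact contDiff_cos.comp ((contDiff_const.mul (contDiff_id.inner ℝ contDiff_const)).sub
    contDiff_const)

theorem abs_trig_le_one (q : (Fin m → ℤ) × Bool) (y : EuclideanSpace ℝ (Fin m)) :
    |trig q y| ≤ 1 := abs_cos_le_one _

theorem norm_iteratedFDeriv_trig_le (q : (Fin m → ℤ) × Bool) (n : ℕ)
    (y : EuclideanSpace ℝ (Fin m)) :
    ‖iteratedFDeriv ℝ n (trig q) y‖ ≤ (2 * π) ^ n * weight q ^ n := by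
  have h : trig q = fun v => cos (((2 * π) • innerSL ℝ (freq q.1)) v -
      if q.2 then π / 2 else 0) := by
    funext v
    simp only [trig, smul_apply, innerSL_apply_apply, smul_eq_mul, real_inner_comm]
  rw [h]
  refine (norm_iteratedFDeriv_cos_clm_le _ _ _ _).trans ?_
  rw [norm_smul, mul_pow, innerSL_apply_norm, Real.norm_of_nonneg (by positivity)]
  gcongr
  unfold weight; linarith

theorem exists_summable_inv_weight_pow :
    ∃ n : ℕ, Summable fun q : (Fin m → ℤ) × Bool => (weight q)⁻¹ ^ n := by
  let b := (EuclideanSpace.basisFun (Fin m) ℝ).toBasis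
  let Λ := Submodule.span ℤ (Set.range b)
  have hmem : ∀ k : Fin m → ℤ, freq k ∈ Λ := by
    intro k
    have h : freq k = ∑ i, k i • b i := by
      ext j
      simp [freq, b, Finset.sum_apply, Pi.single_apply]
    rw [h]
    exact Submodule.sum_mem _ fun i _ =>
      Submodule.smul_mem _ _ (Submodule.subset_span ⟨i, rfl⟩)
  have hs := ZLattice.summable_norm_pow_inv Λ (Module.finrank ℤ Λ + 1) (Nat.lt_succ_self _)
  set n := Module.finrank ℤ Λ + 1
  refine ⟨n, ?_⟩
  have hinj : Function.Injective fun k : Fin m → ℤ => (⟨freq k, hmem k⟩ : Λ) := by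
    intro k k' h
    have h1 : freq k = freq k' := congrArg Subtype.val h
    funext i
    have h2 := congrArg (fun v : EuclideanSpace ℝ (Fin m) => v i) h1
    simpa [freq] using h2
  have h1 : Summable fun k : Fin m → ℤ => (1 + ‖freq k‖)⁻¹ ^ n := by
    refine Summable.of_norm_bounded_eventually (hs.comp_injective hinj) ?_
    filter_upwards [(Set.finite_singleton (0 : Fin m → ℤ)).compl_mem_cofinite] with k hk
    have hk0 : freq k ≠ 0 := by
      intro h0
      apply hk
      funext i
      have h2 := congrArg (fun v : EuclideanSpace ℝ (Fin m) => v i) h0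
      simpa [freq] using h2
    have hpos : 0 < ‖freq k‖ := norm_pos_iff.2 hk0
    rw [Real.norm_of_nonneg (by positivity)]
    change (1 + ‖freq k‖)⁻¹ ^ n ≤ ‖freq k‖⁻¹ ^ n
    gcongr
    linarith
  have h2 := h1.mul_of_nonneg (Summable.of_finite (f := fun _ : Bool => (1 : ℝ)))
    (fun k => by positivity) (fun _ => zero_le_one)
  simpa [weight] using h2

theorem summable_weight_pow_mul {a : (Fin m → ℤ) × Bool → ℝ}
    (h : ∀ N : ℕ, ∃ K, ∀ q, weight q ^ N * |a q| ≤ K) (N : ℕ) :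
    Summable fun q => weight q ^ N * |a q| := by
  obtain ⟨n, hn⟩ := exists_summable_inv_weight_pow (m := m)
  obtain ⟨K, hK⟩ := h (N + n)
  refine Summable.of_nonneg_of_le (fun q => mul_nonneg (pow_nonneg (weight_pos q).le _)
    (abs_nonneg _)) (fun q => ?_) (hn.mul_left K)
  have hw := weight_pos q
  calc weight q ^ N * |a q| = (weight q ^ (N + n) * |a q|) * (weight q)⁻¹ ^ n := by
        rw [pow_add, inv_pow]; field_simp
    _ ≤ K * (weight q)⁻¹ ^ n := by gcongr; exact hK q

/-- The Fourier coefficients of a function supported in a period box. -/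
def trigCoeff (f : EuclideanSpace ℝ (Fin m) → ℝ) (q : (Fin m → ℤ) × Bool) : ℝ :=
  ∫ y, f y * trig q y

theorem exists_forall_weight_pow_mul_trigCoeff_le {f : EuclideanSpace ℝ (Fin m) → ℝ}
    (hf : ContDiff ℝ ∞ f) (hc : HasCompactSupport f) (N : ℕ) :
    ∃ K, ∀ q, weight q ^ N * |trigCoeff f q| ≤ K := by
  obtain ⟨K, -, hK⟩ := exists_forall_pow_mul_abs_integral_cos_le volume hf hc (innerSL ℝ)
    (ContinuousLinearMap.id ℝ _) (fun w => real_inner_self_eq_norm_sq w) N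
  exact ⟨K, fun q => hK (freq q.1) _⟩

theorem exists_forall_weight_pow_mul_integral_trig_mul_trig_le
    {H : EuclideanSpace ℝ (Fin m) × EuclideanSpace ℝ (Fin m) → ℝ}
    (hH : ContDiff ℝ ∞ H) (hc : HasCompactSupport H) (N : ℕ) :
    ∃ K, 0 ≤ K ∧ ∀ q, weight q ^ N * |∫ w, H w * (trig q w.1 * trig q w.2)| ≤ K := by
  let L₁ : EuclideanSpace ℝ (Fin m) × EuclideanSpace ℝ (Fin m) →L[ℝ]
      EuclideanSpace ℝ (Fin m) →L[ℝ] ℝ :=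
    (innerSL ℝ).comp (ContinuousLinearMap.fst ℝ _ _)
  let L₂ : EuclideanSpace ℝ (Fin m) × EuclideanSpace ℝ (Fin m) →L[ℝ]
      EuclideanSpace ℝ (Fin m) →L[ℝ] ℝ :=
    (innerSL ℝ).comp (ContinuousLinearMap.snd ℝ _ _)
  have hvol : (volume : Measure (EuclideanSpace ℝ (Fin m) × EuclideanSpace ℝ (Fin m))).IsAddHaarMeasure :=
    Measure.prod.instIsAddHaarMeasure volume volume
  obtain ⟨K₁, hK₁0, hK₁⟩ := exists_forall_pow_mul_abs_integral_cos_le volume hH hc (L₁ + L₂)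
    (ContinuousLinearMap.inl ℝ _ _) (fun w => by simp [L₁, L₂]) N
  obtain ⟨K₂, hK₂0, hK₂⟩ := exists_forall_pow_mul_abs_integral_cos_le volume hH hc (L₁ - L₂)
    (ContinuousLinearMap.inl ℝ _ _) (fun w => by simp [L₁, L₂]) N
  refine ⟨K₁ + K₂, by positivity, fun q => ?_⟩
  set c : ℝ := if q.2 then π / 2 else 0 with hcdef
  have hi : ∀ (L : EuclideanSpace ℝ (Fin m) × EuclideanSpace ℝ (Fin m) →L[ℝ]
      EuclideanSpace ℝ (Fin m) →L[ℝ] ℝ) (d : ℝ),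
      Integrable fun w => H w * cos (2 * π * L w (freq q.1) - d) := by
    intro L d
    refine Continuous.integrable_of_hasCompactSupport ?_ hc.mul_right
    have h1 : Continuous fun v => L v (freq q.1) := by fun_prop
    exact hH.continuous.mul (continuous_cos.comp ((continuous_const.mul h1).sub continuous_const))
  have h1 : ∫ w, H w * (trig q w.1 * trig q w.2) =
      ((∫ w, H w * cos (2 * π * (L₁ + L₂) w (freq q.1) - 2 * c)) +
      ∫ w, H w * cos (2 * π * (L₁ - L₂) w (freq q.1) - 0)) / 2 := by
    rw [← integral_add (hi _ _) (hi _ _), ← integral_div]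
    refine integral_congr_ae (Filter.Eventually.of_forall fun w => ?_)
    simp only [trig, ← hcdef]
    set s := inner ℝ w.1 (freq q.1) with hs
    set t := inner ℝ w.2 (freq q.1) with ht
    have e1 : (L₁ + L₂) w (freq q.1) = s + t := rfl
    have e2 : (L₁ - L₂) w (freq q.1) = s - t := rfl
    rw [e1, e2, ← mul_add, mul_div_assoc]
    congr 1
    rw [show 2 * π * (s + t) - 2 * c = (2 * π * s - c) + (2 * π * t - c) by ring,
      show 2 * π * (s - t) - 0 = (2 * π * s - c) - (2 * π * t - c) by ring, cos_add,
      cos_sub (2 * π * s - c) (2 * π * t - c)]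
    ring
  have h2 := hK₁ (freq q.1) (2 * c)
  have h3 := hK₂ (freq q.1) 0
  rw [h1, abs_div, abs_two]
  change (1 + ‖freq q.1‖) ^ N * _ ≤ _
  set A := ∫ w, H w * cos (2 * π * (L₁ + L₂) w (freq q.1) - 2 * c)
  set B := ∫ w, H w * cos (2 * π * (L₁ - L₂) w (freq q.1) - 0)
  have hw : 0 ≤ (1 + ‖freq q.1‖) ^ N := by positivity
  have := mul_le_mul_of_nonneg_left (abs_add_le A B) hw
  nlinarith

/-- A function that vanishes off a compact subset of an open unit box descends to a continuous
function on the torus. -/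
theorem exists_continuousMap_unitAddTorus {f : EuclideanSpace ℝ (Fin m) → ℝ} (hf : Continuous f)
    (c : Fin m → ℝ) (hs : ∀ y, f y ≠ 0 → ∀ i, y i ∈ Set.Ioo (c i) (c i + 1)) :
    ∃ F : C(UnitAddTorus (Fin m), ℂ), ∀ y : EuclideanSpace ℝ (Fin m),
      (∀ i, y i ∈ Set.Icc (c i) (c i + 1)) → F (fun i => (y i : UnitAddCircle)) = f y := by
  let g : UnitAddTorus (Fin m) → ℂ := fun t =>
    f (WithLp.toLp 2 fun i => (AddCircle.equivIoc 1 (c i) (t i) : ℝ))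
  let S : Set (Fin m → ℝ) := Set.univ.pi fun i => Set.Icc (c i) (c i + 1)
  have hS : IsCompact S := isCompact_univ_pi fun i => isCompact_Icc
  have hIoc : ∀ (i : Fin m) (r : ℝ), r ∈ Set.Ioc (c i) (c i + 1) →
      (AddCircle.equivIoc 1 (c i) (r : UnitAddCircle) : ℝ) = r := by
    intro i r hr
    exact AddCircle.equivIoc_coe_of_mem hr
  have hg : ∀ y : EuclideanSpace ℝ (Fin m), (∀ i, y i ∈ Set.Icc (c i) (c i + 1)) →
      g (fun i => (y i : UnitAddCircle)) = f y := by
    intro y hy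
    by_cases h : ∀ i, y i ∈ Set.Ioc (c i) (c i + 1)
    · simp only [g]
      congr 2
      ext i
      exact hIoc i _ (h i)
    · push Not at h
      obtain ⟨i, hi⟩ := h
      have hyi : y i = c i := by
        by_contra hne
        exact hi ⟨lt_of_le_of_ne (hy i).1 (Ne.symm hne), (hy i).2⟩
      have h1 : f y = 0 := by
        by_contra hne
        exact (hs y hne i).1.ne' hyi
      have h2 : g (fun i => (y i : UnitAddCircle)) = 0 := by
        simp only [g]
        rw [Complex.ofReal_eq_zero]
        by_contra hne
        have h3 := (hs _ hne i).2
        have h4 : ((y i : ℝ) : UnitAddCircle) = ((c i + 1 : ℝ) : UnitAddCircle) := by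
          rw [hyi]; exact (AddCircle.coe_add_period 1 (c i)).symm
        simp only [h4] at h3
        rw [hIoc i (c i + 1) ⟨by linarith, le_rfl⟩] at h3
        exact lt_irrefl _ h3
      rw [h2, h1, Complex.ofReal_zero]
  have : CompactSpace S := isCompact_iff_compactSpace.1 hS
  let π' : S → UnitAddTorus (Fin m) := fun y i => (y.1 i : UnitAddCircle)
  have hπc : Continuous π' := continuous_pi fun i =>
    (AddCircle.continuous_mk' 1).comp ((continuous_apply i).comp continuous_subtype_val)
  have hπs : Function.Surjective π' := by
    intro t
    refine ⟨⟨fun i => (AddCircle.equivIoc 1 (c i) (t i) : ℝ), fun i _ =>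
      Set.Ioc_subset_Icc_self (AddCircle.equivIoc 1 (c i) (t i)).2⟩, ?_⟩
    funext i
    exact (AddCircle.equivIoc 1 (c i)).symm_apply_apply (t i)
  have hq : Topology.IsQuotientMap π' := Topology.IsQuotientMap.of_surjective_continuous hπs hπc
  have hgc : Continuous g := by
    rw [hq.continuous_iff]
    have h5 : g ∘ π' = fun y : S => ((f (WithLp.toLp 2 y.1) : ℝ) : ℂ) := by
      funext y
      exact hg (WithLp.toLp 2 y.1) fun i => y.2 i trivial
    rw [h5]
    exact Complex.continuous_ofReal.comp (hf.comp
      ((PiLp.continuous_toLp 2 _).comp continuous_subtype_val))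
  exact ⟨⟨g, hgc⟩, hg⟩

theorem mFourier_coe_eq (k : Fin m → ℤ) (y : EuclideanSpace ℝ (Fin m)) :
    UnitAddTorus.mFourier k (fun i => (y i : UnitAddCircle)) =
      trig (k, false) y + trig (k, true) y * Complex.I := by
  have h1 : UnitAddTorus.mFourier k (fun i => (y i : UnitAddCircle)) =
      Complex.exp (((2 * π * inner ℝ y (freq k) : ℝ) : ℂ) * Complex.I) := by
    change ∏ i, fourier (k i) (y i : UnitAddCircle) = _
    simp only [fourier_coe_apply]
    rw [← Complex.exp_sum]
    congr 1
    simp only [freq, PiLp.inner_apply, RCLike.inner_apply, conj_trivial]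
    push_cast
    rw [Finset.mul_sum, Finset.sum_mul]
    refine Finset.sum_congr rfl fun i _ => ?_
    simp only [div_one]
    ring
  rw [h1, Complex.exp_mul_I]
  simp only [trig, if_true, Bool.false_eq_true, if_false, sub_zero, cos_sub_pi_div_two,
    Complex.ofReal_cos, Complex.ofReal_sin]

theorem hasSum_trigCoeff_mul_trig {f : EuclideanSpace ℝ (Fin m) → ℝ}
    (hf : ContDiff ℝ ∞ f) (hc : HasCompactSupport f) (c : Fin m → ℝ)
    (hs : ∀ y, f y ≠ 0 → ∀ i, y i ∈ Set.Ioo (c i) (c i + 1))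
    {y : EuclideanSpace ℝ (Fin m)} (hy : ∀ i, y i ∈ Set.Icc (c i) (c i + 1)) :
    HasSum (fun q => trigCoeff f q * trig q y) (f y) := by
  obtain ⟨F, hF⟩ := exists_continuousMap_unitAddTorus hf.continuous c hs
  have hi : ∀ q, Integrable fun y => f y * trig q y := fun q =>
    (hf.continuous.mul (contDiff_trig q).continuous).integrable_of_hasCompactSupport hc.mul_right
  have hcoef : ∀ k, UnitAddTorus.mFourierCoeff F k =
      trigCoeff f (k, false) - trigCoeff f (k, true) * Complex.I := by
    intro k
    rw [UnitAddTorus.mFourierCoeff_eq_integral F k c]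
    have hmp := PiLp.volume_preserving_ofLp (Fin m)
    rw [← hmp.setIntegral_preimage_emb (MeasurableEquiv.toLp 2 (Fin m → ℝ)).symm.measurableEmbedding]
    have h2 : ∫ y : EuclideanSpace ℝ (Fin m) in
        WithLp.ofLp ⁻¹' {x : Fin m → ℝ | ∀ i, x i ∈ Set.Ioc (c i) (c i + 1)},
        UnitAddTorus.mFourier (-k) (fun i => (y i : UnitAddCircle)) •
          F (fun i => (y i : UnitAddCircle)) =
        ∫ y : EuclideanSpace ℝ (Fin m),
          ((f y * trig (k, false) y : ℝ) : ℂ) - ((f y * trig (k, true) y : ℝ) : ℂ) * Complex.I := by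
      rw [← integral_indicator]
      · refine integral_congr_ae (Filter.Eventually.of_forall fun y => ?_)
        beta_reduce
        by_cases hy : ∀ i, y i ∈ Set.Ioc (c i) (c i + 1)
        · rw [Set.indicator_of_mem (by exact hy), hF y fun i => Set.Ioc_subset_Icc_self (hy i),
            UnitAddTorus.mFourier_neg, mFourier_coe_eq]
          simp only [map_add, map_mul, Complex.conj_ofReal, Complex.conj_I, smul_eq_mul]
          push_cast
          ring
        · rw [Set.indicator_of_notMem (by exact hy)]
          have h0 : f y = 0 := by
            by_contra hne
            exact hy fun i => Set.Ioo_subset_Ioc_self (hs y hne i)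
          simp [h0]
      · refine hmp.measurable ?_
        simp only [Set.ofPred_forall]
        exact MeasurableSet.iInter fun i => measurable_pi_apply i measurableSet_Ioc
    refine Eq.trans h2 ?_
    rw [integral_sub (hi _).ofReal ((hi _).ofReal.mul_const _), integral_mul_const,
      integral_complex_ofReal, integral_complex_ofReal]
    rfl
  have hsum0 : ∀ σ, Summable fun k => trigCoeff f (k, σ) := by
    intro σ
    have h := summable_weight_pow_mul (exists_forall_weight_pow_mul_trigCoeff_le hf hc) 0
    simp only [pow_zero, one_mul] at h
    exact (h.of_abs).comp_injective (i := fun k => (k, σ)) fun a b h => (Prod.mk.inj h).1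
  have hsumF : Summable (UnitAddTorus.mFourierCoeff F) := by
    have h3 : UnitAddTorus.mFourierCoeff F = fun k =>
      (trigCoeff f (k, false) : ℂ) - trigCoeff f (k, true) * Complex.I := funext hcoef
    rw [h3]
    exact (Complex.ofRealCLM.summable (hsum0 false)).sub
      ((Complex.ofRealCLM.summable (hsum0 true)).mul_right _)
  have hsum := UnitAddTorus.hasSum_mFourier_series_apply_of_summable hsumF
    fun i => (y i : UnitAddCircle)
  rw [hF y hy] at hsum
  have hre := Complex.reCLM.hasSum hsum
  have h4 : ∀ k, Complex.reCLM (UnitAddTorus.mFourierCoeff F k •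
      UnitAddTorus.mFourier k fun i => (y i : UnitAddCircle)) =
      trigCoeff f (k, false) * trig (k, false) y + trigCoeff f (k, true) * trig (k, true) y := by
    intro k
    rw [hcoef, mFourier_coe_eq]
    simp [smul_eq_mul]
  simp only [h4, Complex.reCLM_apply, Complex.ofReal_re] at hre
  have habs : Summable fun q => trigCoeff f q * trig q y := by
    have h := summable_weight_pow_mul (exists_forall_weight_pow_mul_trigCoeff_le hf hc) 0
    simp only [pow_zero, one_mul] at h
    refine Summable.of_norm_bounded h fun q => ?_
    rw [norm_mul]
    exact mul_le_of_le_one_right (abs_nonneg _) (abs_trig_le_one q y)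
  have h5 := habs.hasSum.prod_fiberwise (g := fun k =>
    trigCoeff f (k, false) * trig (k, false) y + trigCoeff f (k, true) * trig (k, true) y)
    fun k => by
      have := hasSum_fintype fun b : Bool => trigCoeff f (k, b) * trig (k, b) y
      simpa [add_comm] using this
  rw [hre.unique h5]
  exact habs.hasSum

end FourierSeries

section TrigSeries

open Real

variable {m : ℕ} {G : Type*} [NormedAddCommGroup G] [NormedSpace ℝ G]

/-- The sum of a trigonometric series. -/
def trigSeries (a : (Fin m → ℤ) × Bool → ℝ) (y : EuclideanSpace ℝ (Fin m)) : ℝ :=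
  ∑' q, a q * trig q y

theorem contDiff_trigSeries {a : (Fin m → ℤ) × Bool → ℝ}
    (ha : ∀ N : ℕ, Summable fun q => weight q ^ N * |a q|) : ContDiff ℝ ∞ (trigSeries a) := by
  refine contDiff_tsum (v := fun n q => (2 * π) ^ n * (weight q ^ n * |a q|))
    (fun q => contDiff_const.mul (contDiff_trig q)) (fun n _ => (ha n).mul_left _) ?_
  intro n q y _
  have h := iteratedFDeriv_const_smul_apply (𝕜 := ℝ) (i := n) (a := a q) (f := trig q) (x := y)
    ((contDiff_trig q).contDiffAt.of_le (mod_cast le_top))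
  have h2 : (fun y => a q * trig q y) = a q • trig q := rfl
  rw [h2, h, norm_smul, Real.norm_eq_abs]
  calc _ ≤ |a q| * ((2 * π) ^ n * weight q ^ n) := by
        gcongr; exact norm_iteratedFDeriv_trig_le q n y
    _ = _ := by ring

theorem summable_mul_trig {a : (Fin m → ℤ) × Bool → ℝ}
    (ha : ∀ N : ℕ, Summable fun q => weight q ^ N * |a q|) (y : EuclideanSpace ℝ (Fin m)) :
    Summable fun q => a q * trig q y := by
  have h := ha 0
  simp only [pow_zero, one_mul] at h
  refine Summable.of_norm_bounded h fun q => ?_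
  rw [norm_mul]
  exact mul_le_of_le_one_right (abs_nonneg _) (abs_trig_le_one q y)

theorem exists_norm_iteratedFDeriv_trig_smul_le {Ξ : EuclideanSpace ℝ (Fin m) → G}
    (hΞ : ContDiff ℝ ∞ Ξ) (hc : HasCompactSupport Ξ) (n : ℕ) :
    ∃ K, 0 ≤ K ∧ ∀ q y, ‖iteratedFDeriv ℝ n (fun y => trig q y • Ξ y) y‖ ≤ K * weight q ^ n := by
  have hb : ∀ i : ℕ, ∃ K, ∀ y, ‖iteratedFDeriv ℝ i Ξ y‖ ≤ K := fun i =>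
    (hc.iteratedFDeriv i).exists_bound_of_continuous
      (hΞ.continuous_iteratedFDeriv (mod_cast le_top))
  choose K hK using hb
  have hK0 : ∀ i, 0 ≤ K i := fun i => (norm_nonneg _).trans (hK i 0)
  refine ⟨∑ i ∈ Finset.range (n + 1), (n.choose i : ℝ) * (2 * π) ^ i * K (n - i),
    Finset.sum_nonneg fun i _ => mul_nonneg (by positivity) (hK0 _), fun q y => ?_⟩
  refine (norm_iteratedFDeriv_smul_le (contDiff_trig q) hΞ y (n := n) (mod_cast le_top)).trans ?_
  rw [Finset.sum_mul]
  refine Finset.sum_le_sum fun i hi => ?_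
  have h1 : weight q ^ i ≤ weight q ^ n :=
    pow_le_pow_right₀ (one_le_weight q) (Nat.lt_succ_iff.1 (Finset.mem_range.1 hi))
  calc (n.choose i : ℝ) * ‖iteratedFDeriv ℝ i (trig q) y‖ * ‖iteratedFDeriv ℝ (n - i) Ξ y‖
      ≤ (n.choose i : ℝ) * ((2 * π) ^ i * weight q ^ n) * K (n - i) := by
        have := weight_pos q
        gcongr
        · exact (norm_iteratedFDeriv_trig_le q i y).trans (by gcongr)
        · exact hK _ _
    _ = _ := by ring

theorem tendstoUniformly_iteratedFDeriv_trigSeries_smul {a : (Fin m → ℤ) × Bool → ℝ}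
    (ha : ∀ N : ℕ, Summable fun q => weight q ^ N * |a q|) {Ξ : EuclideanSpace ℝ (Fin m) → G}
    (hΞ : ContDiff ℝ ∞ Ξ) (hc : HasCompactSupport Ξ) [CompleteSpace G] (n : ℕ) :
    TendstoUniformly
      (fun S : Finset ((Fin m → ℤ) × Bool) =>
        iteratedFDeriv ℝ n fun y => ∑ q ∈ S, a q • trig q y • Ξ y)
      (iteratedFDeriv ℝ n fun y => trigSeries a y • Ξ y) Filter.atTop := by
  choose K hK0 hK using exists_norm_iteratedFDeriv_trig_smul_le hΞ hc
  have hs : ∀ q, ContDiff ℝ ∞ fun y => a q • trig q y • Ξ y := fun q =>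
    contDiff_const.smul ((contDiff_trig q).smul hΞ)
  have hbd : ∀ (k : ℕ) q y, ‖iteratedFDeriv ℝ k (fun y => a q • trig q y • Ξ y) y‖ ≤
      K k * (weight q ^ k * |a q|) := by
    intro k q y
    have h := iteratedFDeriv_const_smul_apply (𝕜 := ℝ) (i := k) (a := a q)
      (f := fun y => trig q y • Ξ y) (x := y)
      (((contDiff_trig q).smul hΞ).contDiffAt.of_le (mod_cast le_top))
    have h2 : (fun y => a q • trig q y • Ξ y) = a q • fun y => trig q y • Ξ y := rfl
    rw [h2, h, norm_smul, Real.norm_eq_abs]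
    calc _ ≤ |a q| * (K k * weight q ^ k) := by gcongr; exact hK k q y
      _ = _ := by ring
  have heq : (fun y => trigSeries a y • Ξ y) = fun y => ∑' q, a q • trig q y • Ξ y := by
    funext y
    simp only [trigSeries, smul_smul]
    exact ((summable_mul_trig ha y).hasSum.smul_const (Ξ y)).tsum_eq.symm
  have h3 := iteratedFDeriv_tsum (N := ⊤) hs (fun k _ => (ha k).mul_left (K k))
    (fun k q y _ => hbd k q y) (k := n) le_top
  rw [heq, h3]
  have h4 := tendstoUniformly_tsum ((ha n).mul_left (K n)) (fun q y => hbd n q y)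
  have h5 : (fun S : Finset ((Fin m → ℤ) × Bool) =>
      iteratedFDeriv ℝ n fun y => ∑ q ∈ S, a q • trig q y • Ξ y) = fun S y =>
      ∑ q ∈ S, iteratedFDeriv ℝ n (fun y => a q • trig q y • Ξ y) y := by
    funext S y
    rw [iteratedFDeriv_sum fun q _ => (hs q).of_le (mod_cast le_top), Finset.sum_apply]
  rw [h5]
  exact h4

end TrigSeries

/-- The derivatives of `y ↦ A y (f (τ y))` are controlled by those of `f` on compact sets. -/
theorem exists_norm_iteratedFDeriv_clm_comp_le {E E' G G' : Type*}
    [NormedAddCommGroup E] [NormedSpace ℝ E] [NormedAddCommGroup E'] [NormedSpace ℝ E']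
    [NormedAddCommGroup G] [NormedSpace ℝ G] [NormedAddCommGroup G'] [NormedSpace ℝ G']
    {O K : Set E} (hO : IsOpen O) (hK : IsCompact K) (hKO : K ⊆ O)
    {A : E → G →L[ℝ] G'} {τ : E → E'} (hA : ContDiffOn ℝ ∞ A O) (hτ : ContDiffOn ℝ ∞ τ O) (n : ℕ) :
    ∃ c : ℝ, 0 ≤ c ∧ ∀ f : E' → G, ContDiff ℝ ∞ f → ∀ ε : ℝ, 0 ≤ ε →
      (∀ i ≤ n, ∀ z, ‖iteratedFDeriv ℝ i f z‖ ≤ ε) →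
      ∀ y ∈ K, ‖iteratedFDeriv ℝ n (fun y => A y (f (τ y))) y‖ ≤ c * ε := by
  have hu := hO.uniqueDiffOn (𝕜 := ℝ)
  have hbA : ∀ i : ℕ, ∃ a, ∀ y ∈ K, ‖iteratedFDerivWithin ℝ i A O y‖ ≤ a := fun i =>
    hK.exists_bound_of_continuousOn
      ((hA.continuousOn_iteratedFDerivWithin (mod_cast le_top) hu).mono hKO)
  have hbτ : ∀ i : ℕ, ∃ a, ∀ y ∈ K, ‖iteratedFDerivWithin ℝ i τ O y‖ ≤ a := fun i =>
    hK.exists_bound_of_continuousOn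
      ((hτ.continuousOn_iteratedFDerivWithin (mod_cast le_top) hu).mono hKO)
  choose a ha using hbA
  choose t ht using hbτ
  set D : ℝ := 1 + ∑ i ∈ Finset.range (n + 1), |t i| with hD
  have hD1 : 1 ≤ D := le_add_of_nonneg_right (Finset.sum_nonneg fun i _ => abs_nonneg _)
  have hDt : ∀ i ≤ n, t i ≤ D := fun i hi => by
    have := Finset.single_le_sum (f := fun i => |t i|) (fun i _ => abs_nonneg _)
      (Finset.mem_range.2 (Nat.lt_succ_iff.2 hi))
    have h2 := le_abs_self (t i)
    beta_reduce at this
    linarith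
  refine ⟨∑ i ∈ Finset.range (n + 1), (n.choose i : ℝ) * |a i| * ((n - i).factorial * D ^ (n - i)),
    Finset.sum_nonneg fun i _ => by positivity, fun f hf ε hε hb y hy => ?_⟩
  have hyO := hKO hy
  have hcomp : ∀ j ≤ n, ‖iteratedFDerivWithin ℝ j (f ∘ τ) O y‖ ≤ j.factorial * ε * D ^ j := by
    intro j hj
    refine norm_iteratedFDerivWithin_comp_le (t := Set.univ) hf.contDiffOn hτ
      (mod_cast le_top : (j : ℕ∞ω) ≤ ∞) uniqueDiffOn_univ hu
      (Set.mapsTo_univ _ _) hyO (fun i hi => ?_) fun i hi1 hi => ?_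
    · rw [iteratedFDerivWithin_univ]
      exact hb i (hi.trans hj) _
    · exact ((ht i y hy).trans (hDt i (hi.trans hj))).trans (le_self_pow₀ hD1 (by omega))
  have h1 := norm_iteratedFDerivWithin_clm_apply hA (hf.comp_contDiffOn hτ) hu hyO
    (n := n) (mod_cast le_top)
  rw [← iteratedFDerivWithin_of_isOpen n hO hyO]
  refine h1.trans ?_
  rw [Finset.sum_mul]
  refine Finset.sum_le_sum fun i hi => ?_
  calc _ ≤ (n.choose i : ℝ) * |a i| * ((n - i).factorial * ε * D ^ (n - i)) := by
        gcongr
        · exact (ha i y hy).trans (le_abs_self _)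
        · exact hcomp _ (Nat.sub_le _ _)
    _ = _ := by ring

section LocalSection

variable {m : ℕ} {M : Type*} [TopologicalSpace M] [ChartedSpace (EuclideanSpace ℝ (Fin m)) M]
  {G : Type*} [NormedAddCommGroup G] [NormedSpace ℝ G]
  {V : M → Type*} [TopologicalSpace (TotalSpace G V)] [∀ x, TopologicalSpace (V x)]
  [∀ x, AddCommGroup (V x)] [∀ x, Module ℝ (V x)]
  [FiberBundle G V] [VectorBundle ℝ G V]

variable (m G V) in
/-- The functions on `ℝ^m` which are local expressions at `a` of smooth sections with compact
support in the domain of the chart and the trivialization. -/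
structure IsLocalRep (a : M) (f : EuclideanSpace ℝ (Fin m) → G) : Prop where
  contDiff : ContDiff ℝ ∞ f
  hasCompactSupport : HasCompactSupport f
  tsupport_subset : tsupport f ⊆ localDomain m G V a

variable (m G V) in
/-- The open subset of `M` where both the preferred chart and the preferred trivialization at `a`
are defined. -/
def localSource (a : M) : Set M :=
  (chartAt (EuclideanSpace ℝ (Fin m)) a).source ∩ (trivializationAt G V a).baseSet

theorem isOpen_localSource (a : M) : IsOpen (localSource m G V a) :=
  (chartAt (EuclideanSpace ℝ (Fin m)) a).open_source.inter (Trivialization.open_baseSet _)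

theorem mem_localSource (a : M) : a ∈ localSource m G V a :=
  ⟨mem_chart_source _ a, FiberBundle.mem_baseSet_trivializationAt' a⟩

theorem isOpen_localDomain (a : M) : IsOpen (localDomain m G V a) :=
  (continuousOn_extChartAt_symm (I := 𝓡 m) a).isOpen_inter_preimage
    (isOpen_extChartAt_target a) (Trivialization.open_baseSet _)

theorem symm_mem_localSource {a : M} {y : EuclideanSpace ℝ (Fin m)}
    (hy : y ∈ localDomain m G V a) : (extChartAt (𝓡 m) a).symm y ∈ localSource m G V a := by
  refine ⟨?_, hy.2⟩
  have := (extChartAt (𝓡 m) a).map_target hy.1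
  rwa [extChartAt_source] at this

theorem extChartAt_mem_localDomain {a x : M} (hx : x ∈ localSource m G V a) :
    extChartAt (𝓡 m) a x ∈ localDomain m G V a := by
  have h : x ∈ (extChartAt (𝓡 m) a).source := by rw [extChartAt_source]; exact hx.1
  refine ⟨(extChartAt (𝓡 m) a).map_source h, ?_⟩
  rw [Set.mem_preimage, (extChartAt (𝓡 m) a).left_inv h]
  exact hx.2

theorem symm_extChartAt {a x : M} (hx : x ∈ localSource m G V a) :
    (extChartAt (𝓡 m) a).symm (extChartAt (𝓡 m) a x) = x :=
  (extChartAt (𝓡 m) a).left_inv (by rw [extChartAt_source]; exact hx.1)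

variable (m G V) in
/-- The section, supported in the chart domain at `a`, with local expression `f`. -/
def localSectionFun (a : M) (f : EuclideanSpace ℝ (Fin m) → G) (x : M) : V x :=
  (trivializationAt G V a).symmL ℝ x
    ((chartAt (EuclideanSpace ℝ (Fin m)) a).source.indicator (fun x => f (extChartAt (𝓡 m) a x)) x)

theorem localSectionFun_of_mem {a x : M} {f : EuclideanSpace ℝ (Fin m) → G}
    (hx : x ∈ localSource m G V a) : localSectionFun m G V a f x =
      (trivializationAt G V a).symmL ℝ x (f (extChartAt (𝓡 m) a x)) := by
  rw [localSectionFun, Set.indicator_of_mem hx.1]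

theorem trivializationAt_localSectionFun {a x : M} {f : EuclideanSpace ℝ (Fin m) → G}
    (hx : x ∈ localSource m G V a) :
    (trivializationAt G V a ⟨x, localSectionFun m G V a f x⟩).2 = f (extChartAt (𝓡 m) a x) := by
  rw [localSectionFun_of_mem hx, Trivialization.symmL_apply _ hx.2,
    Trivialization.apply_mk_symm _ hx.2]

theorem localRep_localSectionFun {a : M} {f : EuclideanSpace ℝ (Fin m) → G}
    {y : EuclideanSpace ℝ (Fin m)} (hy : y ∈ localDomain m G V a) :
    localRep m G V a (localSectionFun m G V a f) y = f y := by
  rw [localRep, trivializationAt_localSectionFun (symm_mem_localSource hy),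
    (extChartAt (𝓡 m) a).right_inv hy.1]

theorem localSectionFun_eq_zero {a x : M} {f : EuclideanSpace ℝ (Fin m) → G}
    {K : Set (EuclideanSpace ℝ (Fin m))} (hf : tsupport f ⊆ K)
    (hx : x ∉ (extChartAt (𝓡 m) a).symm '' K) : localSectionFun m G V a f x = 0 := by
  by_cases hs : x ∈ localSource m G V a
  · rw [localSectionFun_of_mem hs, image_eq_zero_of_notMem_tsupport (f := f), map_zero]
    exact fun h => hx ⟨_, hf h, symm_extChartAt hs⟩
  · rw [localSectionFun]
    by_cases h1 : x ∈ (chartAt (EuclideanSpace ℝ (Fin m)) a).source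
    · rw [Trivialization.symmL_apply_of_notMem]
      exact fun h2 => hs ⟨h1, h2⟩
    · rw [Set.indicator_of_notMem h1, map_zero]

theorem localSectionFun_const_smul (a : M) (c : ℝ) (f : EuclideanSpace ℝ (Fin m) → G) (x : M) :
    localSectionFun m G V a (fun y => c • f y) x = c • localSectionFun m G V a f x := by
  simp only [localSectionFun, ← map_smul]
  congr 1
  exact congrFun (Set.indicator_const_smul _ c _) x

theorem localSectionFun_sum {ι : Type*} (S : Finset ι) (a : M)
    (f : ι → EuclideanSpace ℝ (Fin m) → G) (x : M) :
    localSectionFun m G V a (fun y => ∑ i ∈ S, f i y) x =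
      ∑ i ∈ S, localSectionFun m G V a (f i) x := by
  simp only [localSectionFun, ← map_sum]
  congr 1
  by_cases h : x ∈ (chartAt (EuclideanSpace ℝ (Fin m)) a).source <;> simp [h]

theorem isCompact_symm_image {a : M} {K : Set (EuclideanSpace ℝ (Fin m))} (hK : IsCompact K)
    (hKD : K ⊆ localDomain m G V a) : IsCompact ((extChartAt (𝓡 m) a).symm '' K) :=
  hK.image_of_continuousOn
    ((continuousOn_extChartAt_symm (I := 𝓡 m) a).mono fun _ hy => (hKD hy).1)

theorem symm_image_subset {a : M} {K : Set (EuclideanSpace ℝ (Fin m))}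
    (hKD : K ⊆ localDomain m G V a) :
    (extChartAt (𝓡 m) a).symm '' K ⊆ localSource m G V a := by
  rintro _ ⟨y, hy, rfl⟩
  exact symm_mem_localSource (hKD hy)

variable [IsManifold (𝓡 m) ∞ M] [ContMDiffVectorBundle ∞ G V (𝓡 m)]

theorem contMDiff_localSectionFun [T2Space M] {a : M} {f : EuclideanSpace ℝ (Fin m) → G}
    (hf : IsLocalRep m G V a f) :
    ContMDiff (𝓡 m) ((𝓡 m).prod 𝓘(ℝ, G)) ∞
      fun x => TotalSpace.mk' G x (localSectionFun m G V a f x) := by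
  intro x
  by_cases hx : x ∈ localSource m G V a
  · rw [(trivializationAt G V a).contMDiffAt_section_iff hx.2]
    have h1 : ContMDiffAt (𝓡 m) 𝓘(ℝ, G) ∞ (fun x => f (extChartAt (𝓡 m) a x)) x :=
      hf.contDiff.contMDiff.contMDiffAt.comp x (contMDiffAt_extChartAt' hx.1)
    refine h1.congr_of_eventuallyEq ?_
    filter_upwards [(isOpen_localSource a).mem_nhds hx] with z hz
    exact trivializationAt_localSectionFun hz
  · have hcl : IsClosed ((extChartAt (𝓡 m) a).symm '' tsupport f) :=
      (isCompact_symm_image (G := G) (V := V) hf.hasCompactSupport hf.tsupport_subset).isClosed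
    have hx' : x ∉ (extChartAt (𝓡 m) a).symm '' tsupport f := fun h =>
      hx (symm_image_subset hf.tsupport_subset h)
    have h0 := (contMDiff_zeroSection (n := ∞) (IB := 𝓡 m) ℝ V (F := G)).contMDiffAt (x := x)
    refine h0.congr_of_eventuallyEq ?_
    filter_upwards [hcl.isOpen_compl.mem_nhds hx'] with z hz
    rw [localSectionFun_eq_zero subset_rfl hz]
    rfl

/-- The smooth section, supported in the chart domain at `a`, with local expression `f`. -/
def localSection [T2Space M] (a : M) (f : EuclideanSpace ℝ (Fin m) → G)
    (hf : IsLocalRep m G V a f) : Cₛ^∞⟮𝓡 m; G, V⟯ :=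
  ⟨localSectionFun m G V a f, contMDiff_localSectionFun hf⟩

theorem localSection_apply [T2Space M] {a : M} {f : EuclideanSpace ℝ (Fin m) → G}
    (hf : IsLocalRep m G V a f) (x : M) :
    localSection a f hf x = localSectionFun m G V a f x := rfl

theorem contDiffOn_localRep (a : M) (s : Cₛ^∞⟮𝓡 m; G, V⟯) :
    ContDiffOn ℝ ∞ (localRep m G V a s) (localDomain m G V a) := by
  intro y hy
  have h1 := ((trivializationAt G V a).contMDiffAt_section_iff
    (symm_mem_localSource hy).2).1 (s.contMDiff _)
  have h2 : ContMDiffAt (𝓡 m) (𝓡 m) ∞ (extChartAt (𝓡 m) a).symm y :=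
    (contMDiffOn_extChartAt_symm a).contMDiffAt ((isOpen_extChartAt_target a).mem_nhds hy.1)
  exact (h1.comp y h2).contDiffAt.contDiffWithinAt

/-- A smooth section with compact support in a chart domain is given by its local expression. -/
theorem exists_localSection_eq [T2Space M] {a : M} (s : Cₛ^∞⟮𝓡 m; G, V⟯) {K : Set M}
    (hK : IsCompact K) (hKa : K ⊆ localSource m G V a) (hs : ∀ x ∉ K, s x = 0) :
    ∃ (f : EuclideanSpace ℝ (Fin m) → G) (hf : IsLocalRep m G V a f),
      tsupport f ⊆ extChartAt (𝓡 m) a '' K ∧ s = localSection a f hf ∧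
      ∀ y ∈ localDomain m G V a, f y = localRep m G V a s y := by
  have hK' : IsCompact (extChartAt (𝓡 m) a '' K) := hK.image_of_continuousOn
    ((continuousOn_extChartAt (I := 𝓡 m) a).mono fun x hx => by
      rw [extChartAt_source]; exact (hKa hx).1)
  have hKD : extChartAt (𝓡 m) a '' K ⊆ localDomain m G V a := by
    rintro _ ⟨x, hx, rfl⟩
    exact extChartAt_mem_localDomain (hKa hx)
  have hzero : ∀ y ∈ localDomain m G V a, y ∉ extChartAt (𝓡 m) a '' K →
      localRep m G V a s y = 0 := by
    intro y hy hyK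
    have h1 : (extChartAt (𝓡 m) a).symm y ∉ K := fun h =>
      hyK ⟨_, h, (extChartAt (𝓡 m) a).right_inv hy.1⟩
    rw [localRep, hs _ h1, ← Trivialization.continuousLinearMapAt_apply_of_mem (R := ℝ) _ hy.2,
      map_zero]
  set f := (localDomain m G V a).indicator (localRep m G V a s) with hf
  have hsupp : Function.support f ⊆ extChartAt (𝓡 m) a '' K := by
    intro y hy
    by_contra hyK
    apply hy
    by_cases hyD : y ∈ localDomain m G V a
    · rw [hf, Set.indicator_of_mem hyD, hzero y hyD hyK]
    · rw [hf, Set.indicator_of_notMem hyD]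
  have htsupp : tsupport f ⊆ extChartAt (𝓡 m) a '' K := closure_minimal hsupp hK'.isClosed
  have hfl : IsLocalRep m G V a f := by
    refine ⟨contDiff_iff_contDiffAt.2 fun y => ?_, HasCompactSupport.intro hK' fun y hy => ?_,
      htsupp.trans hKD⟩
    · by_cases hyD : y ∈ localDomain m G V a
      · have hn := (isOpen_localDomain a).mem_nhds hyD
        refine ((contDiffOn_localRep a s).contDiffAt hn).congr_of_eventuallyEq ?_
        filter_upwards [hn] with z hz
        rw [hf, Set.indicator_of_mem hz]
      · have hn := hK'.isClosed.isOpen_compl.mem_nhds fun h => hyD (hKD h)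
        refine contDiffAt_const (c := (0 : G)).congr_of_eventuallyEq ?_
        filter_upwards [hn] with z hz
        by_contra h
        exact hz (hsupp h)
    · by_contra h
      exact hy (hsupp h)
  refine ⟨f, hfl, htsupp, ?_, fun y hy => Set.indicator_of_mem hy _⟩
  ext x
  rw [localSection_apply]
  by_cases hx : x ∈ localSource m G V a
  · rw [localSectionFun_of_mem hx, hf, Set.indicator_of_mem (extChartAt_mem_localDomain hx),
      localRep, symm_extChartAt hx,
      ← Trivialization.continuousLinearMapAt_apply_of_mem (R := ℝ) _ hx.2,
      Trivialization.symmL_continuousLinearMapAt _ hx.2]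
  · rw [hs x fun h => hx (hKa h), localSectionFun_eq_zero (K := extChartAt (𝓡 m) a '' K) htsupp]
    rintro ⟨y, hy, rfl⟩
    exact hx (symm_mem_localSource (hKD hy))

theorem tendsto_localSection [T2Space M] {a : M} {K₀ : Set (EuclideanSpace ℝ (Fin m))}
    (hK₀ : IsCompact K₀) (hK₀D : K₀ ⊆ localDomain m G V a) {ι : Type*} {l : Filter ι}
    {g : ι → EuclideanSpace ℝ (Fin m) → G} {f : EuclideanSpace ℝ (Fin m) → G}
    (hg : ∀ i, IsLocalRep m G V a (g i)) (hf : IsLocalRep m G V a f)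
    (hgK : ∀ i, tsupport (g i) ⊆ K₀) (hfK : tsupport f ⊆ K₀)
    (h : ∀ n, TendstoUniformly (fun i => iteratedFDeriv ℝ n (g i)) (iteratedFDeriv ℝ n f) l) :
    Filter.Tendsto (fun i => localSection a (g i) (hg i)) l (𝓝 (localSection a f hf)) := by
  set K₁ : Set M := (extChartAt (𝓡 m) a).symm '' K₀ with hK₁
  have hK₁c : IsClosed K₁ := (isCompact_symm_image (G := G) (V := V) hK₀ hK₀D).isClosed
  have hK₁s : K₁ ⊆ localSource m G V a := symm_image_subset hK₀D
  rw [sectionTopology]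
  simp only [nhds_iInf, Filter.tendsto_iInf, nhds_induced, Filter.tendsto_comap_iff]
  intro b n
  rw [UniformOnFun.tendsto_iff_tendstoUniformlyOn]
  rintro K ⟨hK, hKD⟩
  rw [Metric.tendstoUniformlyOn_iff]
  intro ε hε
  set O : Set (EuclideanSpace ℝ (Fin m)) := localDomain m G V b ∩
    (extChartAt (𝓡 m) b).symm ⁻¹' localSource m G V a with hO
  have hOo : IsOpen O := ((continuousOn_extChartAt_symm (I := 𝓡 m) b).mono
    fun y hy => hy.1).isOpen_inter_preimage (isOpen_localDomain b) (isOpen_localSource a)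
  have hsm : ContMDiffOn (𝓡 m) (𝓡 m) ∞ (extChartAt (𝓡 m) b).symm O :=
    (contMDiffOn_extChartAt_symm b).mono fun y hy => hy.1.1
  set A : EuclideanSpace ℝ (Fin m) → G →L[ℝ] G := fun y =>
    ((trivializationAt G V a).coordChangeL ℝ (trivializationAt G V b)
      ((extChartAt (𝓡 m) b).symm y) : G →L[ℝ] G) with hA
  set τ : EuclideanSpace ℝ (Fin m) → EuclideanSpace ℝ (Fin m) := fun y =>
    extChartAt (𝓡 m) a ((extChartAt (𝓡 m) b).symm y) with hτ
  have hAs : ContDiffOn ℝ ∞ A O :=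
    (hsm.coordChangeL (fun y hy => hy.2.2) (fun y hy => hy.1.2)).contDiffOn
  have hτs : ContDiffOn ℝ ∞ τ O :=
    ((contMDiffOn_extChartAt (x := a)).comp hsm fun y hy => hy.2.1).contDiffOn
  have hrep : ∀ (f : EuclideanSpace ℝ (Fin m) → G), ∀ y ∈ O,
      localRep m G V b (localSectionFun m G V a f) y = A y (f (τ y)) := by
    intro f y hy
    rw [localRep, localSectionFun_of_mem hy.2, Trivialization.symmL_apply _ hy.2.2]
    exact (Trivialization.coordChangeL_apply _ _ ⟨hy.2.2, hy.1.2⟩ _).symm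
  have hrep0 : ∀ (f : EuclideanSpace ℝ (Fin m) → G), tsupport f ⊆ K₀ →
      ∀ y ∈ localDomain m G V b, (extChartAt (𝓡 m) b).symm y ∉ K₁ →
      localRep m G V b (localSectionFun m G V a f) y = 0 := by
    intro f hf y hy hyK
    rw [localRep, localSectionFun_eq_zero hf hyK,
      ← Trivialization.continuousLinearMapAt_apply_of_mem (R := ℝ) _ hy.2, map_zero]
  have hKb : ContinuousOn (extChartAt (𝓡 m) b).symm K :=
    (continuousOn_extChartAt_symm (I := 𝓡 m) b).mono fun y hy => (hKD hy).1
  set K₂ := K ∩ (extChartAt (𝓡 m) b).symm ⁻¹' K₁ with hK₂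
  have hK₂c : IsCompact K₂ := hK.of_isClosed_subset
    (hKb.preimage_isClosed_of_isClosed hK.isClosed hK₁c) Set.inter_subset_left
  have hK₂O : K₂ ⊆ O := fun y hy => ⟨hKD hy.1, hK₁s hy.2⟩
  obtain ⟨c, hc0, hc⟩ := exists_norm_iteratedFDeriv_clm_comp_le hOo hK₂c hK₂O hAs hτs n
  have hδ : 0 < ε / (c + 1) := by positivity
  have hev : ∀ᶠ i in l, ∀ k ≤ n, ∀ z,
      ‖iteratedFDeriv ℝ k f z - iteratedFDeriv ℝ k (g i) z‖ ≤ ε / (c + 1) := by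
    have : ∀ᶠ i in l, ∀ k ∈ Finset.range (n + 1), ∀ z,
        ‖iteratedFDeriv ℝ k f z - iteratedFDeriv ℝ k (g i) z‖ ≤ ε / (c + 1) := by
      rw [Filter.eventually_all_finset]
      intro k _
      filter_upwards [Metric.tendstoUniformly_iff.1 (h k) _ hδ] with i hi z
      rw [← dist_eq_norm]
      exact (hi z).le
    filter_upwards [this] with i hi k hk
    exact hi k (Finset.mem_range.2 (Nat.lt_succ_iff.2 hk))
  filter_upwards [hev] with i hi y hyK
  simp only [Function.comp_apply, UniformOnFun.toFun_ofFun]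
  change dist (iteratedFDeriv ℝ n (localRep m G V b (localSectionFun m G V a f)) y)
    (iteratedFDeriv ℝ n (localRep m G V b (localSectionFun m G V a (g i))) y) < ε
  by_cases hyK₁ : (extChartAt (𝓡 m) b).symm y ∈ K₁
  · have hyO : y ∈ O := hK₂O ⟨hyK, hyK₁⟩
    have hn := hOo.mem_nhds hyO
    have hev2 : ∀ f : EuclideanSpace ℝ (Fin m) → G,
        localRep m G V b (localSectionFun m G V a f) =ᶠ[𝓝 y] fun y => A y (f (τ y)) := fun f => by
      filter_upwards [hn] with z hz using hrep f z hz
    have hcd : ∀ f : EuclideanSpace ℝ (Fin m) → G, ContDiff ℝ ∞ f →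
        ContDiffAt ℝ n (fun y => A y (f (τ y))) y := fun f hf =>
      (((hAs.contDiffAt hn).clm_apply (hf.contDiffAt.comp y (hτs.contDiffAt hn)))).of_le
        (mod_cast le_top)
    rw [((hev2 f).iteratedFDeriv ℝ n).eq_of_nhds, ((hev2 (g i)).iteratedFDeriv ℝ n).eq_of_nhds,
      dist_eq_norm, ← iteratedFDeriv_sub_apply (hcd f hf.contDiff) (hcd _ (hg i).contDiff)]
    have h5 := hc (fun z => f z - g i z) (hf.contDiff.sub (hg i).contDiff) _ hδ.le (fun k hk z => by
      have h6 := iteratedFDeriv_sub_apply (i := k) (x := z)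
        (hf.contDiff.contDiffAt.of_le (mod_cast le_top))
        ((hg i).contDiff.contDiffAt.of_le (mod_cast le_top))
      have h7 : (fun z => f z - g i z) = f - g i := rfl
      rw [h7, h6]
      exact hi k hk z) y ⟨hyK, hyK₁⟩
    have h8 : ((fun y => A y (f (τ y))) - fun y => A y (g i (τ y))) =
        fun y => A y (f (τ y) - g i (τ y)) := by
      funext y
      simp
    rw [h8]
    refine h5.trans_lt ?_
    rw [mul_div_assoc', div_lt_iff₀ (by positivity)]
    nlinarith
  · have hopen : IsOpen (localDomain m G V b ∩ (extChartAt (𝓡 m) b).symm ⁻¹' K₁ᶜ) :=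
      ((continuousOn_extChartAt_symm (I := 𝓡 m) b).mono
        fun y hy => hy.1).isOpen_inter_preimage (isOpen_localDomain b) hK₁c.isOpen_compl
    have hn := hopen.mem_nhds ⟨hKD hyK, hyK₁⟩
    have hev3 : ∀ f : EuclideanSpace ℝ (Fin m) → G, tsupport f ⊆ K₀ →
        localRep m G V b (localSectionFun m G V a f) =ᶠ[𝓝 y] fun _ => 0 := fun f hf => by
      filter_upwards [hn] with z hz using hrep0 f hf z hz.1 hz.2
    rw [((hev3 f hfK).iteratedFDeriv ℝ n).eq_of_nhds,
      ((hev3 (g i) (hgK i)).iteratedFDeriv ℝ n).eq_of_nhds, dist_self]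
    exact hε

end LocalSection

section ChartChange

variable {m : ℕ} {M : Type*} [TopologicalSpace M] [ChartedSpace (EuclideanSpace ℝ (Fin m)) M]
  [IsManifold (𝓡 m) ∞ M]

/-- The part of the chart target at `a` that lies over the chart domain at `b`. -/
def chartOverlap (m : ℕ) {M : Type*} [TopologicalSpace M]
    [ChartedSpace (EuclideanSpace ℝ (Fin m)) M] (a b : M) : Set (EuclideanSpace ℝ (Fin m)) :=
  (extChartAt (𝓡 m) a).target ∩ (extChartAt (𝓡 m) a).symm ⁻¹'
    (chartAt (EuclideanSpace ℝ (Fin m)) b).source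

theorem isOpen_chartOverlap (a b : M) : IsOpen (chartOverlap m a b) :=
  (continuousOn_extChartAt_symm (I := 𝓡 m) a).isOpen_inter_preimage
    (isOpen_extChartAt_target a) (chartAt (EuclideanSpace ℝ (Fin m)) b).open_source

/-- The change of charts from `a` to `b`. -/
def chartChange (m : ℕ) {M : Type*} [TopologicalSpace M]
    [ChartedSpace (EuclideanSpace ℝ (Fin m)) M] (a b : M) :
    EuclideanSpace ℝ (Fin m) → EuclideanSpace ℝ (Fin m) :=
  extChartAt (𝓡 m) b ∘ (extChartAt (𝓡 m) a).symm

theorem symm_mem_source_of_mem_target {a : M} {y : EuclideanSpace ℝ (Fin m)}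
    (hy : y ∈ (extChartAt (𝓡 m) a).target) :
    (extChartAt (𝓡 m) a).symm y ∈ (chartAt (EuclideanSpace ℝ (Fin m)) a).source := by
  have := (extChartAt (𝓡 m) a).map_target hy
  rwa [extChartAt_source] at this

theorem symm_chartChange {a b : M} {y : EuclideanSpace ℝ (Fin m)} (hy : y ∈ chartOverlap m a b) :
    (extChartAt (𝓡 m) b).symm (chartChange m a b y) = (extChartAt (𝓡 m) a).symm y :=
  (extChartAt (𝓡 m) b).left_inv (by rw [extChartAt_source]; exact hy.2)

theorem chartChange_mem {a b : M} {y : EuclideanSpace ℝ (Fin m)} (hy : y ∈ chartOverlap m a b) :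
    chartChange m a b y ∈ chartOverlap m b a := by
  refine ⟨(extChartAt (𝓡 m) b).map_source (by rw [extChartAt_source]; exact hy.2), ?_⟩
  rw [Set.mem_preimage, symm_chartChange hy]
  exact symm_mem_source_of_mem_target hy.1

theorem chartChange_chartChange {a b : M} {y : EuclideanSpace ℝ (Fin m)}
    (hy : y ∈ chartOverlap m a b) : chartChange m b a (chartChange m a b y) = y := by
  have h := symm_chartChange hy
  change extChartAt (𝓡 m) a ((extChartAt (𝓡 m) b).symm (chartChange m a b y)) = y
  rw [h, (extChartAt (𝓡 m) a).right_inv hy.1]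

theorem injOn_chartChange (a b : M) : Set.InjOn (chartChange m a b) (chartOverlap m a b) :=
  fun y hy z hz h => by rw [← chartChange_chartChange hy, h, chartChange_chartChange hz]

theorem image_chartChange (a b : M) :
    chartChange m a b '' chartOverlap m a b = chartOverlap m b a := by
  refine Set.Subset.antisymm (by rintro _ ⟨y, hy, rfl⟩; exact chartChange_mem hy) fun z hz => ?_
  exact ⟨_, chartChange_mem hz, chartChange_chartChange hz⟩

theorem hasFDerivAt_chartChange {a b : M} {y : EuclideanSpace ℝ (Fin m)}
    (hy : y ∈ chartOverlap m a b) :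
    HasFDerivAt (chartChange m a b)
      (tangentCoordChange (𝓡 m) a b ((extChartAt (𝓡 m) a).symm y)) y := by
  have : IsManifold (𝓡 m) 1 M := IsManifold.of_le (n := ∞) (mod_cast le_top)
  have h := hasFDerivWithinAt_tangentCoordChange (I := 𝓡 m) (x := a) (y := b)
    (z := (extChartAt (𝓡 m) a).symm y)
    ⟨by rw [extChartAt_source]; exact symm_mem_source_of_mem_target hy.1,
      by rw [extChartAt_source]; exact hy.2⟩
  rw [(extChartAt (𝓡 m) a).right_inv hy.1, ModelWithCorners.range_eq_univ,
    hasFDerivWithinAt_univ] at h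
  exact h

/-- The absolute value of the Jacobian determinant of the change of charts from `a` to `b`. -/
def absJacobian (a b x : M) : ℝ := |(tangentCoordChange (𝓡 m) a b x).det|

theorem densityCoord_eq_absJacobian_mul {a b x : M}
    (ha : x ∈ (chartAt (EuclideanSpace ℝ (Fin m)) a).source)
    (hb : x ∈ (chartAt (EuclideanSpace ℝ (Fin m)) b).source) (d : Density m M x) :
    densityCoord m a x d = absJacobian (m := m) a b x * densityCoord m b x d := by
  have h : ∀ c : M, x ∈ (chartAt (EuclideanSpace ℝ (Fin m)) c).source → densityCoord m c x d =
      (densityCore m M).coordChange (achart _ x) (achart _ c) x d := by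
    intro c hc
    exact congrArg (fun L : ℝ →L[ℝ] ℝ => L d)
      ((densityCore m M).trivializationAt_continuousLinearMapAt (b₀ := c) (b := x) hc)
  rw [h a ha, h b hb]
  exact ((densityCore m M).coordChange_comp (achart _ x) (achart _ b) (achart _ a) x
    ⟨⟨mem_chart_source _ x, hb⟩, ha⟩ d).symm

theorem setIntegral_chart_eq {a b : M} {P Q : M → ℝ}
    (h : ∀ x ∈ (chartAt (EuclideanSpace ℝ (Fin m)) a).source,
      x ∈ (chartAt (EuclideanSpace ℝ (Fin m)) b).source → P x = absJacobian (m := m) a b x * Q x)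
    (hP : ∀ x ∉ (chartAt (EuclideanSpace ℝ (Fin m)) b).source, P x = 0)
    (hQ : ∀ x ∉ (chartAt (EuclideanSpace ℝ (Fin m)) a).source, Q x = 0) :
    ∫ y in (extChartAt (𝓡 m) a).target, P ((extChartAt (𝓡 m) a).symm y) =
      ∫ y in (extChartAt (𝓡 m) b).target, Q ((extChartAt (𝓡 m) b).symm y) := by
  rw [setIntegral_eq_of_subset_of_forall_sdiff_eq_zero (isOpen_extChartAt_target a).measurableSet
      (s := chartOverlap m a b) Set.inter_subset_left fun y hy => hP _ fun h => hy.2 ⟨hy.1, h⟩,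
    setIntegral_eq_of_subset_of_forall_sdiff_eq_zero (isOpen_extChartAt_target b).measurableSet
      (s := chartOverlap m b a) Set.inter_subset_left fun y hy => hQ _ fun h => hy.2 ⟨hy.1, h⟩,
    ← image_chartChange a b, integral_image_eq_integral_abs_det_fderiv_smul volume
      (isOpen_chartOverlap a b).measurableSet
      (fun y hy => (hasFDerivAt_chartChange hy).hasFDerivWithinAt) (injOn_chartChange a b)]
  refine setIntegral_congr_fun (isOpen_chartOverlap a b).measurableSet fun y hy => ?_
  rw [symm_chartChange hy, h _ (symm_mem_source_of_mem_target hy.1) hy.2]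
  rfl

theorem setIntegral_chart_prod_eq {a b : M × M} {P Q : M → M → ℝ}
    (h : ∀ x z, x ∈ (chartAt (EuclideanSpace ℝ (Fin m)) a.1).source →
      x ∈ (chartAt (EuclideanSpace ℝ (Fin m)) b.1).source →
      z ∈ (chartAt (EuclideanSpace ℝ (Fin m)) a.2).source →
      z ∈ (chartAt (EuclideanSpace ℝ (Fin m)) b.2).source →
      P x z = absJacobian (m := m) a.1 b.1 x * absJacobian (m := m) a.2 b.2 z * Q x z)
    (hP : ∀ x z, ¬ (x ∈ (chartAt (EuclideanSpace ℝ (Fin m)) b.1).source ∧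
      z ∈ (chartAt (EuclideanSpace ℝ (Fin m)) b.2).source) → P x z = 0)
    (hQ : ∀ x z, ¬ (x ∈ (chartAt (EuclideanSpace ℝ (Fin m)) a.1).source ∧
      z ∈ (chartAt (EuclideanSpace ℝ (Fin m)) a.2).source) → Q x z = 0) :
    ∫ w in (extChartAt (𝓡 m) a.1).target ×ˢ (extChartAt (𝓡 m) a.2).target,
      P ((extChartAt (𝓡 m) a.1).symm w.1) ((extChartAt (𝓡 m) a.2).symm w.2) =
    ∫ w in (extChartAt (𝓡 m) b.1).target ×ˢ (extChartAt (𝓡 m) b.2).target,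
      Q ((extChartAt (𝓡 m) b.1).symm w.1) ((extChartAt (𝓡 m) b.2).symm w.2) := by
  have hvol : (volume : Measure (EuclideanSpace ℝ (Fin m) ×
      EuclideanSpace ℝ (Fin m))).IsAddHaarMeasure :=
    Measure.prod.instIsAddHaarMeasure volume volume
  have hopen : ∀ a b : M × M, MeasurableSet (chartOverlap m a.1 b.1 ×ˢ chartOverlap m a.2 b.2) :=
    fun a b => ((isOpen_chartOverlap _ _).prod (isOpen_chartOverlap _ _)).measurableSet
  have himg : Prod.map (chartChange m a.1 b.1) (chartChange m a.2 b.2) ''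
      (chartOverlap m a.1 b.1 ×ˢ chartOverlap m a.2 b.2) =
      chartOverlap m b.1 a.1 ×ˢ chartOverlap m b.2 a.2 := by
    rw [Set.prodMap_image_prod, image_chartChange, image_chartChange]
  have hsub : ∀ a b : M × M, chartOverlap m a.1 b.1 ×ˢ chartOverlap m a.2 b.2 ⊆
      (extChartAt (𝓡 m) a.1).target ×ˢ (extChartAt (𝓡 m) a.2).target := fun a b =>
    Set.prod_mono Set.inter_subset_left Set.inter_subset_left
  have htgt : ∀ a : M × M, MeasurableSet ((extChartAt (𝓡 m) a.1).target ×ˢ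
      (extChartAt (𝓡 m) a.2).target) := fun a =>
    ((isOpen_extChartAt_target _).prod (isOpen_extChartAt_target _)).measurableSet
  rw [setIntegral_eq_of_subset_of_forall_sdiff_eq_zero (htgt a) (hsub a b) fun w hw =>
      hP _ _ fun h => hw.2 ⟨⟨hw.1.1, h.1⟩, ⟨hw.1.2, h.2⟩⟩,
    setIntegral_eq_of_subset_of_forall_sdiff_eq_zero (htgt b) (hsub b a) fun w hw =>
      hQ _ _ fun h => hw.2 ⟨⟨hw.1.1, h.1⟩, ⟨hw.1.2, h.2⟩⟩,
    ← himg, integral_image_eq_integral_abs_det_fderiv_smul volume (hopen a b)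
      (fun w hw => ((hasFDerivAt_chartChange hw.1).prodMap w
        (hasFDerivAt_chartChange hw.2)).hasFDerivWithinAt)
      ((injOn_chartChange a.1 b.1).prodMap (injOn_chartChange a.2 b.2))]
  refine setIntegral_congr_fun (hopen a b) fun w hw => ?_
  simp only [Prod.map_fst, Prod.map_snd]
  rw [symm_chartChange hw.1, symm_chartChange hw.2,
    h _ _ (symm_mem_source_of_mem_target hw.1.1) hw.1.2 (symm_mem_source_of_mem_target hw.2.1)
      hw.2.2, smul_eq_mul]
  congr 1
  rw [absJacobian, absJacobian, ← abs_mul]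
  congr 1
  exact (LinearMap.det_prodMap _ _).symm

variable [T2Space M] [CompactSpace M]

theorem sum_chartPartition (x : M) :
    ∑ b ∈ (finite_support_chartPartition m M).toFinset, chartPartition m M b x = 1 := by
  rw [← (chartPartition m M).sum_eq_one (Set.mem_univ x)]
  refine (finsum_eq_sum_of_support_subset _ fun b hb => ?_).symm
  rw [Set.Finite.coe_toFinset]
  exact ⟨x, hb⟩

theorem chartPartition_eq_zero_of_notMem {b x : M}
    (hx : x ∉ (chartAt (EuclideanSpace ℝ (Fin m)) b).source) : chartPartition m M b x = 0 :=
  image_eq_zero_of_notMem_tsupport fun h => hx (tsupport_chartPartition_subset b h)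

theorem continuousOn_chartPartition_symm (a b : M) :
    ContinuousOn (fun y => chartPartition m M b ((extChartAt (𝓡 m) a).symm y))
      (extChartAt (𝓡 m) a).target :=
  (chartPartition m M b).contMDiff.continuous.comp_continuousOn
    (continuousOn_extChartAt_symm (I := 𝓡 m) a)

theorem abs_chartPartition_le_one (b x : M) : |chartPartition m M b x| ≤ 1 := by
  rw [abs_of_nonneg ((chartPartition m M).nonneg b x)]
  exact (chartPartition m M).le_one b x

theorem densityIntegral_eq_setIntegral {a : M} {ρ : ∀ x : M, Density m M x}
    (hρ : ∀ x ∉ (chartAt (EuclideanSpace ℝ (Fin m)) a).source, ρ x = 0)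
    (hi : IntegrableOn (fun y => densityCoord m a ((extChartAt (𝓡 m) a).symm y)
      (ρ ((extChartAt (𝓡 m) a).symm y))) (extChartAt (𝓡 m) a).target) :
    densityIntegral m ρ = ∫ y in (extChartAt (𝓡 m) a).target,
      densityCoord m a ((extChartAt (𝓡 m) a).symm y) (ρ ((extChartAt (𝓡 m) a).symm y)) := by
  have h1 : ∀ b : M, ∫ y in (extChartAt (𝓡 m) b).target,
      chartPartition m M b ((extChartAt (𝓡 m) b).symm y) *
      densityCoord m b ((extChartAt (𝓡 m) b).symm y) (ρ ((extChartAt (𝓡 m) b).symm y)) =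
      ∫ y in (extChartAt (𝓡 m) a).target,
      chartPartition m M b ((extChartAt (𝓡 m) a).symm y) *
      densityCoord m a ((extChartAt (𝓡 m) a).symm y) (ρ ((extChartAt (𝓡 m) a).symm y)) := by
    intro b
    refine setIntegral_chart_eq (a := b) (b := a)
      (P := fun x => chartPartition m M b x * densityCoord m b x (ρ x))
      (Q := fun x => chartPartition m M b x * densityCoord m a x (ρ x)) (fun x hb ha => ?_)
      (fun x hx => ?_) fun x hx => ?_
    · rw [densityCoord_eq_absJacobian_mul hb ha]; ring
    · rw [hρ x hx, map_zero, mul_zero]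
    · rw [chartPartition_eq_zero_of_notMem hx, zero_mul]
  rw [densityIntegral]
  simp only [h1]
  rw [finsum_eq_sum_of_support_subset (s := (finite_support_chartPartition m M).toFinset)]
  · rw [← integral_finsetSum]
    · refine integral_congr_ae (Filter.Eventually.of_forall fun y => ?_)
      beta_reduce
      rw [← Finset.sum_mul, sum_chartPartition, one_mul]
    · intro b _
      refine hi.bdd_mul (c := 1) ((continuousOn_chartPartition_symm a b).aestronglyMeasurable
        (isOpen_extChartAt_target a).measurableSet) (Filter.Eventually.of_forall fun y => ?_)
      exact abs_chartPartition_le_one _ _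
  · intro b hb
    rw [Set.Finite.coe_toFinset]
    by_contra h
    refine hb ?_
    simp only [Set.mem_ofPred_eq, not_exists, not_not] at h
    simp [h]

end ChartChange

section LocalPairing

variable {m : ℕ} {M : Type*} [TopologicalSpace M] [ChartedSpace (EuclideanSpace ℝ (Fin m)) M]
  [IsManifold (𝓡 m) ∞ M]
  {F : Type*} [NormedAddCommGroup F] [NormedSpace ℝ F]
  {E : M → Type*} [TopologicalSpace (TotalSpace F E)] [∀ x, TopologicalSpace (E x)]
  [∀ x, AddCommGroup (E x)] [∀ x, Module ℝ (E x)] [FiberBundle F E] [VectorBundle ℝ F E]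
  [∀ x, IsTopologicalAddGroup (E x)] [∀ x, ContinuousSMul ℝ (E x)]

variable (m F E) in
/-- Functions that are local expressions of compactly supported test sections. -/
abbrev IsLocalTest (a : M) (f : EuclideanSpace ℝ (Fin m) → F →L[ℝ] ℝ) : Prop :=
  IsLocalRep m (F →L[ℝ] ℝ) (fun x : M => E x →L[ℝ] Density m M x) a f

theorem localSource_test (a : M) :
    localSource m (F →L[ℝ] ℝ) (fun x : M => E x →L[ℝ] Density m M x) a = localSource m F E a := by
  ext x
  exact ⟨fun h => ⟨h.1, h.2.1⟩, fun h => ⟨h.1, h.2, h.1⟩⟩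

theorem localDomain_test (a : M) :
    localDomain m (F →L[ℝ] ℝ) (fun x : M => E x →L[ℝ] Density m M x) a = localDomain m F E a := by
  ext y
  exact ⟨fun h => ⟨h.1, h.2.1⟩, fun h => ⟨h.1, h.2, symm_mem_source_of_mem_target h.1⟩⟩

theorem densityCoord_comp {a x : M} (hx : x ∈ localSource m F E a) (u : E x →L[ℝ] Density m M x) :
    (densityCoord m a x).comp u =
      (trivializationAt (F →L[ℝ] ℝ) (fun x : M => E x →L[ℝ] Density m M x) a ⟨x, u⟩).2.comp
        ((trivializationAt F E a).continuousLinearMapAt ℝ x) := by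
  ext e
  rw [hom_trivializationAt_apply]
  change _ = (trivializationAt ℝ (Density m M) a).continuousLinearMapAt ℝ x
    (u ((trivializationAt F E a).symmL ℝ x ((trivializationAt F E a).continuousLinearMapAt ℝ x e)))
  rw [Trivialization.symmL_continuousLinearMapAt _ hx.2]
  rfl

theorem densityCoord_apply {a x : M} (hx : x ∈ localSource m F E a)
    (u : E x →L[ℝ] Density m M x) (e : E x) :
    densityCoord m a x (u e) =
      (trivializationAt (F →L[ℝ] ℝ) (fun x : M => E x →L[ℝ] Density m M x) a ⟨x, u⟩).2
        (trivializationAt F E a ⟨x, e⟩).2 := by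
  have h := congrArg (fun L : E x →L[ℝ] ℝ => L e) (densityCoord_comp hx u)
  rw [← Trivialization.continuousLinearMapAt_apply_of_mem (R := ℝ) _ hx.2]
  exact h

variable [ContMDiffVectorBundle ∞ F E (𝓡 m)] [T2Space M] [CompactSpace M]

theorem toGeneralized_eq_integral {a : M} {s : SmoothSection m F E} {φ : TestSection m F E}
    {h : EuclideanSpace ℝ (Fin m) → ℝ} (hi : Integrable h)
    (hs : ∀ x ∉ localSource m F E a, φ x (s x) = 0)
    (hon : ∀ y ∈ localDomain m F E a, h y =
      localRep m (F →L[ℝ] ℝ) (fun x : M => E x →L[ℝ] Density m M x) a φ y (localRep m F E a s y))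
    (hoff : ∀ y ∉ localDomain m F E a, h y = 0) :
    toGeneralized s φ = ∫ y, h y := by
  have h1 : ∀ y ∈ (extChartAt (𝓡 m) a).target,
      densityCoord m a ((extChartAt (𝓡 m) a).symm y)
        (φ ((extChartAt (𝓡 m) a).symm y) (s ((extChartAt (𝓡 m) a).symm y))) = h y := by
    intro y hy
    by_cases hD : y ∈ localDomain m F E a
    · rw [hon y hD, densityCoord_apply (symm_mem_localSource hD)]
      rfl
    · have hS : (extChartAt (𝓡 m) a).symm y ∉ localSource m F E a := fun h => hD ⟨hy, h.2⟩
      rw [hs _ hS, map_zero, hoff y hD]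
  have hmeas := (isOpen_extChartAt_target (I := 𝓡 m) a).measurableSet
  rw [toGeneralized_apply, densityIntegral_eq_setIntegral (a := a)
    (fun x hx => hs x fun h => hx h.1), setIntegral_congr_fun hmeas h1]
  · exact setIntegral_eq_integral_of_forall_compl_eq_zero fun y hy => hoff y fun h => hy h.1
  · exact (integrableOn_congr_fun h1 hmeas).2 hi.integrableOn

theorem toGeneralized_localTest {a : M} (s : SmoothSection m F E)
    {f : EuclideanSpace ℝ (Fin m) → F →L[ℝ] ℝ} (hf : IsLocalTest m F E a f) :
    toGeneralized s (localSection a f hf) = ∫ y, f y (localRep m F E a s y) := by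
  have hD := hf.tsupport_subset
  rw [localDomain_test] at hD
  have h0 : ∀ y ∉ tsupport f, f y (localRep m F E a s y) = 0 := fun y hy => by
    rw [image_eq_zero_of_notMem_tsupport hy]; rfl
  refine toGeneralized_eq_integral (a := a) ?_ (fun x hx => ?_) (fun y hy => ?_) fun y hy => ?_
  · rw [← integrableOn_iff_integrable_of_support_subset (s := tsupport f)
      fun y hy => by by_contra h; exact hy (h0 y h)]
    refine ContinuousOn.integrableOn_compact hf.hasCompactSupport ?_
    exact hf.contDiff.continuous.continuousOn.clm_apply
      ((contDiffOn_localRep a s).continuousOn.mono hD)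
  · rw [localSection_apply, localSectionFun_eq_zero subset_rfl]
    · rfl
    · rintro h
      exact hx (localSource_test (m := m) (F := F) (E := E) a ▸ symm_image_subset hf.tsupport_subset h)
  · have h := localRep_localSectionFun (G := F →L[ℝ] ℝ)
      (V := fun x : M => E x →L[ℝ] Density m M x) (f := f) (by rw [localDomain_test]; exact hy)
    exact congrArg (fun L : F →L[ℝ] ℝ => L (localRep m F E a s y)) h.symm
  · exact h0 y fun h => hy (hD h)

/-- The expression of a section of `E ⊠ E` in the preferred charts and trivializations. -/
def kernelRep (C : BoxSection m F E) (a b : M)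
    (w : EuclideanSpace ℝ (Fin m) × EuclideanSpace ℝ (Fin m)) : (F →L[ℝ] ℝ) →L[ℝ] F :=
  (trivializationAt ((F →L[ℝ] ℝ) →L[ℝ] F) (BoxBundle m E) (a, b)
    ⟨((extChartAt (𝓡 m) a).symm w.1, (extChartAt (𝓡 m) b).symm w.2), C _⟩).2

end LocalPairing

section LocalPairing

variable {m : ℕ} {M : Type*} [TopologicalSpace M] [ChartedSpace (EuclideanSpace ℝ (Fin m)) M]
  [IsManifold (𝓡 m) ∞ M]
  {F : Type*} [NormedAddCommGroup F] [NormedSpace ℝ F]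
  {E : M → Type*} [TopologicalSpace (TotalSpace F E)] [∀ x, TopologicalSpace (E x)]
  [∀ x, AddCommGroup (E x)] [∀ x, Module ℝ (E x)] [FiberBundle F E] [VectorBundle ℝ F E]
  [∀ x, IsTopologicalAddGroup (E x)] [∀ x, ContinuousSMul ℝ (E x)]

variable [ContMDiffVectorBundle ∞ F E (𝓡 m)] [T2Space M] [CompactSpace M]

theorem mem_baseSet_box {a b x z : M}
    (hx : x ∈ (trivializationAt F E a).baseSet) (hz : z ∈ (trivializationAt F E b).baseSet) :
    (x, z) ∈ (trivializationAt ((F →L[ℝ] ℝ) →L[ℝ] F) (BoxBundle m E) (a, b)).baseSet :=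
  ⟨⟨hx, trivial⟩, hz⟩

set_option synthInstance.maxHeartbeats 100000 in
theorem contDiffOn_kernelRep (C : BoxSection m F E) (a b : M) :
    ContDiffOn ℝ ∞ (kernelRep C a b) (localDomain m F E a ×ˢ localDomain m F E b) := by
  intro w hw
  have h1 := ((trivializationAt ((F →L[ℝ] ℝ) →L[ℝ] F) (BoxBundle m E) (a, b)).contMDiffAt_section_iff
    (x₀ := ((extChartAt (𝓡 m) a).symm w.1, (extChartAt (𝓡 m) b).symm w.2))
    (mem_baseSet_box hw.1.2 hw.2.2)).1 (C.contMDiff _)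
  have h2 : ∀ (a : M) (y : EuclideanSpace ℝ (Fin m)), y ∈ localDomain m F E a →
      ContMDiffAt (𝓡 m) (𝓡 m) ∞ (extChartAt (𝓡 m) a).symm y := fun a y hy =>
    (contMDiffOn_extChartAt_symm a).contMDiffAt ((isOpen_extChartAt_target a).mem_nhds hy.1)
  have h3 : ContMDiffAt 𝓘(ℝ, EuclideanSpace ℝ (Fin m) × EuclideanSpace ℝ (Fin m))
      ((𝓡 m).prod (𝓡 m)) ∞ (fun w : EuclideanSpace ℝ (Fin m) × EuclideanSpace ℝ (Fin m) =>
        ((extChartAt (𝓡 m) a).symm w.1, (extChartAt (𝓡 m) b).symm w.2)) w :=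
    ((h2 a _ hw.1).comp w contDiff_fst.contMDiff.contMDiffAt).prodMk
      ((h2 b _ hw.2).comp w contDiff_snd.contMDiff.contMDiffAt)
  have h4 : ContMDiffAt 𝓘(ℝ, EuclideanSpace ℝ (Fin m) × EuclideanSpace ℝ (Fin m))
      𝓘(ℝ, (F →L[ℝ] ℝ) →L[ℝ] F) ∞ (kernelRep C a b) w :=
    ContMDiffAt.comp w (g := fun p : M × M => (trivializationAt ((F →L[ℝ] ℝ) →L[ℝ] F)
      (BoxBundle m E) (a, b) ⟨p, C p⟩).2) h1 h3
  exact h4.contDiffAt.contDiffWithinAt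

theorem boxForm_eq_trivializationAt (C : BoxSection m F E) {a b x z : M}
    (hx : x ∈ (trivializationAt F E a).baseSet) (u v : F →L[ℝ] ℝ) :
    boxForm C x z (u.comp ((trivializationAt F E a).continuousLinearMapAt ℝ x))
      (v.comp ((trivializationAt F E b).continuousLinearMapAt ℝ z)) =
    v ((trivializationAt ((F →L[ℝ] ℝ) →L[ℝ] F) (BoxBundle m E) (a, b) ⟨(x, z), C (x, z)⟩).2 u) := by
  rw [hom_trivializationAt_apply, boxForm]
  have key : ((trivializationAt (F →L[ℝ] ℝ) (fun p : M × M =>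
      (fstMap m M *ᵖ E) p →L[ℝ] Bundle.Trivial (M × M) ℝ p) (a, b)).symmL ℝ (x, z)) u =
      u.comp ((trivializationAt F E a).continuousLinearMapAt ℝ x) := by
    have hb : (x, z) ∈ (trivializationAt (F →L[ℝ] ℝ) (fun p : M × M =>
      (fstMap m M *ᵖ E) p →L[ℝ] Bundle.Trivial (M × M) ℝ p) (a, b)).baseSet := ⟨hx, trivial⟩
    let L : (fstMap m M *ᵖ E) (x, z) →L[ℝ] Bundle.Trivial (M × M) ℝ (x, z) :=
      u.comp ((trivializationAt F E a).continuousLinearMapAt ℝ x)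
    have h1 : (trivializationAt (F →L[ℝ] ℝ) (fun p : M × M =>
        (fstMap m M *ᵖ E) p →L[ℝ] Bundle.Trivial (M × M) ℝ p) (a, b)).continuousLinearMapAt ℝ
        (x, z) L = u := by
      rw [Trivialization.continuousLinearMapAt_apply_of_mem (R := ℝ) _ hb, hom_trivializationAt_apply]
      ext e
      have h2 := (trivializationAt F E a).continuousLinearMapAt_symmL (R := ℝ) hx e
      have hp : (x, z) ∈ (trivializationAt F (fstMap m M *ᵖ E) (a, b)).baseSet := hx
      have h4 : (trivializationAt F (fstMap m M *ᵖ E) (a, b)).symmL ℝ (x, z) e =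
          (trivializationAt F E a).symmL ℝ x e := by
        let v : (fstMap m M *ᵖ E) (x, z) := (trivializationAt F E a).symmL ℝ x e
        have h5 := Trivialization.symmL_continuousLinearMapAt (R := ℝ)
          (trivializationAt F (fstMap m M *ᵖ E) (a, b)) hp v
        have h6 : (trivializationAt F (fstMap m M *ᵖ E) (a, b)).continuousLinearMapAt ℝ (x, z) v =
            (trivializationAt F (fstMap m M *ᵖ E) (a, b) ⟨(x, z), v⟩).2 :=
          Trivialization.continuousLinearMapAt_apply_of_mem (R := ℝ) _ hp v
        have h7 : (trivializationAt F (fstMap m M *ᵖ E) (a, b) ⟨(x, z), v⟩).2 = e := by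
          rw [Trivialization.continuousLinearMapAt_apply_of_mem (R := ℝ) _ hx] at h2
          exact h2
        exact (congrArg ((trivializationAt F (fstMap m M *ᵖ E) (a, b)).symmL ℝ (x, z))
          (h6.trans h7)).symm.trans h5
      refine Eq.trans ?_ (congrArg u h2)
      refine Eq.trans ?_ (congrArg (fun v : E x =>
        u ((trivializationAt F E a).continuousLinearMapAt ℝ x v)) h4)
      exact congrArg (fun A : ℝ →L[ℝ] ℝ => A (u ((trivializationAt F E a).continuousLinearMapAt ℝ x
        ((trivializationAt F (fstMap m M *ᵖ E) (a, b)).symmL ℝ (x, z) e))))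
        (Bundle.Trivial.continuousLinearMapAt_trivialization ℝ (M × M) ℝ (x, z))
    have h3 := Trivialization.symmL_continuousLinearMapAt (R := ℝ) _ hb L
    rw [h1] at h3
    exact h3
  rw [ContinuousLinearMap.inCoordinates]
  change _ = v (((trivializationAt F (sndMap m M *ᵖ E) (a, b)).continuousLinearMapAt ℝ (x, z))
    (C (x, z) (((trivializationAt (F →L[ℝ] ℝ) (fun p : M × M =>
      (fstMap m M *ᵖ E) p →L[ℝ] Bundle.Trivial (M × M) ℝ p) (a, b)).symmL ℝ (x, z)) u)))
  rw [key]
  rfl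

/-- The density `C(φ, ψ)` in product charts, for test sections `φ`, `ψ` with local expressions
`f`, `g`. -/
def kernelIntegrand (C : BoxSection m F E) (a b : M)
    (f g : EuclideanSpace ℝ (Fin m) → F →L[ℝ] ℝ)
    (w : EuclideanSpace ℝ (Fin m) × EuclideanSpace ℝ (Fin m)) : ℝ :=
  g w.2 (kernelRep C a b w (f w.1))

theorem kernelIntegrand_eq_zero (C : BoxSection m F E) (a b : M)
    {f g : EuclideanSpace ℝ (Fin m) → F →L[ℝ] ℝ}
    {w : EuclideanSpace ℝ (Fin m) × EuclideanSpace ℝ (Fin m)}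
    (hw : w ∉ tsupport f ×ˢ tsupport g) : kernelIntegrand C a b f g w = 0 := by
  rw [kernelIntegrand]
  by_cases h : w.1 ∈ tsupport f
  · rw [image_eq_zero_of_notMem_tsupport (f := g) fun h' => hw ⟨h, h'⟩]
    rfl
  · rw [image_eq_zero_of_notMem_tsupport (f := f) h, map_zero, map_zero]

theorem hasCompactSupport_kernelIntegrand (C : BoxSection m F E) {a b : M}
    {f g : EuclideanSpace ℝ (Fin m) → F →L[ℝ] ℝ} (hf : IsLocalTest m F E a f)
    (hg : IsLocalTest m F E b g) : HasCompactSupport (kernelIntegrand C a b f g) :=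
  HasCompactSupport.intro (IsCompact.prod hf.hasCompactSupport hg.hasCompactSupport)
    fun _ hw => kernelIntegrand_eq_zero C a b hw

theorem contDiff_kernelIntegrand (C : BoxSection m F E) {a b : M}
    {f g : EuclideanSpace ℝ (Fin m) → F →L[ℝ] ℝ} (hf : IsLocalTest m F E a f)
    (hg : IsLocalTest m F E b g) : ContDiff ℝ ∞ (kernelIntegrand C a b f g) := by
  refine contDiff_iff_contDiffAt.2 fun w => ?_
  by_cases hw : w ∈ localDomain m F E a ×ˢ localDomain m F E b
  · have h1 := (contDiffOn_kernelRep C a b).contDiffAt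
      (((isOpen_localDomain a).prod (isOpen_localDomain b)).mem_nhds hw)
    exact (hg.contDiff.comp contDiff_snd).contDiffAt.clm_apply
      (h1.clm_apply (hf.contDiff.comp contDiff_fst).contDiffAt)
  · have hcl : IsClosed (tsupport f ×ˢ tsupport g) :=
      (isClosed_tsupport f).prod (isClosed_tsupport g)
    have hw' : w ∉ tsupport f ×ˢ tsupport g := fun h => hw
      ⟨localDomain_test (m := m) (F := F) (E := E) a ▸ hf.tsupport_subset h.1,
        localDomain_test (m := m) (F := F) (E := E) b ▸ hg.tsupport_subset h.2⟩
    refine contDiffAt_const (c := (0 : ℝ)).congr_of_eventuallyEq ?_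
    filter_upwards [hcl.isOpen_compl.mem_nhds hw'] with z hz
    exact kernelIntegrand_eq_zero C a b hz

theorem boxForm_smul (C : BoxSection m F E) (x z : M) (c d : ℝ) (u : E x →L[ℝ] ℝ)
    (v : E z →L[ℝ] ℝ) : boxForm C x z (c • u) (d • v) = c * d * boxForm C x z u v := by
  have h : C (x, z) (c • u) = c • C (x, z) u := map_smul (C (x, z)) c u
  have h2 : ∀ e : E z, v (c • e) = c * v e := fun e => map_smul v c e
  have h3 : boxForm C x z (c • u) (d • v) = d * (c * boxForm C x z u v) :=
    congrArg (d * ·) ((congrArg v h).trans (h2 _))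
  rw [h3]
  ring

theorem boxForm_zero_left (C : BoxSection m F E) (x z : M) (v : E z →L[ℝ] ℝ) :
    boxForm C x z 0 v = 0 := by
  have h : C (x, z) (0 : E x →L[ℝ] ℝ) = 0 := map_zero (C (x, z))
  exact (congrArg v h).trans (map_zero v)

theorem boxForm_zero_right (C : BoxSection m F E) (x z : M) (u : E x →L[ℝ] ℝ) :
    boxForm C x z u 0 = 0 := rfl

theorem kernelPairing_localTest (C : BoxSection m F E) {a b : M}
    {f g : EuclideanSpace ℝ (Fin m) → F →L[ℝ] ℝ} (hf : IsLocalTest m F E a f)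
    (hg : IsLocalTest m F E b g) :
    kernelPairing C (localSection a f hf) (localSection b g hg) =
      ∫ w, kernelIntegrand C a b f g w := by
  set φ := localSection a f hf with hφ
  set ψ := localSection b g hg with hψ
  have hφ0 : ∀ x ∉ localSource m F E a, φ x = 0 := fun x hx => by
    rw [hφ, localSection_apply, localSectionFun_eq_zero subset_rfl]
    exact fun h => hx (localSource_test (m := m) (F := F) (E := E) a ▸
      symm_image_subset hf.tsupport_subset h)
  have hψ0 : ∀ x ∉ localSource m F E b, ψ x = 0 := fun x hx => by
    rw [hψ, localSection_apply, localSectionFun_eq_zero subset_rfl]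
    exact fun h => hx (localSource_test (m := m) (F := F) (E := E) b ▸
      symm_image_subset hg.tsupport_subset h)
  let B : M × M → M → M → ℝ := fun p x z => boxForm C x z ((densityCoord m p.1 x).comp (φ x))
    ((densityCoord m p.2 z).comp (ψ z))
  have hB0 : ∀ p x z, ¬ (x ∈ localSource m F E a ∧ z ∈ localSource m F E b) → B p x z = 0 := by
    intro p x z h
    by_cases hx : x ∈ localSource m F E a
    · simp only [B]
      rw [hψ0 z fun hz => h ⟨hx, hz⟩, ContinuousLinearMap.comp_zero, boxForm_zero_right]
    · simp only [B]
      rw [hφ0 x hx, ContinuousLinearMap.comp_zero, boxForm_zero_left]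
  have hcoord : ∀ {p q x : M}, x ∈ (chartAt (EuclideanSpace ℝ (Fin m)) p).source →
      x ∈ (chartAt (EuclideanSpace ℝ (Fin m)) q).source → ∀ u : E x →L[ℝ] Density m M x,
      (densityCoord m p x).comp u = absJacobian (m := m) p q x • (densityCoord m q x).comp u := by
    intro p q x hp hq u
    ext e
    exact densityCoord_eq_absJacobian_mul hp hq (u e)
  have hBchange : ∀ (p : M × M) x z, x ∈ (chartAt (EuclideanSpace ℝ (Fin m)) p.1).source →
      x ∈ (chartAt (EuclideanSpace ℝ (Fin m)) a).source →
      z ∈ (chartAt (EuclideanSpace ℝ (Fin m)) p.2).source →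
      z ∈ (chartAt (EuclideanSpace ℝ (Fin m)) b).source →
      B p x z = absJacobian (m := m) p.1 a x * absJacobian (m := m) p.2 b z * B (a, b) x z := by
    intro p x z h1 h2 h3 h4
    simp only [B]
    rw [hcoord h1 h2, hcoord h3 h4, boxForm_smul]
  have hBloc : ∀ w ∈ (extChartAt (𝓡 m) a).target ×ˢ (extChartAt (𝓡 m) b).target,
      B (a, b) ((extChartAt (𝓡 m) a).symm w.1) ((extChartAt (𝓡 m) b).symm w.2) =
        kernelIntegrand C a b f g w := by
    intro w hw
    by_cases h : w.1 ∈ localDomain m F E a ∧ w.2 ∈ localDomain m F E b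
    · have h1 := symm_mem_localSource h.1
      have h2 := symm_mem_localSource h.2
      have e1 := localRep_localSectionFun (G := F →L[ℝ] ℝ)
        (V := fun x : M => E x →L[ℝ] Density m M x) (f := f) (a := a)
        (by rw [localDomain_test]; exact h.1)
      have e2 := localRep_localSectionFun (G := F →L[ℝ] ℝ)
        (V := fun x : M => E x →L[ℝ] Density m M x) (f := g) (a := b)
        (by rw [localDomain_test]; exact h.2)
      simp only [B]
      rw [densityCoord_comp h1, densityCoord_comp h2]
      refine (boxForm_eq_trivializationAt C h1.2 _ _).trans ?_
      rw [kernelIntegrand, ← e1, ← e2]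
      rfl
    · rw [hB0, kernelIntegrand_eq_zero]
      · exact fun h' => h
          ⟨localDomain_test (m := m) (F := F) (E := E) a ▸ hf.tsupport_subset h'.1,
            localDomain_test (m := m) (F := F) (E := E) b ▸ hg.tsupport_subset h'.2⟩
      · exact fun h' => h ⟨⟨hw.1, h'.1.2⟩, ⟨hw.2, h'.2.2⟩⟩
  have hmeas : MeasurableSet ((extChartAt (𝓡 m) a).target ×ˢ (extChartAt (𝓡 m) b).target) :=
    ((isOpen_extChartAt_target (I := 𝓡 m) a).prod
      (isOpen_extChartAt_target (I := 𝓡 m) b)).measurableSet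
  have h1 : ∀ p : M × M,
      ∫ w in (extChartAt (𝓡 m) p.1).target ×ˢ (extChartAt (𝓡 m) p.2).target,
        chartPartition m M p.1 ((extChartAt (𝓡 m) p.1).symm w.1) *
        chartPartition m M p.2 ((extChartAt (𝓡 m) p.2).symm w.2) *
        B p ((extChartAt (𝓡 m) p.1).symm w.1) ((extChartAt (𝓡 m) p.2).symm w.2) =
      ∫ w in (extChartAt (𝓡 m) a).target ×ˢ (extChartAt (𝓡 m) b).target,
        chartPartition m M p.1 ((extChartAt (𝓡 m) a).symm w.1) *
        chartPartition m M p.2 ((extChartAt (𝓡 m) b).symm w.2) * kernelIntegrand C a b f g w := by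
    intro p
    refine (setIntegral_chart_prod_eq (a := p) (b := (a, b))
      (P := fun x z => chartPartition m M p.1 x * chartPartition m M p.2 z * B p x z)
      (Q := fun x z => chartPartition m M p.1 x * chartPartition m M p.2 z * B (a, b) x z)
      (fun x z h1 h2 h3 h4 => ?_) (fun x z h => ?_) (fun x z h => ?_)).trans ?_
    · rw [hBchange p x z h1 h2 h3 h4]; ring
    · rw [hB0, mul_zero]
      exact fun h' => h ⟨h'.1.1, h'.2.1⟩
    · by_cases hx : x ∈ (chartAt (EuclideanSpace ℝ (Fin m)) p.1).source
      · rw [chartPartition_eq_zero_of_notMem (b := p.2) fun hz => h ⟨hx, hz⟩, mul_zero, zero_mul]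
      · rw [chartPartition_eq_zero_of_notMem (b := p.1) hx, zero_mul, zero_mul]
    · exact setIntegral_congr_fun hmeas fun w hw => congrArg _ (hBloc w hw)
  have hvol : (volume : Measure (EuclideanSpace ℝ (Fin m) ×
      EuclideanSpace ℝ (Fin m))).IsAddHaarMeasure :=
    Measure.prod.instIsAddHaarMeasure volume volume
  have hint : Integrable (kernelIntegrand C a b f g) :=
    (contDiff_kernelIntegrand C hf hg).continuous.integrable_of_hasCompactSupport
      (hasCompactSupport_kernelIntegrand C hf hg)
  have hcp : ∀ p : M × M, ContinuousOn
      (fun w : EuclideanSpace ℝ (Fin m) × EuclideanSpace ℝ (Fin m) =>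
      chartPartition m M p.1 ((extChartAt (𝓡 m) a).symm w.1) *
      chartPartition m M p.2 ((extChartAt (𝓡 m) b).symm w.2))
      ((extChartAt (𝓡 m) a).target ×ˢ (extChartAt (𝓡 m) b).target) := fun p =>
    ((continuousOn_chartPartition_symm a p.1).comp continuousOn_fst fun w hw => hw.1).mul
      ((continuousOn_chartPartition_symm b p.2).comp continuousOn_snd fun w hw => hw.2)
  rw [kernelPairing]
  refine (finsum_congr h1).trans ?_
  rw [finsum_eq_sum_of_support_subset (s := (finite_support_chartPartition m M).toFinset ×ˢ
    (finite_support_chartPartition m M).toFinset)]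
  · rw [← integral_finsetSum, ← setIntegral_eq_integral_of_forall_compl_eq_zero
      (f := kernelIntegrand C a b f g)
      (s := (extChartAt (𝓡 m) a).target ×ˢ (extChartAt (𝓡 m) b).target)]
    · refine integral_congr_ae (Filter.Eventually.of_forall fun w => ?_)
      beta_reduce
      rw [← Finset.sum_mul, Finset.sum_product]
      dsimp only
      rw [← Finset.sum_mul_sum, sum_chartPartition,
        sum_chartPartition, one_mul, one_mul]
    · intro w hw
      refine kernelIntegrand_eq_zero C a b fun h => hw ?_
      exact ⟨(hf.tsupport_subset h.1).1, (hg.tsupport_subset h.2).1⟩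
    · intro p _
      refine hint.integrableOn.bdd_mul (c := 1) ((hcp p).aestronglyMeasurable hmeas)
        (Filter.Eventually.of_forall fun w => ?_)
      rw [norm_mul]
      exact mul_le_one₀ (abs_chartPartition_le_one _ _) (norm_nonneg _)
        (abs_chartPartition_le_one _ _)
  · intro p hp
    rw [Finset.coe_product, Set.Finite.coe_toFinset]
    by_contra h
    refine hp ?_
    beta_reduce
    have h' : (∀ x, chartPartition m M p.1 x = 0) ∨ ∀ x, chartPartition m M p.2 x = 0 := by
      by_contra hn
      push Not at hn
      exact h ⟨hn.1, hn.2⟩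
    rcases h' with h' | h' <;> simp [h']

end LocalPairing

section LocalRepOps

variable {m : ℕ} {M : Type*} [TopologicalSpace M] [ChartedSpace (EuclideanSpace ℝ (Fin m)) M]
  {G : Type*} [NormedAddCommGroup G] [NormedSpace ℝ G]
  {V : M → Type*} [TopologicalSpace (TotalSpace G V)] [∀ x, TopologicalSpace (V x)]
  [∀ x, AddCommGroup (V x)] [∀ x, Module ℝ (V x)] [FiberBundle G V] [VectorBundle ℝ G V]

theorem IsLocalRep.of_support_subset {a : M} {g : EuclideanSpace ℝ (Fin m) → G}
    {G' : Type*} [NormedAddCommGroup G'] {k : EuclideanSpace ℝ (Fin m) → G'}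
    (hk : HasCompactSupport k) (hkD : tsupport k ⊆ localDomain m G V a)
    (hg : ContDiff ℝ ∞ g) (h : ∀ y, k y = 0 → g y = 0) : IsLocalRep m G V a g := by
  have h1 : tsupport g ⊆ tsupport k :=
    closure_mono fun y hy hky => hy (h y hky)
  exact ⟨hg, hk.of_isClosed_subset (isClosed_tsupport g) h1, h1.trans hkD⟩

theorem IsLocalRep.smul {a : M} {f : EuclideanSpace ℝ (Fin m) → G} (hf : IsLocalRep m G V a f)
    {h : EuclideanSpace ℝ (Fin m) → ℝ} (hh : ContDiff ℝ ∞ h) :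
    IsLocalRep m G V a fun y => h y • f y :=
  .of_support_subset hf.hasCompactSupport hf.tsupport_subset (hh.smul hf.contDiff)
    fun y hy => by rw [hy, smul_zero]

theorem IsLocalRep.sum {ι : Type*} {a : M} (S : Finset ι) {f : ι → EuclideanSpace ℝ (Fin m) → G}
    (hf : ∀ i, IsLocalRep m G V a (f i)) : IsLocalRep m G V a fun y => ∑ i ∈ S, f i y := by
  induction S using Finset.cons_induction with
  | empty =>
    simp only [Finset.sum_empty]
    have h0 : tsupport (fun _ : EuclideanSpace ℝ (Fin m) => (0 : G)) = ∅ := tsupport_eq_empty_iff.2 rfl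
    exact ⟨contDiff_const, HasCompactSupport.zero, by rw [h0]; exact Set.empty_subset _⟩
  | cons i S hi ih =>
    simp only [Finset.sum_cons]
    refine ⟨(hf i).contDiff.add ih.contDiff, (hf i).hasCompactSupport.add ih.hasCompactSupport, ?_⟩
    exact (tsupport_add _ _).trans (Set.union_subset (hf i).tsupport_subset ih.tsupport_subset)

theorem sum_section_apply {ι : Type*} (S : Finset ι) (s : ι → Cₛ^∞⟮𝓡 m; G, V⟯) (x : M) :
    (∑ i ∈ S, s i) x = ∑ i ∈ S, s i x := by
  induction S using Finset.cons_induction with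
  | empty => rfl
  | cons i S hi ih => rw [Finset.sum_cons, Finset.sum_cons, ← ih]; rfl

variable [IsManifold (𝓡 m) ∞ M] [ContMDiffVectorBundle ∞ G V (𝓡 m)] [T2Space M]

theorem localSection_sum {ι : Type*} {a : M} (S : Finset ι)
    {f : ι → EuclideanSpace ℝ (Fin m) → G} (hf : ∀ i, IsLocalRep m G V a (f i)) :
    localSection a (fun y => ∑ i ∈ S, f i y) (.sum S hf) = ∑ i ∈ S, localSection a (f i) (hf i) := by
  ext x
  rw [localSection_apply, localSectionFun_sum, sum_section_apply]
  rfl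

theorem localSection_const_smul {a : M} {f : EuclideanSpace ℝ (Fin m) → G}
    (hf : IsLocalRep m G V a f) (c : ℝ) (hcf : IsLocalRep m G V a fun y => c • f y) :
    localSection a (fun y => c • f y) hcf = c • localSection a f hf := by
  ext x
  exact localSectionFun_const_smul a c f x

theorem localSection_congr {a : M} {f g : EuclideanSpace ℝ (Fin m) → G}
    (hf : IsLocalRep m G V a f) (hg : IsLocalRep m G V a g) (h : ∀ y, f y = g y) :
    localSection a f hf = localSection a g hg := by
  obtain rfl : f = g := funext h
  rfl

/-- The local sections obtained by multiplication with the trigonometric functions. -/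
def trigSection {a : M} {f : EuclideanSpace ℝ (Fin m) → G} (hf : IsLocalRep m G V a f)
    (q : (Fin m → ℤ) × Bool) : Cₛ^∞⟮𝓡 m; G, V⟯ :=
  localSection a (fun y => trig q y • f y) (hf.smul (contDiff_trig q))

/-- The expansion of `T` on local sections, in terms of the Fourier expansion of the coefficient. -/
theorem hasSum_trigCoeff_mul_trigSection [CompleteSpace G] {a : M}
    {χ h : EuclideanSpace ℝ (Fin m) → ℝ} {ξ : G}
    (hf : IsLocalRep m G V a fun y => χ y • ξ) (hhf : IsLocalRep m G V a fun y => h y • ξ)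
    (c : Fin m → ℝ) (hχ : ∀ y, χ y ≠ 0 → ∀ i, y i ∈ Set.Ioo (c i) (c i + 1))
    (hh : ContDiff ℝ ∞ h) (hhc : HasCompactSupport h) (hhχ : ∀ y, h y ≠ 0 → χ y = 1)
    (T : Cₛ^∞⟮𝓡 m; G, V⟯ → ℝ) (hT : Continuous T) (hTl : IsLinearMap ℝ T) :
    HasSum (fun q => trigCoeff h q * T (trigSection hf q)) (T (localSection a _ hhf)) := by
  have hrapid : ∀ N : ℕ, Summable fun q => weight q ^ N * |trigCoeff h q| := fun N =>
    summable_weight_pow_mul (exists_forall_weight_pow_mul_trigCoeff_le hh hhc) N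
  have hser : IsLocalRep m G V a fun y => trigSeries (trigCoeff h) y • (χ y • ξ) :=
    hf.smul (contDiff_trigSeries hrapid)
  have heq : ∀ y, h y • ξ = trigSeries (trigCoeff h) y • (χ y • ξ) := by
    intro y
    by_cases hy : χ y = 0
    · have : h y = 0 := by
        by_contra hne
        have := hhχ y hne
        rw [hy] at this
        exact zero_ne_one this
      rw [this, hy]
      simp
    · have hs := hasSum_trigCoeff_mul_trig hh hhc c
        (fun y hy => hχ y (by rw [hhχ y hy]; exact one_ne_zero)) (y := y)
        fun i => Set.Ioo_subset_Icc_self (hχ y hy i)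
      rw [trigSeries, hs.tsum_eq, ← smul_assoc, smul_eq_mul]
      by_cases h0 : h y = 0
      · rw [h0, zero_mul]
      · rw [hhχ y h0, mul_one]
  have hterm : ∀ q, IsLocalRep m G V a fun y => trigCoeff h q • trig q y • (χ y • ξ) := fun q =>
    (hf.smul (contDiff_trig q)).smul contDiff_const
  have hlim := tendsto_localSection (K₀ := tsupport fun y => χ y • ξ) hf.hasCompactSupport
    hf.tsupport_subset (fun S => IsLocalRep.sum S hterm) hser
    (fun S => closure_mono fun y hy h0 => hy ?_) (closure_mono fun y hy h0 => hy ?_)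
    fun n => tendstoUniformly_iteratedFDeriv_trigSeries_smul hrapid hf.contDiff
      hf.hasCompactSupport n
  · have h1 := (hT.tendsto _).comp hlim
    rw [← localSection_congr hhf hser heq] at h1
    refine h1.congr fun S => ?_
    let L : Cₛ^∞⟮𝓡 m; G, V⟯ →ₗ[ℝ] ℝ := IsLinearMap.mk' T hTl
    change L _ = ∑ q ∈ S, trigCoeff h q * L (trigSection hf q)
    beta_reduce
    rw [localSection_sum S hterm, map_sum]
    refine Finset.sum_congr rfl fun q _ => ?_
    rw [localSection_const_smul (hf.smul (contDiff_trig q)), map_smul]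
    rfl
  · change χ y • ξ = 0 at h0
    simp [h0]
  · change χ y • ξ = 0 at h0
    simp [h0]

end LocalRepOps

section RapidDecay

variable {m : ℕ} {M : Type*} [TopologicalSpace M] [ChartedSpace (EuclideanSpace ℝ (Fin m)) M]
  [IsManifold (𝓡 m) ∞ M]
  {F : Type*} [NormedAddCommGroup F] [NormedSpace ℝ F]
  {E : M → Type*} [TopologicalSpace (TotalSpace F E)] [∀ x, TopologicalSpace (E x)]
  [∀ x, AddCommGroup (E x)] [∀ x, Module ℝ (E x)] [FiberBundle F E] [VectorBundle ℝ F E]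
  [∀ x, IsTopologicalAddGroup (E x)] [∀ x, ContinuousSMul ℝ (E x)]
  [ContMDiffVectorBundle ∞ F E (𝓡 m)] [T2Space M] [CompactSpace M]

theorem measurable_eval (φ : TestSection m F E) :
    Measurable fun T : GeneralizedSection m F E => T φ :=
  (WeakDual.eval_continuous φ).measurable

theorem IsGaussianMeasure.memLp_eval {Γ : Measure (GeneralizedSection m F E)}
    (hΓ : IsGaussianMeasure Γ) (φ : TestSection m F E) :
    MemLp (fun T : GeneralizedSection m F E => T φ) 2 Γ := by
  obtain ⟨v, hv⟩ := hΓ.map_eq φ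
  have h : MemLp id 2 (Γ.map fun T : GeneralizedSection m F E => T φ) := by
    rw [hv]
    exact memLp_id_gaussianReal 2
  exact h.comp_of_map (measurable_eval φ).aemeasurable

theorem ae_summable_weight_pow_mul_trigSection {Γ : Measure (GeneralizedSection m F E)}
    {C : BoxSection m F E} (hΓ : IsSmoothGaussianMeasure Γ C) {a : M}
    {f : EuclideanSpace ℝ (Fin m) → F →L[ℝ] ℝ} (hf : IsLocalTest m F E a f) :
    ∀ᵐ T ∂Γ, ∀ N : ℕ, Summable fun q => weight q ^ N * |T (trigSection hf q)| := by
  have hE : ∀ q, ∫ T : GeneralizedSection m F E, T (trigSection hf q) ^ 2 ∂Γ =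
      ∫ w, kernelIntegrand C a a f f w * (trig q w.1 * trig q w.2) := by
    intro q
    simp only [pow_two]
    rw [hΓ.covariance_eq, trigSection, kernelPairing_localTest]
    refine integral_congr_ae (Filter.Eventually.of_forall fun w => ?_)
    simp only [kernelIntegrand, map_smul, smul_apply, smul_eq_mul]
    ring
  have hint : ∀ q, Integrable (fun T : GeneralizedSection m F E => T (trigSection hf q) ^ 2) Γ :=
    fun q => (hΓ.memLp_eval _).integrable_sq
  obtain ⟨n, hn⟩ := exists_summable_inv_weight_pow (m := m)
  have hN : ∀ N : ℕ, ∀ᵐ T ∂Γ, ∃ K, ∀ q, weight q ^ N * |T (trigSection hf q)| ≤ K := by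
    intro N
    obtain ⟨K, hK0, hK⟩ := exists_forall_weight_pow_mul_integral_trig_mul_trig_le
      (contDiff_kernelIntegrand C hf hf) (hasCompactSupport_kernelIntegrand C hf hf) (N + N + n)
    have hsum : Summable fun q => weight q ^ (N + N) *
        ∫ T : GeneralizedSection m F E, T (trigSection hf q) ^ 2 ∂Γ := by
      refine Summable.of_nonneg_of_le (fun q => mul_nonneg (pow_nonneg (weight_pos q).le _)
        (integral_nonneg fun T => sq_nonneg _)) (fun q => ?_) (hn.mul_left K)
      rw [hE q, inv_pow, ← div_eq_mul_inv, le_div_iff₀ (pow_pos (weight_pos q) n)]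
      refine le_trans (le_of_eq_of_le ?_ (mul_le_mul_of_nonneg_left (le_abs_self _)
        (pow_nonneg (weight_pos q).le (N + N + n)))) (hK q)
      rw [pow_add _ (N + N) n]
      ring
    have hlin : ∫⁻ T, ∑' q, ENNReal.ofReal (weight q ^ (N + N) * T (trigSection hf q) ^ 2) ∂Γ ≠
        ⊤ := by
      rw [lintegral_tsum fun q => (((measurable_eval _).pow_const 2).const_mul
        _).ennreal_ofReal.aemeasurable]
      have h1 : ∀ q, ∫⁻ T, ENNReal.ofReal (weight q ^ (N + N) * T (trigSection hf q) ^ 2) ∂Γ =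
          ENNReal.ofReal (weight q ^ (N + N) *
            ∫ T : GeneralizedSection m F E, T (trigSection hf q) ^ 2 ∂Γ) := fun q => by
        rw [← ofReal_integral_eq_lintegral_ofReal ((hint q).const_mul _), integral_const_mul]
        exact Filter.Eventually.of_forall fun T =>
          mul_nonneg (pow_nonneg (weight_pos q).le _) (sq_nonneg _)
      simp only [h1]
      exact hsum.tsum_ofReal_ne_top
    have hmeas : Measurable fun T : GeneralizedSection m F E =>
        ∑' q, ENNReal.ofReal (weight q ^ (N + N) * T (trigSection hf q) ^ 2) :=
      Measurable.tsum fun q => (((measurable_eval _).pow_const 2).const_mul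
        _).ennreal_ofReal
    filter_upwards [ae_lt_top hmeas hlin] with T hT
    refine ⟨(∑' q, ENNReal.ofReal (weight q ^ (N + N) * T (trigSection hf q) ^ 2)).toReal + 1,
      fun q => ?_⟩
    have h2 : weight q ^ (N + N) * T (trigSection hf q) ^ 2 ≤
        (∑' q, ENNReal.ofReal (weight q ^ (N + N) * T (trigSection hf q) ^ 2)).toReal :=
      (ENNReal.ofReal_le_iff_le_toReal hT.ne).1 (ENNReal.le_tsum q)
    have h3 : (weight q ^ N * |T (trigSection hf q)|) ^ 2 =
        weight q ^ (N + N) * T (trigSection hf q) ^ 2 := by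
      rw [mul_pow, sq_abs, pow_add, pow_two]
    nlinarith [sq_nonneg (weight q ^ N * |T (trigSection hf q)| - 1)]
  filter_upwards [ae_all_iff.2 hN] with T hT N
  exact summable_weight_pow_mul hT N

end RapidDecay

theorem hasSum_trigCoeff_mul {m : ℕ} {h : EuclideanSpace ℝ (Fin m) → ℝ} (hh : Continuous h)
    (hc : HasCompactSupport h) {a : (Fin m → ℤ) × Bool → ℝ} (ha : Summable fun q => |a q|) :
    HasSum (fun q => trigCoeff h q * a q) (∫ y, h y * trigSeries a y) := by
  have hint : Integrable h := hh.integrable_of_hasCompactSupport hc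
  have hq : ∀ q, Integrable fun y => h y * (a q * trig q y) := fun q => by
    refine hint.mul_bdd (c := |a q|)
      ((continuous_const.mul (contDiff_trig q).continuous).aestronglyMeasurable)
      (Filter.Eventually.of_forall fun y => ?_)
    rw [norm_mul, Real.norm_eq_abs, Real.norm_eq_abs]
    exact mul_le_of_le_one_right (abs_nonneg _) (abs_trig_le_one q y)
  have h1 := hasSum_integral_of_summable_integral_norm hq <| by
    refine Summable.of_nonneg_of_le (fun q => integral_nonneg fun y => norm_nonneg _)
      (fun q => ?_) (ha.mul_left (∫ y, ‖h y‖))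
    rw [← integral_mul_const]
    refine integral_mono (hq q).norm (hint.norm.mul_const _) fun y => ?_
    beta_reduce
    rw [norm_mul, norm_mul, Real.norm_eq_abs (a q), Real.norm_eq_abs (trig q y)]
    exact mul_le_mul_of_nonneg_left
      (mul_le_of_le_one_right (abs_nonneg _) (abs_trig_le_one q y)) (norm_nonneg _)
  simp only [tsum_mul_left] at h1
  refine h1.congr_fun fun q => ?_
  rw [trigCoeff, ← integral_mul_const]
  exact integral_congr_ae (Filter.Eventually.of_forall fun y => by ring)

section Regularity

variable {m : ℕ} {M : Type*} [TopologicalSpace M] [ChartedSpace (EuclideanSpace ℝ (Fin m)) M]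
  [IsManifold (𝓡 m) ∞ M]
  {F : Type*} [NormedAddCommGroup F] [NormedSpace ℝ F]
  {E : M → Type*} [TopologicalSpace (TotalSpace F E)] [∀ x, TopologicalSpace (E x)]
  [∀ x, AddCommGroup (E x)] [∀ x, Module ℝ (E x)] [FiberBundle F E] [VectorBundle ℝ F E]
  [∀ x, IsTopologicalAddGroup (E x)] [∀ x, ContinuousSMul ℝ (E x)]
  [ContMDiffVectorBundle ∞ F E (𝓡 m)] [T2Space M] [CompactSpace M]

theorem generalizedSection_map_sum (T : GeneralizedSection m F E) {ι : Type*} (S : Finset ι)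
    (φ : ι → TestSection m F E) : T (∑ i ∈ S, φ i) = ∑ i ∈ S, T (φ i) :=
  map_sum (IsLinearMap.mk' (T : TestSection m F E → ℝ) ⟨map_add T, map_smul T⟩) φ S

theorem generalizedSection_sum_apply {ι : Type*} (S : Finset ι)
    (T : ι → GeneralizedSection m F E) (φ : TestSection m F E) :
    (∑ i ∈ S, T i) φ = ∑ i ∈ S, T i φ := by
  induction S using Finset.cons_induction with
  | empty => rfl
  | cons i S hi ih => rw [Finset.sum_cons, Finset.sum_cons, ← ih]; rfl

theorem isLocalTest_smul_const {a : M} {χ : EuclideanSpace ℝ (Fin m) → ℝ} (hχ : ContDiff ℝ ∞ χ)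
    (hχc : HasCompactSupport χ) (hχD : tsupport χ ⊆ localDomain m F E a) (ξ : F →L[ℝ] ℝ) :
    IsLocalTest m F E a fun y => χ y • ξ :=
  .of_support_subset hχc (by rw [localDomain_test]; exact hχD) (hχ.smul contDiff_const)
    fun y hy => by rw [hy, zero_smul]

theorem exists_section_of_summable {ι : Type*} [Fintype ι] (b : Module.Basis ι ℝ F)
    [FiniteDimensional ℝ F] {a : M}
    {χ : EuclideanSpace ℝ (Fin m) → ℝ} (hχ : ContDiff ℝ ∞ χ)
    (hχc : HasCompactSupport χ) (hχD : tsupport χ ⊆ localDomain m F E a)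
    (c : Fin m → ℝ) (hχbox : ∀ y, χ y ≠ 0 → ∀ i, y i ∈ Set.Ioo (c i) (c i + 1))
    (T : GeneralizedSection m F E)
    (hT : ∀ (j : ι) (N : ℕ), Summable fun q => weight q ^ N * |T (trigSection
      (isLocalTest_smul_const hχ hχc hχD (LinearMap.toContinuousLinearMap (b.coord j))) q)|) :
    ∃ σ : SmoothSection m F E, ∀ (f : EuclideanSpace ℝ (Fin m) → F →L[ℝ] ℝ)
      (hf : IsLocalTest m F E a f), (∀ y, f y ≠ 0 → χ y = 1) →
      T (localSection a f hf) = toGeneralized σ (localSection a f hf) := by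
  let ξ : ι → F →L[ℝ] ℝ := fun j => LinearMap.toContinuousLinearMap (b.coord j)
  have hξ : ∀ j, IsLocalTest m F E a fun y => χ y • ξ j := fun j =>
    isLocalTest_smul_const hχ hχc hχD (ξ j)
  let d : ι → (Fin m → ℤ) × Bool → ℝ := fun j q => T (trigSection (hξ j) q)
  have hd : ∀ j (N : ℕ), Summable fun q => weight q ^ N * |d j q| := hT
  let g : EuclideanSpace ℝ (Fin m) → F := fun y => χ y • ∑ j, trigSeries (d j) y • b j
  have hg : IsLocalRep m F E a g := .of_support_subset hχc hχD
    (hχ.smul (ContDiff.sum fun j _ => (contDiff_trigSeries (hd j)).smul contDiff_const))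
    fun y hy => by simp only [g]; rw [hy, zero_smul]
  refine ⟨localSection a g hg, fun f hf hfχ => ?_⟩
  have hsmooth : ∀ j, ContDiff ℝ ∞ fun y => f y (b j) := fun j =>
    hf.contDiff.clm_apply contDiff_const
  have hcs : ∀ j, HasCompactSupport fun y => f y (b j) := fun j =>
    hf.hasCompactSupport.mono fun y hy h0 => hy (by
      change f y = 0 at h0
      change f y (b j) = 0
      rw [h0]; rfl)
  have hfj : ∀ j, IsLocalTest m F E a fun y => f y (b j) • ξ j := fun j =>
    .of_support_subset hf.hasCompactSupport hf.tsupport_subset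
      ((hsmooth j).smul contDiff_const) fun y hy => by rw [hy, zero_apply, zero_smul]
  have hdecomp : ∀ y, f y = ∑ j, f y (b j) • ξ j := by
    intro y
    ext e
    conv_lhs => rw [← b.sum_repr e, map_sum]
    rw [sum_apply]
    refine Finset.sum_congr rfl fun j _ => ?_
    rw [map_smul, smul_apply, smul_eq_mul, smul_eq_mul, mul_comm]
    rfl
  have hL : ∀ j, HasSum (fun q => trigCoeff (fun y => f y (b j)) q * d j q)
      (T (localSection a _ (hfj j))) := fun j =>
    hasSum_trigCoeff_mul_trigSection (hξ j) (hfj j) c hχbox (hsmooth j) (hcs j)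
      (fun y hy => hfχ y fun h0 => hy (by rw [h0]; rfl)) T (map_continuous T)
      ⟨map_add T, map_smul T⟩
  have hR : ∀ j, HasSum (fun q => trigCoeff (fun y => f y (b j)) q * d j q)
      (∫ y, f y (b j) * trigSeries (d j) y) := fun j =>
    hasSum_trigCoeff_mul (hsmooth j).continuous (hcs j) (by simpa using hd j 0)
  rw [toGeneralized_localTest, localSection_congr hf (.sum Finset.univ hfj) hdecomp,
    localSection_sum Finset.univ hfj, generalizedSection_map_sum]
  have h1 : ∀ y, f y (localRep m F E a (localSection a g hg) y) =
      ∑ j, f y (b j) * trigSeries (d j) y := by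
    intro y
    by_cases h0 : f y = 0
    · simp [h0]
    · have hyD : y ∈ localDomain m F E a :=
        localDomain_test (m := m) (F := F) (E := E) a ▸ hf.tsupport_subset (subset_tsupport f h0)
      have h2 : localRep m F E a (localSection a g hg) y = g y := localRep_localSectionFun hyD
      rw [h2]
      simp only [g]
      rw [hfχ y h0, one_smul, map_sum]
      refine Finset.sum_congr rfl fun j _ => ?_
      rw [map_smul, smul_eq_mul, mul_comm]
  simp only [h1]
  rw [integral_finsetSum]
  · exact Finset.sum_congr rfl fun j _ => (hL j).unique (hR j)
  · intro j _
    exact ((hsmooth j).continuous.mul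
      (contDiff_trigSeries (hd j)).continuous).integrable_of_hasCompactSupport
      ((hcs j).mul_right)

theorem toGeneralized_zero : toGeneralized (0 : SmoothSection m F E) = 0 := by
  refine DFunLike.ext _ _ fun φ => ?_
  rw [toGeneralized_apply, densityIntegral_pairing]
  refine Finset.sum_eq_zero fun a _ => ?_
  rw [chartPairing_eq]
  refine integral_eq_zero_of_ae (Filter.Eventually.of_forall fun y => ?_)
  have h : φ ((extChartAt (𝓡 m) a).symm y)
      ((0 : SmoothSection m F E) ((extChartAt (𝓡 m) a).symm y)) = 0 := map_zero _
  beta_reduce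
  rw [h, map_zero, mul_zero]
  rfl

theorem toGeneralized_add (s t : SmoothSection m F E) :
    toGeneralized (s + t) = toGeneralized s + toGeneralized t := by
  refine DFunLike.ext _ _ fun φ => ?_
  change toGeneralized (s + t) φ = toGeneralized s φ + toGeneralized t φ
  simp only [toGeneralized_apply, densityIntegral_pairing, ← Finset.sum_add_distrib]
  refine Finset.sum_congr rfl fun a _ => ?_
  rw [chartPairing_eq, chartPairing_eq, chartPairing_eq, ← integral_add
    (integrableOn_chartPairing s a φ) (integrableOn_chartPairing t a φ)]
  refine integral_congr_ae (Filter.Eventually.of_forall fun y => ?_)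
  have h : φ ((extChartAt (𝓡 m) a).symm y) ((s + t) ((extChartAt (𝓡 m) a).symm y)) =
      φ ((extChartAt (𝓡 m) a).symm y) (s ((extChartAt (𝓡 m) a).symm y)) +
        φ ((extChartAt (𝓡 m) a).symm y) (t ((extChartAt (𝓡 m) a).symm y)) := map_add _ _ _
  beta_reduce
  rw [h, map_add, mul_add]

theorem toGeneralized_sum {ι : Type*} (S : Finset ι) (s : ι → SmoothSection m F E) :
    toGeneralized (∑ i ∈ S, s i) = ∑ i ∈ S, toGeneralized (s i) := by
  induction S using Finset.cons_induction with
  | empty => exact toGeneralized_zero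
  | cons i S hi ih => rw [Finset.sum_cons, Finset.sum_cons, ← ih, toGeneralized_add]

theorem exists_ball_subset_localDomain_inter_box (a : M) : ∃ χ : ContDiffBump (extChartAt (𝓡 m) a a),
    tsupport χ ⊆ localDomain m F E a ∧
    ∀ y, χ y ≠ 0 → ∀ i, y i ∈ Set.Ioo (extChartAt (𝓡 m) a a i - 1 / 2)
      (extChartAt (𝓡 m) a a i - 1 / 2 + 1) := by
  obtain ⟨r, hr, hrD⟩ := Metric.isOpen_iff.1 (isOpen_localDomain (m := m) (G := F) (V := E) a) _
    (extChartAt_mem_localDomain (mem_localSource a))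
  let R := min r (1 / 2)
  have hR : 0 < R := lt_min hr (by norm_num)
  refine ⟨⟨R / 4, R / 2, by linarith, by linarith⟩, ?_, fun y hy i => ?_⟩
  · rw [ContDiffBump.tsupport_eq]
    refine (Metric.closedBall_subset_ball ?_).trans hrD
    change R / 2 < r
    linarith [min_le_left r (1 / 2)]
  · have h1 : y ∈ Metric.ball (extChartAt (𝓡 m) a a) (R / 2) := by
      by_contra h
      exact hy (ContDiffBump.zero_of_le_dist _ (not_lt.1 h))
    rw [Metric.mem_ball, dist_eq_norm] at h1
    have h2 := (PiLp.norm_apply_le (y - extChartAt (𝓡 m) a a) i).trans_lt h1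
    rw [PiLp.sub_apply, Real.norm_eq_abs, abs_lt] at h2
    have h3 : R ≤ 1 / 2 := min_le_right _ _
    constructor <;> linarith [h2.1, h2.2]

theorem exists_nhds_ae_smooth [FiniteDimensional ℝ F] {Γ : Measure (GeneralizedSection m F E)}
    {C : BoxSection m F E} (hΓ : IsSmoothGaussianMeasure Γ C) (a : M) :
    ∃ W : Set M, IsOpen W ∧ a ∈ W ∧ ∀ᵐ T ∂Γ, ∃ σ : SmoothSection m F E,
      ∀ (φ : TestSection m F E) (K : Set M), IsCompact K → K ⊆ W → (∀ x ∉ K, φ x = 0) →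
        T φ = toGeneralized σ φ := by
  obtain ⟨χ, hχD, hχbox⟩ := exists_ball_subset_localDomain_inter_box (m := m) (F := F)
    (E := E) a
  let b := Module.finBasis ℝ F
  have hae := ae_all_iff.2 fun j => ae_summable_weight_pow_mul_trigSection hΓ
    (isLocalTest_smul_const (m := m) (F := F) (E := E) χ.contDiff χ.hasCompactSupport hχD
      (LinearMap.toContinuousLinearMap (b.coord j)))
  refine ⟨localSource m F E a ∩ (extChartAt (𝓡 m) a).source ∩
    (extChartAt (𝓡 m) a) ⁻¹' Metric.ball (extChartAt (𝓡 m) a a) χ.rIn, ?_, ?_, ?_⟩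
  · rw [Set.inter_assoc]
    refine (isOpen_localSource a).inter ?_
    exact (continuousOn_extChartAt a).isOpen_inter_preimage (isOpen_extChartAt_source a)
      Metric.isOpen_ball
  · exact ⟨⟨mem_localSource a, mem_extChartAt_source a⟩, Metric.mem_ball_self χ.rIn_pos⟩
  · filter_upwards [hae] with T hT
    obtain ⟨σ, hσ⟩ := exists_section_of_summable b χ.contDiff χ.hasCompactSupport hχD _ hχbox T hT
    refine ⟨σ, fun φ K hK hKW hφ => ?_⟩
    obtain ⟨f, hf, hfK, rfl, -⟩ := exists_localSection_eq φ hK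
      (by rw [localSource_test]; exact fun x hx => (hKW hx).1.1) hφ
    refine hσ f hf fun y hy => ?_
    obtain ⟨x, hx, rfl⟩ := hfK (subset_tsupport f hy)
    exact χ.one_of_mem_closedBall (Metric.ball_subset_closedBall (hKW hx).2)

/-- The product of a smooth function and a smooth section. -/
def smulSection {G : Type*} [NormedAddCommGroup G] [NormedSpace ℝ G] {V : M → Type*}
    [TopologicalSpace (TotalSpace G V)] [∀ x, TopologicalSpace (V x)]
    [∀ x, AddCommGroup (V x)] [∀ x, Module ℝ (V x)] [FiberBundle G V] [VectorBundle ℝ G V]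
    (ρ : C^∞⟮𝓡 m, M; 𝓘(ℝ), ℝ⟯) (s : Cₛ^∞⟮𝓡 m; G, V⟯) : Cₛ^∞⟮𝓡 m; G, V⟯ :=
  ⟨fun x => ρ x • s x, ρ.contMDiff.smul_section s.contMDiff⟩

theorem toGeneralized_smulSection (ρ : C^∞⟮𝓡 m, M; 𝓘(ℝ), ℝ⟯) (s : SmoothSection m F E)
    (φ : TestSection m F E) :
    toGeneralized (smulSection ρ s) φ = toGeneralized s (smulSection ρ φ) := by
  rw [toGeneralized_apply, toGeneralized_apply]
  congr 1
  funext x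
  exact map_smul (φ x) (ρ x) (s x)

/-- Almost every generalized section is smooth. -/
theorem ae_exists_toGeneralized_eq [FiniteDimensional ℝ F]
    {Γ : Measure (GeneralizedSection m F E)}
    {C : BoxSection m F E} (hΓ : IsSmoothGaussianMeasure Γ C) :
    ∀ᵐ T ∂Γ, ∃ s : SmoothSection m F E, toGeneralized s = T := by
  choose W hWo haW hW using fun a : M => exists_nhds_ae_smooth hΓ a
  obtain ⟨t, ht⟩ := isCompact_univ.elim_finite_subcover W hWo
    fun a _ => Set.mem_iUnion.2 ⟨a, haW a⟩
  obtain ⟨ρ, hρ⟩ := SmoothPartitionOfUnity.exists_isSubordinate (𝓡 m) (s := Set.univ) isClosed_univ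
    (fun a : t => W a) (fun a => hWo a) fun x hx => by
      obtain ⟨a, ha, hx⟩ := Set.mem_iUnion₂.1 (ht hx)
      exact Set.mem_iUnion.2 ⟨⟨a, ha⟩, hx⟩
  filter_upwards [ae_all_iff.2 fun a : t => hW a] with T hT
  choose σ hσ using hT
  refine ⟨∑ a : t, smulSection (ρ a) (σ a), ?_⟩
  refine DFunLike.ext _ _ fun φ => ?_
  have hφ : φ = ∑ a : t, smulSection (ρ a) φ := by
    refine DFunLike.ext _ _ fun x => ?_
    rw [sum_section_apply]
    change φ x = ∑ a : t, ρ a x • φ x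
    rw [← Finset.sum_smul, ← finsum_eq_sum_of_fintype, ρ.sum_eq_one (Set.mem_univ x), one_smul]
  have h2 : toGeneralized (∑ a : t, smulSection (ρ a) (σ a)) φ =
      ∑ a : t, toGeneralized (smulSection (ρ a) (σ a)) φ := by
    rw [toGeneralized_sum, generalizedSection_sum_apply]
  refine h2.trans ?_
  conv_rhs => rw [hφ, generalizedSection_map_sum]
  refine Finset.sum_congr rfl fun a _ => ?_
  rw [toGeneralized_smulSection]
  refine (hσ a _ (tsupport (ρ a)) (isClosed_tsupport _).isCompact (hρ a) fun x hx => ?_).symm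
  change ρ a x • φ x = 0
  rw [image_eq_zero_of_notMem_tsupport hx, zero_smul]

end Regularity

theorem tendsto_integral_mul_of_support_subset_ball {X : Type*} [PseudoMetricSpace X]
    [MeasurableSpace X] {μ : Measure X} {k : ℕ → X → ℝ} {h : X → ℝ} {c : X}
    (hk0 : ∀ n x, 0 ≤ k n x) (hk1 : ∀ n, ∫ x, k n x ∂μ = 1)
    (hsupp : ∀ ε > 0, ∀ᶠ n in Filter.atTop, ∀ x, k n x ≠ 0 → dist x c < ε)
    (hkh : ∀ n, Integrable (fun x => k n x * h x) μ) (hh : ContinuousAt h c) :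
    Filter.Tendsto (fun n => ∫ x, k n x * h x ∂μ) Filter.atTop (𝓝 (h c)) := by
  rw [Metric.tendsto_nhds]
  intro ε hε
  obtain ⟨δ, hδ, hδh⟩ := Metric.continuousAt_iff.1 hh (ε / 2) (half_pos hε)
  filter_upwards [hsupp δ hδ] with n hn
  have hki : Integrable (k n) μ := by
    by_contra hni
    have := hk1 n
    rw [integral_undef hni] at this
    exact zero_ne_one this
  have h1 : ∫ x, k n x * h x ∂μ - h c = ∫ x, k n x * (h x - h c) ∂μ := by
    simp only [mul_sub]
    rw [integral_sub (hkh n) (hki.mul_const _), integral_mul_const, hk1, one_mul]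
  rw [Real.dist_eq, h1]
  have h2 : |∫ x, k n x * (h x - h c) ∂μ| ≤ ∫ x, k n x * (ε / 2) ∂μ := by
    rw [← Real.norm_eq_abs]
    refine norm_integral_le_of_norm_le (hki.mul_const _)
      (Filter.Eventually.of_forall fun x => ?_)
    rw [norm_mul, Real.norm_of_nonneg (hk0 n x)]
    by_cases hx : k n x = 0
    · rw [hx, zero_mul, zero_mul]
    · have := hδh (hn x hx)
      rw [Real.dist_eq] at this
      exact mul_le_mul_of_nonneg_left this.le (hk0 n x)
  rw [integral_mul_const, hk1, one_mul] at h2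
  linarith

section Delta

variable {m : ℕ} {M : Type*} [TopologicalSpace M] [ChartedSpace (EuclideanSpace ℝ (Fin m)) M]
  [IsManifold (𝓡 m) ∞ M]
  {F : Type*} [NormedAddCommGroup F] [NormedSpace ℝ F]
  {E : M → Type*} [TopologicalSpace (TotalSpace F E)] [∀ x, TopologicalSpace (E x)]
  [∀ x, AddCommGroup (E x)] [∀ x, Module ℝ (E x)] [FiberBundle F E] [VectorBundle ℝ F E]
  [∀ x, IsTopologicalAddGroup (E x)] [∀ x, ContinuousSMul ℝ (E x)]
  [ContMDiffVectorBundle ∞ F E (𝓡 m)] [T2Space M] [CompactSpace M]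

variable (m F E) in
theorem exists_deltaBump (a : M) (n : ℕ) : ∃ χ : ContDiffBump (extChartAt (𝓡 m) a a),
    tsupport χ ⊆ localDomain m F E a ∧ χ.rOut < 1 / ((n : ℝ) + 1) := by
  obtain ⟨r, hr, hrD⟩ := Metric.isOpen_iff.1 (isOpen_localDomain (m := m) (G := F) (V := E) a) _
    (extChartAt_mem_localDomain (mem_localSource a))
  let R := min r (1 / ((n : ℝ) + 1))
  have hR : 0 < R := lt_min hr (by positivity)
  refine ⟨⟨R / 4, R / 2, by linarith, by linarith⟩, ?_, ?_⟩
  · rw [ContDiffBump.tsupport_eq]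
    refine (Metric.closedBall_subset_ball ?_).trans hrD
    change R / 2 < r
    linarith [min_le_left r (1 / ((n : ℝ) + 1))]
  · change R / 2 < _
    linarith [min_le_right r (1 / ((n : ℝ) + 1))]

variable (m F E) in
/-- Bump functions that concentrate at a point, in the chart at this point. -/
def deltaBump (a : M) (n : ℕ) : ContDiffBump (extChartAt (𝓡 m) a a) :=
  (exists_deltaBump m F E a n).choose

variable (m F E) in
/-- The associated functions of integral one. -/
def deltaFun (a : M) (n : ℕ) : EuclideanSpace ℝ (Fin m) → ℝ :=
  (deltaBump m F E a n).normed volume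

theorem tsupport_deltaFun (a : M) (n : ℕ) :
    tsupport (deltaFun m F E a n) ⊆ localDomain m F E a := by
  rw [deltaFun, ContDiffBump.tsupport_normed_eq, ← ContDiffBump.tsupport_eq]
  exact (exists_deltaBump m F E a n).choose_spec.1

theorem eventually_deltaFun (a : M) {ε : ℝ} (hε : 0 < ε) : ∀ᶠ n in Filter.atTop,
    ∀ y, deltaFun m F E a n y ≠ 0 → dist y (extChartAt (𝓡 m) a a) < ε := by
  filter_upwards [(tendsto_one_div_add_atTop_nhds_zero_nat (𝕜 := ℝ)).eventually_lt_const hε]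
    with n hn y hy
  have h1 : y ∈ Function.support ((deltaBump m F E a n).normed volume) := hy
  rw [ContDiffBump.support_normed_eq] at h1
  exact (Metric.mem_ball.1 h1).trans ((exists_deltaBump m F E a n).choose_spec.2.trans hn)

theorem contDiff_deltaFun (a : M) (n : ℕ) : ContDiff ℝ ∞ (deltaFun m F E a n) :=
  (deltaBump m F E a n).contDiff_normed

theorem hasCompactSupport_deltaFun (a : M) (n : ℕ) : HasCompactSupport (deltaFun m F E a n) :=
  (deltaBump m F E a n).hasCompactSupport_normed

theorem integral_deltaFun (a : M) (n : ℕ) : ∫ y, deltaFun m F E a n y = 1 :=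
  (deltaBump m F E a n).integral_normed

theorem deltaFun_nonneg (a : M) (n : ℕ) (y : EuclideanSpace ℝ (Fin m)) :
    0 ≤ deltaFun m F E a n y :=
  (deltaBump m F E a n).nonneg_normed y

/-- A linear form on the fibre at `a`, in the trivialization at `a`. -/
def fiberForm {a : M} (u : E a →L[ℝ] ℝ) : F →L[ℝ] ℝ :=
  u.comp ((trivializationAt F E a).symmL ℝ a)

theorem fiberForm_comp {a : M} (u : E a →L[ℝ] ℝ) :
    (fiberForm (F := F) u).comp ((trivializationAt F E a).continuousLinearMapAt ℝ a) = u := by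
  ext e
  change u ((trivializationAt F E a).symmL ℝ a
    ((trivializationAt F E a).continuousLinearMapAt ℝ a e)) = u e
  rw [Trivialization.symmL_continuousLinearMapAt _ (FiberBundle.mem_baseSet_trivializationAt' a)]

/-- Test sections that approximate the functional `s ↦ u (s a)`. -/
def deltaSection {a : M} (u : E a →L[ℝ] ℝ) (n : ℕ) : TestSection m F E :=
  localSection a (fun y => deltaFun m F E a n y • fiberForm u)
    (isLocalTest_smul_const (contDiff_deltaFun a n) (hasCompactSupport_deltaFun a n)
      (tsupport_deltaFun a n) _)

theorem tendsto_toGeneralized_deltaSection (s : SmoothSection m F E) {a : M} (u : E a →L[ℝ] ℝ) :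
    Filter.Tendsto (fun n => toGeneralized s (deltaSection u n)) Filter.atTop (𝓝 (u (s a))) := by
  have ha : a ∈ (trivializationAt F E a).baseSet := FiberBundle.mem_baseSet_trivializationAt' a
  have hc : ContinuousOn (fun y => fiberForm u (localRep m F E a s y)) (localDomain m F E a) :=
    (fiberForm u).continuous.comp_continuousOn (contDiffOn_localRep a s).continuousOn
  have h1 := tendsto_integral_mul_of_support_subset_ball (μ := volume)
    (k := deltaFun m F E a) (h := fun y => fiberForm u (localRep m F E a s y))
    (c := extChartAt (𝓡 m) a a) (deltaFun_nonneg a) (integral_deltaFun a)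
    (fun ε hε => eventually_deltaFun a hε) (fun n => ?_) ?_
  · have h2 : fiberForm u (localRep m F E a s (extChartAt (𝓡 m) a a)) = u (s a) := by
      rw [localRep, symm_extChartAt (mem_localSource (m := m) (G := F) (V := E) a)]
      rw [← Trivialization.continuousLinearMapAt_apply_of_mem (R := ℝ) _ ha]
      exact congrArg (fun L : E a →L[ℝ] ℝ => L (s a)) (fiberForm_comp (F := F) u)
    rw [h2] at h1
    refine h1.congr fun n => ?_
    rw [deltaSection, toGeneralized_localTest]
    rfl
  · rw [← integrableOn_iff_integrable_of_support_subset (s := tsupport (deltaFun m F E a n))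
      fun y hy => subset_tsupport _ fun h0 => hy (by simp only [h0, zero_mul])]
    exact ((contDiff_deltaFun a n).continuous.continuousOn.mul
      (hc.mono (tsupport_deltaFun a n))).integrableOn_compact (hasCompactSupport_deltaFun a n)
  · exact hc.continuousAt ((isOpen_localDomain a).mem_nhds
      (extChartAt_mem_localDomain (mem_localSource a)))

theorem tendsto_kernelPairing_deltaSection (C : BoxSection m F E) {a b : M} (u : E a →L[ℝ] ℝ)
    (v : E b →L[ℝ] ℝ) :
    Filter.Tendsto (fun n => kernelPairing C (deltaSection u n) (deltaSection v n)) Filter.atTop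
      (𝓝 (boxForm C a b u v)) := by
  have ha : a ∈ (trivializationAt F E a).baseSet := FiberBundle.mem_baseSet_trivializationAt' a
  have heq : ∀ n w, kernelIntegrand C a b (fun y => deltaFun m F E a n y • fiberForm u)
      (fun y => deltaFun m F E b n y • fiberForm v) w =
      deltaFun m F E a n w.1 * deltaFun m F E b n w.2 *
        fiberForm v (kernelRep C a b w (fiberForm u)) := fun n w => by
    simp only [kernelIntegrand, map_smul, smul_apply, smul_eq_mul]
    ring
  have hloc : ∀ {a : M} (u : E a →L[ℝ] ℝ) n,
      IsLocalTest m F E a fun y => deltaFun m F E a n y • fiberForm u := fun u n =>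
    isLocalTest_smul_const (contDiff_deltaFun _ n) (hasCompactSupport_deltaFun _ n)
      (tsupport_deltaFun _ n) _
  have hvol : (volume : Measure (EuclideanSpace ℝ (Fin m) ×
      EuclideanSpace ℝ (Fin m))).IsAddHaarMeasure :=
    Measure.prod.instIsAddHaarMeasure volume volume
  have h1 := tendsto_integral_mul_of_support_subset_ball (μ := volume)
    (k := fun n (w : EuclideanSpace ℝ (Fin m) × EuclideanSpace ℝ (Fin m)) =>
      deltaFun m F E a n w.1 * deltaFun m F E b n w.2)
    (h := fun w => fiberForm v (kernelRep C a b w (fiberForm u)))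
    (c := (extChartAt (𝓡 m) a a, extChartAt (𝓡 m) b b))
    (fun n w => mul_nonneg (deltaFun_nonneg a n _) (deltaFun_nonneg b n _))
    (fun n => ?_) (fun ε hε => ?_) (fun n => ?_) ?_
  · have h2 : fiberForm v (kernelRep C a b (extChartAt (𝓡 m) a a, extChartAt (𝓡 m) b b)
        (fiberForm u)) = boxForm C a b u v := by
      have h3 := boxForm_eq_trivializationAt C (b := b) (z := b) ha (fiberForm u) (fiberForm v)
      rw [fiberForm_comp, fiberForm_comp] at h3
      rw [h3]
      exact congrArg (fun p : M × M => fiberForm (F := F) v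
        ((trivializationAt ((F →L[ℝ] ℝ) →L[ℝ] F) (BoxBundle m E) (a, b) ⟨p, C p⟩).2 (fiberForm u)))
        (Prod.ext (extChartAt_to_inv (I := 𝓡 m) a) (extChartAt_to_inv (I := 𝓡 m) b))
    rw [h2] at h1
    refine h1.congr fun n => ?_
    rw [deltaSection, deltaSection, kernelPairing_localTest]
    exact integral_congr_ae (Filter.Eventually.of_forall fun w => (heq n w).symm)
  · refine (integral_prod_mul _ _).trans ?_
    rw [integral_deltaFun, integral_deltaFun, one_mul]
  · filter_upwards [eventually_deltaFun (m := m) (F := F) (E := E) a hε,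
      eventually_deltaFun (m := m) (F := F) (E := E) b hε] with n h1 h2 w hw
    rw [Prod.dist_eq]
    exact max_lt (h1 _ (left_ne_zero_of_mul hw)) (h2 _ (right_ne_zero_of_mul hw))
  · refine Integrable.congr ?_ (Filter.Eventually.of_forall (heq n))
    exact (contDiff_kernelIntegrand C (hloc u n) (hloc v n)).continuous.integrable_of_hasCompactSupport
      (hasCompactSupport_kernelIntegrand C (hloc u n) (hloc v n))
  · refine (fiberForm v).continuous.continuousAt.comp ?_
    refine ContinuousAt.clm_apply ?_ continuousAt_const
    exact (contDiffOn_kernelRep C a b).continuousOn.continuousAt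
      (((isOpen_localDomain a).prod (isOpen_localDomain b)).mem_nhds
        ⟨extChartAt_mem_localDomain (mem_localSource a),
          extChartAt_mem_localDomain (mem_localSource b)⟩)

theorem toGeneralized_injective :
    Function.Injective (toGeneralized : SmoothSection m F E → GeneralizedSection m F E) := by
  intro s t hst
  refine DFunLike.ext _ _ fun a => ?_
  have ha : a ∈ (trivializationAt F E a).baseSet := FiberBundle.mem_baseSet_trivializationAt' a
  have h1 : ∀ u : E a →L[ℝ] ℝ, u (s a) = u (t a) := fun u =>
    tendsto_nhds_unique (tendsto_toGeneralized_deltaSection s u)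
      (hst ▸ tendsto_toGeneralized_deltaSection t u)
  have h2 : (trivializationAt F E a).continuousLinearMapAt ℝ a (s a) =
      (trivializationAt F E a).continuousLinearMapAt ℝ a (t a) := by
    refine (SeparatingDual.eq_iff_forall_dual_eq (R := ℝ)).2 fun ξ => ?_
    exact h1 (ξ.comp ((trivializationAt F E a).continuousLinearMapAt ℝ a))
  have h3 := congrArg ((trivializationAt F E a).symmL ℝ a) h2
  rwa [Trivialization.symmL_continuousLinearMapAt _ ha,
    Trivialization.symmL_continuousLinearMapAt _ ha] at h3

end Delta

section GaussianLimits

variable {Ω : Type*} [MeasurableSpace Ω] {P : Measure Ω} [IsProbabilityMeasure P]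

theorem integral_eq_zero_of_map_eq_gaussianReal {Z : Ω → ℝ} (hZ : Measurable Z) {v : ℝ≥0}
    (h : P.map Z = gaussianReal 0 v) : ∫ z, Z z ∂P = 0 := by
  have h1 := integral_map (μ := P) hZ.aemeasurable (f := fun x : ℝ => x)
    aestronglyMeasurable_id
  rw [← h1, h, integral_id_gaussianReal]

theorem memLp_two_of_map_eq_gaussianReal {Z : Ω → ℝ} (hZ : Measurable Z) {v : ℝ≥0}
    (h : P.map Z = gaussianReal 0 v) : MemLp Z 2 P := by
  have h1 : MemLp id 2 (P.map Z) := by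
    rw [h]
    exact memLp_id_gaussianReal 2
  exact h1.comp_of_map hZ.aemeasurable

theorem integral_sq_eq_of_map_eq_gaussianReal {Z : Ω → ℝ} (hZ : Measurable Z) {v : ℝ≥0}
    (h : P.map Z = gaussianReal 0 v) : ∫ z, Z z ^ 2 ∂P = v := by
  have h1 := integral_map (μ := P) hZ.aemeasurable (f := fun x : ℝ => x ^ 2)
    (by fun_prop)
  have h2 := variance_id_gaussianReal (μ := 0) (v := v)
  rw [variance_of_integral_eq_zero aemeasurable_id integral_id_gaussianReal] at h2
  rw [← h1, h]
  exact h2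

/-- A pointwise limit of centered Gaussian variables is a centered Gaussian variable, if the
variances converge. -/
theorem map_eq_gaussianReal_of_tendsto {Z : ℕ → Ω → ℝ} {Z₀ : Ω → ℝ} {v : ℕ → ℝ≥0} {v₀ : ℝ≥0}
    (hZ : ∀ k, Measurable (Z k)) (hZ₀ : Measurable Z₀)
    (hlim : ∀ z, Filter.Tendsto (fun k => Z k z) Filter.atTop (𝓝 (Z₀ z)))
    (hv : Filter.Tendsto v Filter.atTop (𝓝 v₀)) (h : ∀ k, P.map (Z k) = gaussianReal 0 (v k)) :
    P.map Z₀ = gaussianReal 0 v₀ := by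
  have : IsProbabilityMeasure (P.map Z₀) := Measure.isProbabilityMeasure_map hZ₀.aemeasurable
  refine Measure.ext_of_charFun (funext fun t => ?_)
  have hchar : ∀ W : Ω → ℝ, Measurable W →
      charFun (P.map W) t = ∫ z, Complex.exp (t * W z * Complex.I) ∂P := fun W hW => by
    rw [charFun_apply_real, integral_map hW.aemeasurable]
    fun_prop
  have h1 : Filter.Tendsto (fun k => charFun (P.map (Z k)) t) Filter.atTop
      (𝓝 (charFun (P.map Z₀) t)) := by
    rw [hchar Z₀ hZ₀]
    simp only [hchar _ (hZ _)]
    refine tendsto_integral_of_dominated_convergence (fun _ => 1) (fun k => ?_)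
      (integrable_const _) (fun k => Filter.Eventually.of_forall fun z => ?_)
      (Filter.Eventually.of_forall fun z => ?_)
    · have := hZ k
      fun_prop
    · rw [← Complex.ofReal_mul, Complex.norm_exp_ofReal_mul_I]
    · have hc : Continuous fun x : ℝ => Complex.exp (t * x * Complex.I) := by fun_prop
      exact (hc.tendsto (Z₀ z)).comp (hlim z)
  have h2 : Filter.Tendsto (fun k => charFun (P.map (Z k)) t) Filter.atTop
      (𝓝 (charFun (gaussianReal 0 v₀) t)) := by
    simp only [h, charFun_gaussianReal]
    have hc : Continuous fun r : ℝ≥0 =>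
        Complex.exp (t * (0 : ℝ) * Complex.I - (r : ℝ) * t ^ 2 / 2) := by fun_prop
    exact (hc.tendsto v₀).comp hv
  exact tendsto_nhds_unique h1 h2

end GaussianLimits

section Induced

variable {m : ℕ} {M : Type*} [TopologicalSpace M] [ChartedSpace (EuclideanSpace ℝ (Fin m)) M]
  [IsManifold (𝓡 m) ∞ M]
  {F : Type*} [NormedAddCommGroup F] [NormedSpace ℝ F] [FiniteDimensional ℝ F]
  {E : M → Type*} [TopologicalSpace (TotalSpace F E)] [∀ x, TopologicalSpace (E x)]
  [∀ x, AddCommGroup (E x)] [∀ x, Module ℝ (E x)] [FiberBundle F E] [VectorBundle ℝ F E]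
  [∀ x, IsTopologicalAddGroup (E x)] [∀ x, ContinuousSMul ℝ (E x)]
  [ContMDiffVectorBundle ∞ F E (𝓡 m)] [T2Space M] [CompactSpace M]
  {Γ : Measure (GeneralizedSection m F E)} {C : BoxSection m F E}

theorem measurable_toGeneralized :
    Measurable (toGeneralized : SmoothSection m F E → GeneralizedSection m F E) :=
  fun _ hs => ⟨_, hs, rfl⟩

theorem map_inducedMeasure (hΓ : IsSmoothGaussianMeasure Γ C) :
    (inducedMeasure Γ).map toGeneralized = Γ := by
  have hrange : ∀ᵐ T ∂Γ, T ∈ Set.range (toGeneralized (m := m) (F := F) (E := E)) :=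
    ae_exists_toGeneralized_eq hΓ
  have himage : ∀ B : Set (GeneralizedSection m F E),
      toGeneralized '' (toGeneralized ⁻¹' B) =ᵐ[Γ] B := by
    intro B
    rw [Set.image_preimage_eq_inter_range]
    filter_upwards [hrange] with T hT
    exact propext ⟨fun h => h.1, fun h => ⟨h, hT⟩⟩
  have hnull : ∀ s : Set (SmoothSection m F E), MeasurableSet s →
      NullMeasurableSet (toGeneralized '' s) Γ := by
    rintro _ ⟨B, hB, rfl⟩
    exact hB.nullMeasurableSet.congr (himage B).symm
  refine Measure.ext fun B hB => ?_
  rw [Measure.map_apply measurable_toGeneralized hB, inducedMeasure,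
    Measure.comap_apply₀ _ _ toGeneralized_injective hnull
      (measurable_toGeneralized hB).nullMeasurableSet]
  exact measure_congr (himage B)

theorem isProbabilityMeasure_inducedMeasure (hΓ : IsSmoothGaussianMeasure Γ C) :
    IsProbabilityMeasure (inducedMeasure Γ) := by
  have := hΓ.isProbabilityMeasure
  have h : IsProbabilityMeasure ((inducedMeasure Γ).map toGeneralized) := by
    rwa [map_inducedMeasure hΓ]
  exact (Measure.isProbabilityMeasure_map_iff measurable_toGeneralized.aemeasurable).1 h

theorem measurable_toGeneralized_apply (φ : TestSection m F E) :
    Measurable fun s : SmoothSection m F E => toGeneralized s φ :=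
  (measurable_eval φ).comp measurable_toGeneralized

theorem measurable_pointEval {a : M} (u : E a →L[ℝ] ℝ) :
    Measurable fun s : SmoothSection m F E => u (s a) :=
  measurable_of_tendsto_metrizable (fun n => measurable_toGeneralized_apply (deltaSection u n))
    (tendsto_pi_nhds.2 fun s => tendsto_toGeneralized_deltaSection s u)

theorem integral_eval_sum_sq (hΓ : IsSmoothGaussianMeasure Γ C) {ι : Type*} [Fintype ι]
    (t : ι → ℝ) (φ : ι → TestSection m F E) :
    ∫ T : GeneralizedSection m F E, T (∑ i, t i • φ i) ^ 2 ∂Γ =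
      ∑ i, ∑ j, t i * t j * kernelPairing C (φ i) (φ j) := by
  have h1 : ∀ T : GeneralizedSection m F E, T (∑ i, t i • φ i) ^ 2 =
      ∑ i, ∑ j, t i * t j * (T (φ i) * T (φ j)) := by
    intro T
    rw [generalizedSection_map_sum, pow_two, Finset.sum_mul_sum]
    refine Finset.sum_congr rfl fun i _ => Finset.sum_congr rfl fun j _ => ?_
    have h2 : ∀ i, T (t i • φ i) = t i * T (φ i) := fun i => map_smul T (t i) (φ i)
    rw [h2, h2]
    ring
  have hint : ∀ i j, Integrable
      (fun T : GeneralizedSection m F E => t i * t j * (T (φ i) * T (φ j))) Γ := fun i j =>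
    ((hΓ.memLp_eval (φ i)).integrable_mul (hΓ.memLp_eval (φ j))).const_mul _
  simp only [h1]
  rw [integral_finsetSum _ fun i _ => integrable_finsetSum _ fun j _ => hint i j]
  refine Finset.sum_congr rfl fun i _ => ?_
  rw [integral_finsetSum _ fun j _ => hint i j]
  refine Finset.sum_congr rfl fun j _ => ?_
  rw [integral_const_mul, hΓ.covariance_eq]

/-- The law of a linear combination of point evaluations. -/
theorem exists_map_sum_pointEval_eq_gaussianReal (hΓ : IsSmoothGaussianMeasure Γ C)
    {ι : Type*} [Fintype ι] (t : ι → ℝ) (x : ι → M) (u : ∀ i, E (x i) →L[ℝ] ℝ) :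
    ∃ v : ℝ≥0, (v : ℝ) = ∑ i, ∑ j, t i * t j * boxForm C (x i) (x j) (u i) (u j) ∧
      (inducedMeasure Γ).map (fun s : SmoothSection m F E => ∑ i, t i * u i (s (x i))) =
        gaussianReal 0 v := by
  have hP := isProbabilityMeasure_inducedMeasure hΓ
  have hΓP := hΓ.isProbabilityMeasure
  let Φ : ℕ → TestSection m F E := fun k => ∑ i, t i • deltaSection (u i) k
  choose v hv using fun k => hΓ.map_eq (Φ k)
  have hvk : ∀ k, (v k : ℝ) =
      ∑ i, ∑ j, t i * t j * kernelPairing C (deltaSection (u i) k) (deltaSection (u j) k) :=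
    fun k => by
      rw [← integral_sq_eq_of_map_eq_gaussianReal (measurable_eval (Φ k)) (hv k)]
      exact integral_eval_sum_sq hΓ t fun i => deltaSection (u i) k
  have hlimv : Filter.Tendsto (fun k => (v k : ℝ)) Filter.atTop
      (𝓝 (∑ i, ∑ j, t i * t j * boxForm C (x i) (x j) (u i) (u j))) := by
    simp only [hvk]
    exact tendsto_finsetSum _ fun i _ => tendsto_finsetSum _ fun j _ =>
      (tendsto_kernelPairing_deltaSection C (u i) (u j)).const_mul _
  have hnonneg : 0 ≤ ∑ i, ∑ j, t i * t j * boxForm C (x i) (x j) (u i) (u j) :=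
    ge_of_tendsto' hlimv fun k => (v k).2
  refine ⟨⟨_, hnonneg⟩, rfl, ?_⟩
  refine map_eq_gaussianReal_of_tendsto (Z := fun k s => toGeneralized s (Φ k)) (v := v)
    (fun k => measurable_toGeneralized_apply (Φ k))
    (Finset.measurable_sum _ fun i _ => (measurable_pointEval (u i)).const_mul _)
    (fun s => ?_) (NNReal.tendsto_coe.1 hlimv) fun k => ?_
  · have h1 : ∀ k, toGeneralized s (Φ k) = ∑ i, t i * toGeneralized s (deltaSection (u i) k) :=
      fun k => by
        simp only [Φ]
        rw [generalizedSection_map_sum]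
        exact Finset.sum_congr rfl fun i _ => map_smul (toGeneralized s) _ _
    simp only [h1]
    exact tendsto_finsetSum _ fun i _ => (tendsto_toGeneralized_deltaSection s (u i)).const_mul _
  · rw [← hv k]
    conv_rhs => rw [← map_inducedMeasure hΓ]
    rw [Measure.map_map (measurable_eval _) measurable_toGeneralized]
    rfl

theorem boxForm_comm (hΓ : IsSmoothGaussianMeasure Γ C) {a b : M} (u : E a →L[ℝ] ℝ)
    (v : E b →L[ℝ] ℝ) : boxForm C a b u v = boxForm C b a v u := by
  refine tendsto_nhds_unique (tendsto_kernelPairing_deltaSection C u v)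
    ((tendsto_kernelPairing_deltaSection C v u).congr fun n => ?_)
  rw [← hΓ.covariance_eq, ← hΓ.covariance_eq]
  simp only [mul_comm]

theorem exists_map_pointEval_eq_gaussianReal (hΓ : IsSmoothGaussianMeasure Γ C) {a : M}
    (u : E a →L[ℝ] ℝ) : ∃ v : ℝ≥0, (v : ℝ) = boxForm C a a u u ∧
      (inducedMeasure Γ).map (fun s : SmoothSection m F E => u (s a)) = gaussianReal 0 v := by
  obtain ⟨v, hv, h⟩ := exists_map_sum_pointEval_eq_gaussianReal hΓ (ι := Unit) (fun _ => 1)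
    (fun _ => a) fun _ => u
  refine ⟨v, by simpa using hv, ?_⟩
  simpa using h

theorem integral_pointEval_mul (hΓ : IsSmoothGaussianMeasure Γ C) {a b : M} (u : E a →L[ℝ] ℝ)
    (v : E b →L[ℝ] ℝ) :
    ∫ s : SmoothSection m F E, u (s a) * v (s b) ∂(inducedMeasure Γ) = boxForm C a b u v := by
  have hP := isProbabilityMeasure_inducedMeasure hΓ
  have hsq : ∀ {c : M} (w : E c →L[ℝ] ℝ),
      ∫ s : SmoothSection m F E, w (s c) ^ 2 ∂(inducedMeasure Γ) = boxForm C c c w w ∧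
      MemLp (fun s : SmoothSection m F E => w (s c)) 2 (inducedMeasure Γ) := fun w => by
    obtain ⟨r, hr, h⟩ := exists_map_pointEval_eq_gaussianReal hΓ w
    exact ⟨(integral_sq_eq_of_map_eq_gaussianReal (measurable_pointEval w) h).trans hr,
      memLp_two_of_map_eq_gaussianReal (measurable_pointEval w) h⟩
  have hsum : ∫ s : SmoothSection m F E, (u (s a) + v (s b)) ^ 2 ∂(inducedMeasure Γ) =
      boxForm C a a u u + boxForm C a b u v + (boxForm C b a v u + boxForm C b b v v) := by
    obtain ⟨r, hr, h⟩ := exists_map_sum_pointEval_eq_gaussianReal hΓ (ι := Bool) (fun _ => 1)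
      (fun i => bif i then a else b) fun i => match i with
        | true => u
        | false => v
    simp only [Fintype.sum_bool, one_mul] at hr h
    exact (integral_sq_eq_of_map_eq_gaussianReal
      ((measurable_pointEval u).add (measurable_pointEval v)) h).trans hr
  have hexp : ∀ s : SmoothSection m F E, (u (s a) + v (s b)) ^ 2 =
      u (s a) ^ 2 + 2 * (u (s a) * v (s b)) + v (s b) ^ 2 := fun s => by ring
  simp only [hexp] at hsum
  have hprod : Integrable (fun s : SmoothSection m F E => 2 * (u (s a) * v (s b)))
      (inducedMeasure Γ) := ((hsq u).2.integrable_mul (hsq v).2).const_mul 2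
  have hadd : Integrable (fun s : SmoothSection m F E => u (s a) ^ 2 + 2 * (u (s a) * v (s b)))
      (inducedMeasure Γ) := (hsq u).2.integrable_sq.add hprod
  rw [integral_add hadd (hsq v).2.integrable_sq,
    integral_add (hsq u).2.integrable_sq hprod, integral_const_mul, (hsq u).1, (hsq v).1,
    boxForm_comm hΓ v u] at hsum
  linarith

theorem hasGaussianLaw_pointEval (hΓ : IsSmoothGaussianMeasure Γ C) {ι : Type*} [Fintype ι]
    (x : ι → M) (u : ∀ i, E (x i) →L[ℝ] ℝ) :
    HasGaussianLaw (fun (s : SmoothSection m F E) (i : ι) => u i (s (x i)))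
      (inducedMeasure Γ) := by
  classical
  refine ⟨isGaussian_of_map_eq_gaussianReal fun L => ?_⟩
  obtain ⟨v, -, h⟩ := exists_map_sum_pointEval_eq_gaussianReal hΓ
    (fun i => L (Pi.single i 1)) x u
  refine ⟨0, v, ?_⟩
  rw [Measure.map_map L.continuous.measurable
    (measurable_pi_lambda _ fun i => measurable_pointEval (u i)), ← h]
  congr 1
  funext s
  rw [Function.comp_apply]
  conv_lhs => rw [pi_eq_sum_univ' fun i => u i (s (x i)), map_sum]
  refine Finset.sum_congr rfl fun i _ => ?_
  rw [map_smul, smul_eq_mul, mul_comm]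

end Induced

end GaussianSections

end

theorem proposition1p5
    {m : ℕ} {M : Type*} [TopologicalSpace M] [ChartedSpace (EuclideanSpace ℝ (Fin m)) M]
    [IsManifold (𝓡 m) ∞ M] [T2Space M] [CompactSpace M] [ConnectedSpace M]
    {F : Type*} [NormedAddCommGroup F] [NormedSpace ℝ F] [FiniteDimensional ℝ F]
    {E : M → Type*} [TopologicalSpace (TotalSpace F E)] [∀ x, TopologicalSpace (E x)]
    [∀ x, AddCommGroup (E x)] [∀ x, Module ℝ (E x)] [FiberBundle F E] [VectorBundle ℝ F E]
    [∀ x, IsTopologicalAddGroup (E x)] [∀ x, ContinuousSMul ℝ (E x)]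
    [ContMDiffVectorBundle ∞ F E (𝓡 m)]
    (Γ : Measure (GaussianSections.GeneralizedSection m F E))
    (C : GaussianSections.BoxSection m F E)
    (hΓ : GaussianSections.IsSmoothGaussianMeasure Γ C)
    (n : ℕ) (hn : 0 < n) (x : Fin n → M) (u : ∀ i, E (x i) →L[ℝ] ℝ) :
    Measurable (fun (φ : GaussianSections.SmoothSection m F E) (i : Fin n) => u i (φ (x i))) ∧
    HasGaussianLaw
      (fun (φ : GaussianSections.SmoothSection m F E) (i : Fin n) => u i (φ (x i)))
      (GaussianSections.inducedMeasure Γ) ∧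
    (∀ i, ∫ φ, u i (φ (x i)) ∂(GaussianSections.inducedMeasure Γ) = 0) ∧
    ∀ i j, ∫ φ, u i (φ (x i)) * u j (φ (x j)) ∂(GaussianSections.inducedMeasure Γ) =
      GaussianSections.boxForm C (x i) (x j) (u i) (u j) := by
  refine ⟨measurable_pi_lambda _ fun i => GaussianSections.measurable_pointEval (u i),
    GaussianSections.hasGaussianLaw_pointEval hΓ x u, fun i => ?_,
    fun i j => GaussianSections.integral_pointEval_mul hΓ (u i) (u j)⟩
  have hP := GaussianSections.isProbabilityMeasure_inducedMeasure hΓ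
  obtain ⟨v, -, h⟩ := GaussianSections.exists_map_pointEval_eq_gaussianReal hΓ (u i)
  exact GaussianSections.integral_eq_zero_of_map_eq_gaussianReal
    (GaussianSections.measurable_pointEval (u i)) h
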